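/- **Setting.** Let $\Omega\subset\mathbb R^d$ be compact and convex, let $\mathcal P(\Omega)$ be the set of Borel probability measures on $\Omega$ and let $\mathrm W$ be the Wasserstein-2 distance, $\mathrm W(\mu,\nu)^2=\inf_\pi\int|x-y|^2\,\mathrm d\pi(x,y)$ over all couplings $\pi$ of $\mu$ and $\nu$. Suppose that the following data are given. (i) *Parameter manifold.* $\mathcal S$ is a compact connected subset of an $m$-dimensional smooth Riemannian manifold $M$ without boundary, with geodesic distance $d$ and norms $\|\cdot\|_\theta$ on $T_\theta M$ (for instance $\mathcal S=M$ a compact manifold without boundary, or a compact geodesically convex subset with boundary). $\mathcal D$ is a set of pairs $(\theta,\eta)$ with $\theta\in\mathcal S$, $\eta\in T_\theta M$, such that for $(\theta,\eta)\in\mathcal D$: $(\theta,t\eta)\in\mathcal D$ for $t\in[0,1]$; $\exp_\theta(\eta)$ is defined, and $\gamma(t)=\exp_\theta(t\eta)$, $t\in[0,1]$, is a geodesic in $\mathcal S$ with $\|\dot\gamma(t)\|_{\gamma(t)}=\|\eta\|_\theta=d(\theta,\exp_\theta(\eta))$. For all $\theta_0,\theta_1\in\mathcal S$ there is $\eta$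 with $(\theta_0,\eta)\in\mathcal D$ and $\exp_{\theta_0}(\eta)=\theta_1$. (ii) *Embedding.* $E:\mathcal S\to\mathcal P(\Omega)$, $\theta\mapsto\lambda_\theta$, is bi-Lipschitz onto its image $\Lambda:=E(\mathcal S)$ with respect to $d$ and $\mathrm W$, and every $\lambda\in\Lambda$ is absolutely continuous with respect to the Lebesgue measure. (iii) *Velocity fields.* For $\theta\in\mathcal S$, $B_\theta$ is a linear map from $T_\theta M$ to the $C^1$ gradient vector fields on $\mathbb R^d$, and there is $C\in(0,\infty)$ such that for all $(\theta,\eta)\in\mathcal D$, $x\in\mathbb R^d$, $t\in[0,1]$, with $\gamma(t)=\exp_\theta(t\eta)$, $$C^{-1}\|\eta\|_\theta\le\|B_\theta\eta\|_{L^2(\lambda_\theta)}\le C\|\eta\|_\theta,\qquad \|B_\theta\eta\|_{C^1(\mathbb R^d)}\le C\|\eta\|_\theta,\qquad \bigl|\partial_t[B_{\gamma(t)}\dot\gamma(t)](x)\bigr|\le C\|\eta\|_\theta^2 .$$ (iv) *Consistency.* For every Lipschitz path $\gamma:[0,1]\to\mathcal S$, if $\varphi:[0,1]\times\Omega\to\mathbb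 R^d$ is the flow of $v(t,\cdot)=B_{\gamma(t)}\dot\gamma(t)$, i.e. $\varphi(0,x)=x$ and $\partial_t\varphi(t,x)=v(t,\varphi(t,x))$ for a.e. $t$, with $\varphi(\cdot,x)$ absolutely continuous, then $\lambda_{\gamma(t)}=\varphi(t,\cdot)_\#\lambda_{\gamma(0)}$ for all $t\in[0,1]$. **Energy.** For a curve $\rho\in\mathrm{Lip}([0,1];(\mathcal P(\Omega),\mathrm W))$ let $\mathcal{CE}(\rho)$ be the set of measurable velocity fields $v$, with $v(t)\in L^2(\rho(t);\mathbb R^d)$ for each $t$ and $\int_0^1\int|v(t)|\,\mathrm d\rho(t)\,\mathrm dt<\infty$, such that $$\int_0^1\!\!\int_\Omega\partial_t\phi(t,\cdot)\,\mathrm d\rho(t)\,\mathrm dt+\int_0^1\!\!\int_\Omega\langle\nabla\phi(t,\cdot),v(t)\rangle\,\mathrm d\rho(t)\,\mathrm dt=\int_\Omega\phi(1,\cdot)\,\mathrm d\rho(1)-\int_\Omega\phi(0,\cdot)\,\mathrm d\rho(0)\quad\text{for all }\phi\in C^1([0,1]\times\Omega),$$ and set $\mathrm{energy}(\rho)=\inf\{\int_0^1\|v(t)\|^2_{L^2(\rho(t))}\,\mathrm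 dt: v\in\mathcal{CE}(\rho)\}\in[0,\infty]$. **Proposition.** For $\mu,\nu\in\Lambda$ set $$\mathrm W_\Lambda(\mu,\nu)=\inf\bigl\{\mathrm{energy}(\rho)^{1/2}:\ \rho\in\mathrm{Lip}([0,1];(\Lambda,\mathrm W)),\ \rho(0)=\mu,\ \rho(1)=\nu\bigr\}.$$ Then $\mathrm W_\Lambda$ is a metric on $\Lambda$ with finite diameter (that is, $\mathrm W_\Lambda$ is bounded by a finite constant, vanishes exactly on the diagonal, is symmetric and satisfies the triangle inequality), and for all $\mu,\nu\in\Lambda$ the infimum is attained by an admissible curve. -/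

import Mathlib

open Set MeasureTheory Manifold
open scoped ENNReal NNReal ContDiff Bundle

/-! ### The Wasserstein-2 distance and the energy of curves of measures

All measures are Borel probability measures on `ℝ^d`; a probability measure on a compact set `Ω`
is a probability measure on `ℝ^d` that gives mass zero to the complement of `Ω`.
Curves `[0,1] → X` are functions on `ℝ` of which only the restriction to `[0,1]` is used. -/

namespace WSub

noncomputable section

/-- Euclidean space `ℝ^d`. -/
abbrev Eu (d : ℕ) : Type := EuclideanSpace ℝ (Fin d)

/-- Couplings of `μ` and `ν`. -/
def couplings {d : ℕ} (μ ν : ProbabilityMeasure (Eu d)) : Set (Measure (Eu d × Eu d)) :=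
  {q | q.fst = (μ : Measure (Eu d)) ∧ q.snd = (ν : Measure (Eu d))}

/-- The Wasserstein-2 distance, with values in `[0,∞]`. -/
def W2 {d : ℕ} (μ ν : ProbabilityMeasure (Eu d)) : ℝ≥0∞ :=
  (⨅ q ∈ couplings μ ν, ∫⁻ z, ‖z.1 - z.2‖ₑ ^ 2 ∂q) ^ (1 / 2 : ℝ)

/-- `ρ ∈ Lip([0,1]; (Λ, W))` for a set `Λ` of probability measures. -/
def IsLipCurveIn {d : ℕ} (Λ : Set (ProbabilityMeasure (Eu d)))
    (ρ : ℝ → ProbabilityMeasure (Eu d)) : Prop :=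
  (∀ t ∈ Icc (0 : ℝ) 1, ρ t ∈ Λ) ∧
    ∃ K : ℝ≥0, ∀ s ∈ Icc (0 : ℝ) 1, ∀ t ∈ Icc (0 : ℝ) 1,
      W2 (ρ s) (ρ t) ≤ (K : ℝ≥0∞) * ENNReal.ofReal |s - t|

/-- `CE ρ`: the measurable fields `v`, with `v t` square integrable for `ρ t`, that solve
the continuity equation with `ρ` on `[0,1]` in the distributional sense. The test functions in
`C¹([0,1] × Ω)` are the restrictions of `C¹` functions on `ℝ × ℝ^d`. Finiteness of
`∫∫ ‖v‖ dρ dt` makes the second integral of the equation meaningful; it holds whenever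
`∫∫ ‖v‖² dρ dt` is finite. -/
structure IsCE {d : ℕ} (ρ : ℝ → ProbabilityMeasure (Eu d)) (v : ℝ → Eu d → Eu d) : Prop where
  measurable : Measurable (Function.uncurry v)
  memLp : ∀ t ∈ Icc (0 : ℝ) 1, MemLp (v t) 2 (ρ t : Measure (Eu d))
  integrable : ∫⁻ t in Icc (0 : ℝ) 1, ∫⁻ x, ‖v t x‖ₑ ∂(ρ t : Measure (Eu d)) < ⊤
  equation : ∀ φ : ℝ → Eu d → ℝ, ContDiff ℝ 1 (Function.uncurry φ) →
    (∫ t in Icc (0 : ℝ) 1, ∫ x, deriv (fun s => φ s x) t ∂(ρ t : Measure (Eu d))) +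
      (∫ t in Icc (0 : ℝ) 1, ∫ x, inner ℝ (gradient (φ t) x) (v t x) ∂(ρ t : Measure (Eu d))) =
    (∫ x, φ 1 x ∂(ρ 1 : Measure (Eu d))) - ∫ x, φ 0 x ∂(ρ 0 : Measure (Eu d))

/-- The energy of a curve: the infimum of `∫₀¹ ‖v t‖²_{L²(ρ t)} dt` over `CE ρ`,
with value `∞` if there is no field of finite energy. -/
def energy {d : ℕ} (ρ : ℝ → ProbabilityMeasure (Eu d)) : ℝ≥0∞ :=
  ⨅ (v : ℝ → Eu d → Eu d) (_ : IsCE ρ v),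
    ∫⁻ t in Icc (0 : ℝ) 1, ∫⁻ x, ‖v t x‖ₑ ^ 2 ∂(ρ t : Measure (Eu d))

/-- The curves admissible for the distance between `μ` and `ν` in `Λ`. -/
def admissible {d : ℕ} (Λ : Set (ProbabilityMeasure (Eu d)))
    (μ ν : ProbabilityMeasure (Eu d)) : Set (ℝ → ProbabilityMeasure (Eu d)) :=
  {ρ | IsLipCurveIn Λ ρ ∧ ρ 0 = μ ∧ ρ 1 = ν}

/-- The geodesic restriction of the Wasserstein distance to `Λ`. -/
def WRestr {d : ℕ} (Λ : Set (ProbabilityMeasure (Eu d)))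
    (μ ν : ProbabilityMeasure (Eu d)) : ℝ≥0∞ :=
  ⨅ ρ ∈ admissible Λ μ ν, energy ρ ^ (1 / 2 : ℝ)

/-! ### Geodesics and the exponential map of a Riemannian manifold -/

section Riemannian

variable {m : ℕ} {M : Type*} [MetricSpace M] [ChartedSpace (Eu m) M] [IsManifold (𝓡 m) ∞ M]

/-- The velocity of a curve, as a point of the tangent bundle. -/
def velocity (γ : ℝ → M) (t : ℝ) : TangentBundle (𝓡 m) M :=
  ⟨γ t, mfderiv 𝓘(ℝ, ℝ) (𝓡 m) γ t (1 : ℝ)⟩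

variable [Bundle.RiemannianBundle (fun x : M => TangentSpace (𝓡 m) x)]

/-- The Riemannian metric in the chart at `p`: the value at the coordinate point `y`
on the coordinate vectors `u` and `w`, that is `∑ g_ij(y) u_i w_j`. -/
def chartMetric (p : M) (y u w : Eu m) : ℝ :=
  inner ℝ (mfderiv 𝓘(ℝ, Eu m) (𝓡 m) (extChartAt (𝓡 m) p).symm y u)
    (mfderiv 𝓘(ℝ, Eu m) (𝓡 m) (extChartAt (𝓡 m) p).symm y w)

/-- `γ` is a (Riemannian) geodesic on the open set `J` of times: it is smooth there, and in
coordinates `c` around each of its points it solves the geodesic equation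
`d/dt (g_c(c', w)) = 1/2 ∂_w g_c(c', c')` for all `w`, which after raising the index is
`c'' + Γ(c', c') = 0`. -/
def IsGeodesicOn (γ : ℝ → M) (J : Set ℝ) : Prop :=
  ContMDiffOn 𝓘(ℝ, ℝ) (𝓡 m) ∞ γ J ∧
  ∀ t₀ ∈ J, ∀ w : Eu m,
    let c : ℝ → Eu m := fun t => extChartAt (𝓡 m) (γ t₀) (γ t)
    HasDerivAt (fun t => chartMetric (γ t₀) (c t) (deriv c t) w)
      (1 / 2 * fderiv ℝ (fun y => chartMetric (γ t₀) y (deriv c t₀) (deriv c t₀)) (c t₀) w) t₀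

/-- `γ` is a geodesic, defined on a neighbourhood of `[0,1]`, with initial point and initial
velocity given by `p`. -/
def IsExpCurve (p : TangentBundle (𝓡 m) M) (γ : ℝ → M) : Prop :=
  ∃ ε : ℝ, 0 < ε ∧ IsGeodesicOn (m := m) γ (Ioo (-ε) (1 + ε)) ∧ velocity (m := m) γ 0 = p

open Classical in
/-- The Riemannian exponential map: the value at time `1` of the geodesic with initial data `p`,
and a junk value where this geodesic does not exist up to time `1`. -/
def riemExp (p : TangentBundle (𝓡 m) M) : M :=
  if h : ∃ γ : ℝ → M, IsExpCurve p γ then h.choose 1 else p.proj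

/-- For `p = (θ, η)` the curve `t ↦ exp_θ (t η)`. -/
def expCurve (p : TangentBundle (𝓡 m) M) (t : ℝ) : M :=
  riemExp (⟨p.proj, t • p.snd⟩ : TangentBundle (𝓡 m) M)

/-! ### Parametrized submanifolds of the Wasserstein space -/

/-- `γ ∈ Lip([0,1]; S)`. -/
def IsLipPath (S : Set M) (γ : ℝ → M) : Prop :=
  MapsTo γ (Icc 0 1) S ∧ ∃ K : ℝ≥0, LipschitzOnWith K γ (Icc 0 1)

/-- The velocity field `x ↦ [B_{γ(t)} γ'(t)](x)`. -/
def pathField {d : ℕ} (B : ∀ θ : M, TangentSpace (𝓡 m) θ →ₗ[ℝ] (Eu d → Eu d))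
    (γ : ℝ → M) (t : ℝ) : Eu d → Eu d :=
  B (velocity (m := m) γ t).proj (velocity (m := m) γ t).snd

/-- `φ : [0,1] × Ω → ℝ^d` is a flow of the time dependent field `v`: for every starting point
`x ∈ Ω` the curve `t ↦ φ t x` is absolutely continuous, starts at `x`, and has derivative
`v t (φ t x)` for almost every `t`. -/
def IsFlow {d : ℕ} (Ω : Set (Eu d)) (v φ : ℝ → Eu d → Eu d) : Prop :=
  ∀ x ∈ Ω, φ 0 x = x ∧ AbsolutelyContinuousOnInterval (fun t => φ t x) 0 1 ∧
    ∀ᵐ t ∂(volume.restrict (Icc (0 : ℝ) 1)), HasDerivAt (fun s => φ s x) (v t (φ t x)) t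

/-- The parameter manifold `S` is a compact connected subset of a Riemannian manifold `M` without
boundary (the case `S = univ` is that of a compact manifold without boundary). `D` is a set of
tangent vectors at points of `S` along which the exponential map is defined and yields minimizing
constant speed geodesics in `S`, and any two points of `S` are joined by one of these. -/
structure IsParameterManifold (S : Set M) (D : Set (TangentBundle (𝓡 m) M)) : Prop where
  compact : IsCompact S
  connected : IsConnected S
  base_mem : ∀ p ∈ D, p.proj ∈ S
  starShaped : ∀ p ∈ D, ∀ t ∈ Icc (0 : ℝ) 1,
    (⟨p.proj, t • p.snd⟩ : TangentBundle (𝓡 m) M) ∈ D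
  geodesic : ∀ p ∈ D, IsExpCurve p (expCurve p)
  curve_mem : ∀ p ∈ D, ∀ t ∈ Icc (0 : ℝ) 1, expCurve p t ∈ S
  constSpeed : ∀ p ∈ D, ∀ t ∈ Icc (0 : ℝ) 1, ‖(velocity (m := m) (expCurve p) t).snd‖ = ‖p.snd‖
  minimizing : ∀ p ∈ D, dist p.proj (riemExp p) = ‖p.snd‖
  joined : ∀ θ₀ ∈ S, ∀ θ₁ ∈ S, ∃ p ∈ D, p.proj = θ₀ ∧ riemExp p = θ₁

/-- The embedding `E` of `S` into the absolutely continuous probability measures on `Ω`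
is bi-Lipschitz onto its image. -/
structure IsEmbedding {d : ℕ} (Ω : Set (Eu d)) (S : Set M)
    (E : M → ProbabilityMeasure (Eu d)) : Prop where
  supported : ∀ θ ∈ S, (E θ : Measure (Eu d)) Ωᶜ = 0
  absCont : ∀ θ ∈ S, (E θ : Measure (Eu d)) ≪ volume
  biLipschitz : ∃ L : ℝ, 0 < L ∧ ∀ θ ∈ S, ∀ θ' ∈ S,
    ENNReal.ofReal (L⁻¹ * dist θ θ') ≤ W2 (E θ) (E θ') ∧
      W2 (E θ) (E θ') ≤ ENNReal.ofReal (L * dist θ θ')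

/-- The maps `B θ` take tangent vectors linearly to `C¹` gradient fields on `ℝ^d`, with `L²` norm
equivalent to the Riemannian norm, with a bound on the `C¹` norm, and with a bound on the time
derivative along the geodesics given by `D`. -/
structure IsVelocityMap {d : ℕ} (S : Set M) (D : Set (TangentBundle (𝓡 m) M))
    (E : M → ProbabilityMeasure (Eu d))
    (B : ∀ θ : M, TangentSpace (𝓡 m) θ →ₗ[ℝ] (Eu d → Eu d)) : Prop where
  contDiff : ∀ θ ∈ S, ∀ η : TangentSpace (𝓡 m) θ, ContDiff ℝ 1 (B θ η)
  isGradient : ∀ θ ∈ S, ∀ η : TangentSpace (𝓡 m) θ,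
    ∃ f : Eu d → ℝ, ∀ x, HasGradientAt f (B θ η x) x
  bounds : ∃ C : ℝ, 0 < C ∧ ∀ p ∈ D,
    (ENNReal.ofReal (C⁻¹ * ‖p.snd‖) ≤ eLpNorm (B p.proj p.snd) 2 (E p.proj : Measure (Eu d)) ∧
      eLpNorm (B p.proj p.snd) 2 (E p.proj : Measure (Eu d)) ≤ ENNReal.ofReal (C * ‖p.snd‖)) ∧
    (∀ x, ‖B p.proj p.snd x‖ ≤ C * ‖p.snd‖ ∧ ‖fderiv ℝ (B p.proj p.snd) x‖ ≤ C * ‖p.snd‖) ∧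
    (∀ x, ∀ t ∈ Icc (0 : ℝ) 1, ∃ a : Eu d,
      HasDerivWithinAt (fun s => pathField B (expCurve p) s x) a (Icc 0 1) t ∧
        ‖a‖ ≤ C * ‖p.snd‖ ^ 2)

/-- Consistency of `E` and `B`: along every Lipschitz path `γ` in `S`, the measures `E (γ t)` are
transported by the flow of the field `B_{γ(t)} γ'(t)`. -/
def IsConsistent {d : ℕ} (Ω : Set (Eu d)) (S : Set M) (E : M → ProbabilityMeasure (Eu d))
    (B : ∀ θ : M, TangentSpace (𝓡 m) θ →ₗ[ℝ] (Eu d → Eu d)) : Prop :=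
  ∀ γ : ℝ → M, IsLipPath S γ → ∀ φ : ℝ → Eu d → Eu d, IsFlow Ω (pathField B γ) φ →
    ∀ t ∈ Icc (0 : ℝ) 1,
      (E (γ t) : Measure (Eu d)) = Measure.map (φ t) (E (γ 0) : Measure (Eu d))

end Riemannian

end

end WSub

set_option linter.unusedSectionVars false

/-! The bi-Lipschitz map `E` moves the problem to the compact metric space `S`. There `action x y`
denotes the infimum of the energy over all continuous curves from `x` to `y`; the theorem follows
once `WRestr` is identified with its square root and the infimum is attained by a Lipschitz curve.

Upper bound. Along a geodesic given by `D` the measures are transported by the flow of a field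
bounded by `C` times the distance of the end points, so the action is at most the square of that
number (`exists_path_energy_le`). The hypotheses bound `B` only at initial vectors of `D`. To
control the field along the whole geodesic one needs that its later velocities, suitably scaled,
again lie in `D`; this is `restart_mem`, a version of the fact that minimizing curves have no
corners.

Lower bound. If `θ'` is close to `θ`, a potential of the initial field gains at least the squared
`L²` norm of that field along the flow, up to an error of third order in the distance. After scaling
it separates `E θ` from `E θ'` by `dist θ θ'` with a bounded gradient
(`exists_separating_function`). As a test function in the continuity equation it shows that the `L¹`
norm of any velocity field controls the speed of the curve in `S`. Hence curves of bounded energy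
are uniformly Hölder of exponent 1/2 (`IsSeparatedFamily.sq_edist_le`), and zero action forces
equality of the end points.

Compactness. By Riesz representation, a field of energy at most `K` exists if and only if `weakRate²
≤ K * gradSq` for all test functions. This inequality survives pointwise narrow limits
(`exists_isCE_of_tendsto`), so Arzelà-Ascoli yields a continuous minimizer.

Regularity. Time reversal and concatenation with an optimal switching time make the square root of
the action symmetric and subadditive. Comparing a minimizer with its two halves gives equality in
Cauchy-Schwarz, hence constant speed, hence a Lipschitz curve
(`IsSeparatedFamily.exists_lipschitz_minimizer`). It is admissible for `WRestr`, so the two infima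
agree. -/

namespace WSub
noncomputable section
open Filter Topology

/-! ### First order estimates for the Riemannian distance -/

section FirstOrder

variable {m : ℕ} {M : Type*} [MetricSpace M] [ChartedSpace (Eu m) M] [IsManifold (𝓡 m) ∞ M]

/-- In the chart centered at `γ t` the coordinates of the velocity are the velocity itself. -/
lemma hasDerivAt_extChartAt_comp {γ : ℝ → M} {t : ℝ} {o : M} {u : Eu m}
    (hγ : MDifferentiableAt 𝓘(ℝ, ℝ) (𝓡 m) γ t) (h : velocity (m := m) γ t = ⟨o, u⟩) :
    HasDerivAt (fun s => extChartAt (𝓡 m) o (γ s)) u t := by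
  obtain rfl : γ t = o := congrArg Bundle.TotalSpace.proj h
  have hu : mfderiv 𝓘(ℝ, ℝ) (𝓡 m) γ t (1 : ℝ) = u := by
    exact eq_of_heq (Bundle.TotalSpace.mk.inj h).2
  obtain ⟨A, hA⟩ : ∃ A : ℝ →L[ℝ] Eu m, A = mfderiv 𝓘(ℝ, ℝ) (𝓡 m) γ t := ⟨_, rfl⟩
  have h1 : HasFDerivWithinAt (fun s => extChartAt (𝓡 m) (γ t) (γ s)) A
      (range (id : ℝ → ℝ)) t := by
    rw [hA]
    exact hγ.hasMFDerivAt.2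
  rw [range_id, hasFDerivWithinAt_univ] at h1
  have h2 := h1.hasDerivAt
  rw [hA] at h2
  rw [← hu]
  exact h2

/-- The tangent vector with base point and components given by a pair of vectors in the chart
at `o`. -/
def chartVec (o : M) (z : Eu m × Eu m) : TangentBundle (𝓡 m) M :=
  ⟨(extChartAt (𝓡 m) o).symm z.1,
    (trivializationAt (Eu m) (TangentSpace (𝓡 m)) o).symmL ℝ ((extChartAt (𝓡 m) o).symm z.1) z.2⟩

/-- Near the center `chartVec o` is the inverse of the trivialization at `o` after the inverse
chart, and both are continuous. -/
lemma continuousAt_chartVec (o : M) (v : Eu m) :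
    ContinuousAt (chartVec o) (extChartAt (𝓡 m) o o, v) := by
  set e := trivializationAt (Eu m) (TangentSpace (𝓡 m) : M → Type _) o
  have h0 : ContinuousAt (fun z : Eu m × Eu m => (extChartAt (𝓡 m) o).symm z.1)
      (extChartAt (𝓡 m) o o, v) :=
    ContinuousAt.comp_of_eq (continuousAt_extChartAt_symm (I := 𝓡 m) o) continuousAt_fst rfl
  have h1 : ContinuousAt (fun z : Eu m × Eu m => ((extChartAt (𝓡 m) o).symm z.1, z.2))
      (extChartAt (𝓡 m) o o, v) := h0.prodMk continuousAt_snd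
  have hb : o ∈ e.baseSet := mem_baseSet_trivializationAt _ _ _
  have h2 : ContinuousAt e.toOpenPartialHomeomorph.symm (o, v) :=
    e.toOpenPartialHomeomorph.symm.continuousAt (by simp [e.target_eq, hb])
  have h3 := ContinuousAt.comp_of_eq (x := (extChartAt (𝓡 m) o o, v)) h2 h1 (by simp)
  refine h3.congr ?_
  have : ∀ᶠ z : Eu m × Eu m in 𝓝 (extChartAt (𝓡 m) o o, v),
      (extChartAt (𝓡 m) o).symm z.1 ∈ e.baseSet :=
    h0.preimage_mem_nhds (e.open_baseSet.mem_nhds (by simpa using hb))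
  filter_upwards [this] with z hz
  unfold chartVec
  exact (e.mk_symm hz z.2).symm.trans (congrArg (fun w => (⟨_, w⟩ : TangentBundle (𝓡 m) M))
    (Bundle.Trivialization.symmL_apply e hz z.2 (R := ℝ)).symm)

lemma chartVec_center (o : M) (v : Eu m) : chartVec o (extChartAt (𝓡 m) o o, v) = ⟨o, v⟩ := by
  unfold chartVec
  have h : (extChartAt (𝓡 m) o).symm (extChartAt (𝓡 m) o o) = o := extChartAt_to_inv o
  simp only
  rw [h, TangentBundle.symmL_trivializationAt_eq_core (mem_chart_source _ o)]
  congr 1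
  exact (tangentBundleCore (𝓡 m) M).coordChange_self (achart (Eu m) o) o
    (mem_chart_source (Eu m) o) v

lemma mdifferentiableAt_extChartAt_symm_comp {o : M} {c : ℝ → Eu m} {w : Eu m} {t : ℝ}
    (hc : HasDerivAt c w t) (ht : c t ∈ (extChartAt (𝓡 m) o).target) :
    HasMFDerivAt 𝓘(ℝ, ℝ) (𝓡 m) (fun s => (extChartAt (𝓡 m) o).symm (c s)) t
      ((mfderiv 𝓘(ℝ, Eu m) (𝓡 m) (extChartAt (𝓡 m) o).symm (c t)).comp
        (ContinuousLinearMap.toSpanSingleton ℝ w : ℝ →L[ℝ] Eu m)) := by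
  have h1 : MDifferentiableAt 𝓘(ℝ, Eu m) (𝓡 m) (extChartAt (𝓡 m) o).symm (c t) := by
    have := mdifferentiableWithinAt_extChartAt_symm (I := 𝓡 m) ht
    rwa [ModelWithCorners.range_eq_univ, mdifferentiableWithinAt_univ] at this
  have h2 : HasMFDerivAt 𝓘(ℝ, ℝ) 𝓘(ℝ, Eu m) c t
      (ContinuousLinearMap.toSpanSingleton ℝ w : ℝ →L[ℝ] Eu m) :=
    (hasDerivAt_iff_hasFDerivAt.1 hc).hasMFDerivAt
  exact h1.hasMFDerivAt.comp t h2

lemma velocity_extChartAt_symm_comp {o : M} {c : ℝ → Eu m} {w : Eu m} {t : ℝ}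
    (hc : HasDerivAt c w t) (ht : c t ∈ (extChartAt (𝓡 m) o).target) :
    velocity (m := m) (fun s => (extChartAt (𝓡 m) o).symm (c s)) t = chartVec o (c t, w) := by
  have h := (mdifferentiableAt_extChartAt_symm_comp hc ht).mfderiv
  unfold velocity chartVec
  rw [h]
  congr 1
  have hs : (extChartAt (𝓡 m) o).symm (c t) ∈ (chartAt (Eu m) o).source := by
    rw [← extChartAt_source (𝓡 m)]
    exact (extChartAt (𝓡 m) o).map_target ht
  rw [TangentBundle.symmL_trivializationAt hs, (extChartAt (𝓡 m) o).right_inv ht,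
    ModelWithCorners.range_eq_univ, mfderivWithin_univ]
  have : (ContinuousLinearMap.toSpanSingleton ℝ w : ℝ →L[ℝ] Eu m) (1 : ℝ) = w := by simp
  exact congrArg (mfderiv 𝓘(ℝ, Eu m) (𝓡 m) (extChartAt (𝓡 m) o).symm (c t)) this

variable [Bundle.RiemannianBundle (fun x : M => TangentSpace (𝓡 m) x)]

/-- The Riemannian distance is at most the length of a path with bounded speed. -/
lemma dist_le_of_norm_velocity_le [IsRiemannianManifold (𝓡 m) M] {γ : ℝ → M} {a b : ℝ}
    (hab : a ≤ b) (hγ : ContMDiffOn 𝓘(ℝ, ℝ) (𝓡 m) 1 γ (Icc a b)) {R : ℝ}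
    (hR : ∀ t ∈ Icc a b, ‖(velocity (m := m) γ t).snd‖ ≤ R) :
    dist (γ a) (γ b) ≤ R * (b - a) := by
  have hR0 : 0 ≤ R := (norm_nonneg _).trans (hR a ⟨le_rfl, hab⟩)
  have h1 : edist (γ a) (γ b) ≤ ENNReal.ofReal (R * (b - a)) := by
    rw [IsRiemannianManifold.out (I := 𝓡 m) (γ a) (γ b)]
    refine (riemannianEDist_le_pathELength hγ rfl rfl hab).trans ?_
    rw [pathELength_eq_lintegral_mfderiv_Icc]
    refine (setLIntegral_mono' measurableSet_Icc
      (g := fun _ => ENNReal.ofReal R) fun t ht => ?_).trans ?_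
    · rw [← ofReal_norm]
      exact ENNReal.ofReal_le_ofReal (hR t ht)
    · rw [setLIntegral_const, Real.volume_Icc, ENNReal.ofReal_mul hR0]
  rw [edist_dist] at h1
  exact (ENNReal.ofReal_le_ofReal_iff (mul_nonneg hR0 (sub_nonneg.2 hab))).1 h1

variable [IsContMDiffRiemannianBundle (𝓡 m) ∞ (Eu m) (fun x : M => TangentSpace (𝓡 m) x)]

-- This turns a strict norm bound at one tangent vector into the same bound at all nearby tangent
-- vectors.
variable (m M) in
lemma continuous_norm_snd : Continuous (fun p : TangentBundle (𝓡 m) M => ‖p.snd‖) := by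
  have : IsContinuousRiemannianBundle (Eu m) (fun x : M => TangentSpace (𝓡 m) x) := by
    obtain ⟨g, hg, h⟩ := IsContMDiffRiemannianBundle.exists_contMDiff (IB := 𝓡 m) (n := ∞)
      (F := Eu m) (E := (fun x : M => TangentSpace (𝓡 m) x))
    exact ⟨g, hg.continuous, h⟩
  have h : Continuous (fun p : TangentBundle (𝓡 m) M => inner ℝ p.snd p.snd) :=
    Continuous.inner_bundle (F := Eu m) (b := fun p : TangentBundle (𝓡 m) M => p.proj)
      (v := fun p => p.snd) (w := fun p => p.snd) continuous_id continuous_id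
  simp only [real_inner_self_eq_norm_sq] at h
  simpa [Real.sqrt_sq] using h.sqrt

lemma norm_chartVec_smul (o : M) (y q : Eu m) (h : ℝ) :
    ‖(chartVec o (y, h • q)).snd‖ = |h| * ‖(chartVec o (y, q)).snd‖ := by
  have h1 := norm_smul h (chartVec o (y, q)).snd
  rw [← Real.norm_eq_abs, ← h1]
  exact congrArg (fun v : TangentSpace (𝓡 m) ((extChartAt (𝓡 m) o).symm y) => ‖v‖)
    (map_smul ((trivializationAt (Eu m) (TangentSpace (𝓡 m)) o).symmL ℝ
      ((extChartAt (𝓡 m) o).symm y)) h q)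

/-- In a chart, the distance of nearby points is bounded using the metric at the center. -/
lemma exists_dist_extChartAt_symm_le [IsRiemannianManifold (𝓡 m) M] (o : M) (z : Eu m) {N : ℝ}
    (hN : ‖(⟨o, z⟩ : TangentBundle (𝓡 m) M).snd‖ < N) :
    ∃ r > 0, ∀ a ∈ Metric.ball (extChartAt (𝓡 m) o o) r, ∀ b ∈ Metric.ball (extChartAt (𝓡 m) o o) r,
      ∀ h > (0 : ℝ), h⁻¹ • (b - a) ∈ Metric.ball z r →
        dist ((extChartAt (𝓡 m) o).symm a) ((extChartAt (𝓡 m) o).symm b) ≤ N * h := by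
  have h1 : ∀ᶠ y : Eu m × Eu m in 𝓝 (extChartAt (𝓡 m) o o, z), ‖(chartVec o y).snd‖ < N := by
    have h1 : ContinuousAt (fun y => ‖(chartVec o y).snd‖) (extChartAt (𝓡 m) o o, z) :=
      (continuous_norm_snd m M).continuousAt.comp (continuousAt_chartVec o z)
    refine h1.eventually_lt continuousAt_const ?_
    rwa [chartVec_center]
  have h2 : ∀ᶠ y : Eu m × Eu m in 𝓝 (extChartAt (𝓡 m) o o, z),
      y.1 ∈ (extChartAt (𝓡 m) o).target :=
    continuousAt_fst (extChartAt_target_mem_nhds (I := 𝓡 m) o)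
  obtain ⟨r, hr, hball⟩ := Metric.mem_nhds_iff.1 (h1.and h2)
  refine ⟨r, hr, fun a ha b hb h h0 hq => ?_⟩
  set q : Eu m := h⁻¹ • (b - a) with hqdef
  -- The coordinate segment from `a` to `b`. Its velocity is `h` times a vector near `z`, so its
  -- Riemannian length is at most `N * h`.
  obtain ⟨c, hc⟩ : ∃ c : ℝ → Eu m, c = fun s => a + (s * h) • q := ⟨_, rfl⟩
  have hcd : ∀ s, HasDerivAt c (h • q) s := by
    intro s
    rw [hc]
    have := ((((hasDerivAt_id s).mul_const h).smul_const q).const_add a)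
    simpa using this
  have hcseg : ∀ s ∈ Icc (0 : ℝ) 1, c s ∈ Metric.ball (extChartAt (𝓡 m) o o) r := by
    intro s hs
    have h2 : c s = a + s • (b - a) := by
      simp only [hc, hqdef, smul_smul, mul_assoc, mul_inv_cancel₀ h0.ne', mul_one]
    rw [h2]
    exact (convex_ball _ _).add_smul_sub_mem ha hb hs
  have hmem : ∀ s ∈ Icc (0 : ℝ) 1, ‖(chartVec o (c s, q)).snd‖ < N ∧
      c s ∈ (extChartAt (𝓡 m) o).target := fun s hs =>
    hball (a := (c s, q)) (by rw [← ball_prod_same]; exact ⟨hcseg s hs, hq⟩)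
  have hc0 : c 0 = a := by simp [hc]
  have hc1 : c 1 = b := by
    simp only [hc, hqdef, one_mul, smul_smul, mul_inv_cancel₀ h0.ne', one_smul]
    abel
  have hlen := dist_le_of_norm_velocity_le (m := m)
    (γ := fun s => (extChartAt (𝓡 m) o).symm (c s)) zero_le_one (R := N * h) ?_ ?_
  · simpa only [hc0, hc1, sub_zero, mul_one] using hlen
  · have h1 := contMDiffOn_extChartAt_symm (I := 𝓡 m) (n := 1) o
    refine h1.comp (t := (extChartAt (𝓡 m) o).target) ?_ fun s hs => (hmem s hs).2
    rw [contMDiffOn_iff_contDiffOn, hc]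
    fun_prop
  · intro s hs
    rw [velocity_extChartAt_symm_comp (hcd s) (hmem s hs).2]
    rw [norm_chartVec_smul, abs_of_pos h0, mul_comm]
    exact mul_le_mul_of_nonneg_right (hmem s hs).1.le h0.le

/-- Two curves that leave `o` with velocities `u` and `w` are at distance at most
`N h` after a short time `h` if `‖w - u‖ < N`. -/
lemma eventually_dist_le_of_velocity [IsRiemannianManifold (𝓡 m) M] {α β : ℝ → M} {o : M}
    {u w : Eu m}
    (hα : MDifferentiableAt 𝓘(ℝ, ℝ) (𝓡 m) α 0) (hβ : MDifferentiableAt 𝓘(ℝ, ℝ) (𝓡 m) β 0)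
    (hα' : velocity (m := m) α 0 = ⟨o, u⟩) (hβ' : velocity (m := m) β 0 = ⟨o, w⟩)
    {N : ℝ} (hN : ‖(⟨o, w - u⟩ : TangentBundle (𝓡 m) M).snd‖ < N) :
    ∀ᶠ h in 𝓝[>] (0 : ℝ), dist (α h) (β h) ≤ N * h := by
  have hα0 : α 0 = o := congrArg Bundle.TotalSpace.proj hα'
  have hβ0 : β 0 = o := congrArg Bundle.TotalSpace.proj hβ'
  have ha : HasDerivAt (fun s => extChartAt (𝓡 m) o (α s)) u 0 :=
    hasDerivAt_extChartAt_comp hα hα'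
  have hb : HasDerivAt (fun s => extChartAt (𝓡 m) o (β s)) w 0 :=
    hasDerivAt_extChartAt_comp hβ hβ'
  -- Both curves start at `o`, so the difference quotient of their coordinates converges to the
  -- difference of the velocities.
  have hd : Tendsto (fun h : ℝ => h⁻¹ • (extChartAt (𝓡 m) o (β h) - extChartAt (𝓡 m) o (α h)))
      (𝓝[>] 0) (𝓝 (w - u)) := by
    have h1 := (hb.sub ha).tendsto_slope_zero_right
    simp only [zero_add, Pi.sub_apply, hα0, hβ0, sub_self, sub_zero] at h1
    exact h1
  obtain ⟨r, hr, hdist⟩ := exists_dist_extChartAt_symm_le o (w - u) hN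
  have hsrc : (extChartAt (𝓡 m) o).source ∈ 𝓝 o := extChartAt_source_mem_nhds (I := 𝓡 m) o
  have cα : Tendsto α (𝓝[>] 0) (𝓝 o) := by
    rw [← hα0]; exact hα.continuousAt.tendsto.mono_left nhdsWithin_le_nhds
  have cβ : Tendsto β (𝓝[>] 0) (𝓝 o) := by
    rw [← hβ0]; exact hβ.continuousAt.tendsto.mono_left nhdsWithin_le_nhds
  have cec := continuousAt_extChartAt (I := 𝓡 m) o
  filter_upwards [self_mem_nhdsWithin, hd (Metric.ball_mem_nhds _ hr), cα hsrc, cβ hsrc,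
    (cec.tendsto.comp cα) (Metric.ball_mem_nhds _ hr),
    (cec.tendsto.comp cβ) (Metric.ball_mem_nhds _ hr)] with h h0 hQh hsα hsβ hbα hbβ
  have := hdist _ hbα _ hbβ h h0 hQh
  simp only [Function.comp_apply] at this
  rwa [(extChartAt (𝓡 m) o).left_inv hsα, (extChartAt (𝓡 m) o).left_inv hsβ] at this

end FirstOrder

/-! ### The geodesics of a parameter manifold -/

section Geodesics

variable {m : ℕ} {M : Type*} [MetricSpace M] [ChartedSpace (Eu m) M] [IsManifold (𝓡 m) ∞ M]

lemma hasMFDerivAt_comp_affine {γ : ℝ → M} {a b t : ℝ}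
    (hγ : MDifferentiableAt 𝓘(ℝ, ℝ) (𝓡 m) γ (a + b * t)) :
    HasMFDerivAt 𝓘(ℝ, ℝ) (𝓡 m) (fun s => γ (a + b * s)) t
      ((mfderiv 𝓘(ℝ, ℝ) (𝓡 m) γ (a + b * t)).comp
        (ContinuousLinearMap.toSpanSingleton ℝ b : ℝ →L[ℝ] ℝ)) := by
  have h2 : HasMFDerivAt 𝓘(ℝ, ℝ) 𝓘(ℝ, ℝ) (fun s : ℝ => a + b * s) t
      (ContinuousLinearMap.toSpanSingleton ℝ b : ℝ →L[ℝ] ℝ) := by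
    have : HasDerivAt (fun s : ℝ => a + b * s) b t := by
      simpa using ((hasDerivAt_id t).const_mul b).const_add a
    exact (hasDerivAt_iff_hasFDerivAt.1 this).hasMFDerivAt
  exact HasMFDerivAt.comp t (hγ.hasMFDerivAt) h2

lemma velocity_comp_affine {γ : ℝ → M} {a b t : ℝ}
    (hγ : MDifferentiableAt 𝓘(ℝ, ℝ) (𝓡 m) γ (a + b * t)) :
    velocity (m := m) (fun s => γ (a + b * s)) t =
      ⟨γ (a + b * t), b • (velocity (m := m) γ (a + b * t)).snd⟩ := by
  have h := (hasMFDerivAt_comp_affine hγ).mfderiv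
  unfold velocity
  rw [h]
  congr 1
  have h1 : (ContinuousLinearMap.toSpanSingleton ℝ b : ℝ →L[ℝ] ℝ) (1 : ℝ) = b • (1 : ℝ) := by simp
  exact (congrArg (mfderiv 𝓘(ℝ, ℝ) (𝓡 m) γ (a + b * t)) h1).trans (map_smul _ _ _)

variable [Bundle.RiemannianBundle (fun x : M => TangentSpace (𝓡 m) x)]

variable {S : Set M} {D : Set (TangentBundle (𝓡 m) M)}

lemma expCurve_one (p : TangentBundle (𝓡 m) M) : expCurve p 1 = riemExp p := by
  unfold expCurve
  congr 1
  exact congrArg (Bundle.TotalSpace.mk p.proj) (one_smul ℝ p.snd)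

namespace IsParameterManifold

lemma velocity_zero (hS : IsParameterManifold S D) {p : TangentBundle (𝓡 m) M} (hp : p ∈ D) :
    velocity (m := m) (expCurve p) 0 = p := by
  obtain ⟨ε, -, -, h⟩ := hS.geodesic p hp
  exact h

lemma expCurve_zero (hS : IsParameterManifold S D) {p : TangentBundle (𝓡 m) M} (hp : p ∈ D) :
    expCurve p 0 = p.proj :=
  congrArg Bundle.TotalSpace.proj (hS.velocity_zero hp)

lemma contMDiffAt_expCurve (hS : IsParameterManifold S D) {p : TangentBundle (𝓡 m) M} (hp : p ∈ D)
    {t : ℝ} (ht : t ∈ Icc (0 : ℝ) 1) : ContMDiffAt 𝓘(ℝ, ℝ) (𝓡 m) 1 (expCurve p) t := by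
  obtain ⟨ε, hε, h, -⟩ := hS.geodesic p hp
  have : ContMDiffAt 𝓘(ℝ, ℝ) (𝓡 m) ∞ (expCurve p) t :=
    h.1.contMDiffAt (Ioo_mem_nhds (by linarith [ht.1]) (by linarith [ht.2]))
  exact this.of_le (by norm_cast)

lemma mdifferentiableAt_expCurve (hS : IsParameterManifold S D) {p : TangentBundle (𝓡 m) M}
    (hp : p ∈ D) {t : ℝ} (ht : t ∈ Icc (0 : ℝ) 1) :
    MDifferentiableAt 𝓘(ℝ, ℝ) (𝓡 m) (expCurve p) t :=
  (hS.contMDiffAt_expCurve hp ht).mdifferentiableAt one_ne_zero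

/-- The scaled vector stays in `D`, and its `riemExp` is by definition a point of `expCurve p`, so
`minimizing` applies to it. -/
lemma dist_proj_expCurve (hS : IsParameterManifold S D) {p : TangentBundle (𝓡 m) M}
    (hp : p ∈ D) {t : ℝ} (ht : t ∈ Icc (0 : ℝ) 1) :
    dist p.proj (expCurve p t) = t * ‖p.snd‖ := by
  have := hS.minimizing _ (hS.starShaped p hp t ht)
  rw [norm_smul, Real.norm_of_nonneg ht.1] at this
  exact this

variable [IsRiemannianManifold (𝓡 m) M]

lemma dist_expCurve_le (hS : IsParameterManifold S D) {p : TangentBundle (𝓡 m) M} (hp : p ∈ D)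
    {s t : ℝ} (hs : s ∈ Icc (0 : ℝ) 1) (ht : t ∈ Icc (0 : ℝ) 1) :
    dist (expCurve p s) (expCurve p t) ≤ ‖p.snd‖ * |s - t| := by
  wlog hst : s ≤ t generalizing s t
  · rw [dist_comm, abs_sub_comm]
    exact this ht hs (le_of_not_ge hst)
  rw [abs_sub_comm, abs_of_nonneg (sub_nonneg.2 hst)]
  have hsub : ∀ r ∈ Icc s t, r ∈ Icc (0 : ℝ) 1 := fun r hr => ⟨hs.1.trans hr.1, hr.2.trans ht.2⟩
  exact dist_le_of_norm_velocity_le (m := m) hst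
    (fun r hr => (hS.contMDiffAt_expCurve hp (hsub r hr)).contMDiffWithinAt)
    fun r hr => (hS.constSpeed p hp r (hsub r hr)).le

lemma isLipPath_expCurve (hS : IsParameterManifold S D) {p : TangentBundle (𝓡 m) M} (hp : p ∈ D) :
    IsLipPath S (expCurve p) := by
  refine ⟨fun t ht => hS.curve_mem p hp t ht, ‖p.snd‖₊, ?_⟩
  refine LipschitzOnWith.of_dist_le_mul fun s hs t ht => ?_
  rw [Real.dist_eq]
  exact hS.dist_expCurve_le hp hs ht

variable [IsContMDiffRiemannianBundle (𝓡 m) ∞ (Eu m) (fun x : M => TangentSpace (𝓡 m) x)]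

/-- A minimizing geodesic continues from an interior point with its own velocity: a second
minimizing geodesic to the end point would produce a minimizing curve with a corner. -/
lemma restart_mem (hS : IsParameterManifold S D) {p : TangentBundle (𝓡 m) M} (hp : p ∈ D)
    {t : ℝ} (ht : t ∈ Ioo (0 : ℝ) 1) :
    (⟨expCurve p t, (1 - t) • (velocity (m := m) (expCurve p) t).snd⟩ :
      TangentBundle (𝓡 m) M) ∈ D := by
  have htI : t ∈ Icc (0 : ℝ) 1 := ⟨ht.1.le, ht.2.le⟩
  have h1I : (1 : ℝ) ∈ Icc (0 : ℝ) 1 := ⟨zero_le_one, le_rfl⟩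
  have ht1 : 0 < 1 - t := sub_pos.2 ht.2
  -- A second geodesic from the intermediate point to the same end point; the rest of the proof
  -- identifies its initial vector `w`.
  obtain ⟨q, hq, hqp, hqe⟩ := hS.joined _ (hS.curve_mem p hp t htI) _ (hS.curve_mem p hp 1 h1I)
  obtain ⟨o, w⟩ := q
  obtain rfl : o = expCurve p t := hqp
  set q : TangentBundle (𝓡 m) M := ⟨expCurve p t, w⟩ with hqdef
  have hqn : ‖w‖ ≤ (1 - t) * ‖p.snd‖ := by
    have h := hS.minimizing q hq
    rw [hqe] at h
    have h2 := hS.dist_expCurve_le hp htI h1I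
    rw [abs_sub_comm, abs_of_pos ht1] at h2
    calc ‖w‖ = dist (expCurve p t) (expCurve p 1) := h.symm
      _ ≤ _ := by rw [mul_comm]; exact h2
  have hα := hS.mdifferentiableAt_expCurve hp htI
  have hβ := hS.mdifferentiableAt_expCurve hq (t := 0) ⟨le_rfl, zero_le_one⟩
  have hα1 : MDifferentiableAt 𝓘(ℝ, ℝ) (𝓡 m) (expCurve p) (t + -1 * 0) := by simpa using hα
  have hβ1 : MDifferentiableAt 𝓘(ℝ, ℝ) (𝓡 m) (expCurve q) (0 + (1 - t)⁻¹ * 0) := by simpa using hβ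
  obtain ⟨u, hu'⟩ : ∃ u : TangentSpace (𝓡 m) (expCurve p t),
      u = (velocity (m := m) (expCurve p) t).snd := ⟨_, rfl⟩
  have hα' : velocity (m := m) (fun s => expCurve p (t + -1 * s)) 0 =
      ⟨expCurve p t, (-1 : ℝ) • u⟩ := by
    rw [velocity_comp_affine hα1, show t + -1 * 0 = t by ring, hu']
    rfl
  have hβ' : velocity (m := m) (fun s => expCurve q (0 + (1 - t)⁻¹ * s)) 0 =
      ⟨expCurve p t, (1 - t)⁻¹ • w⟩ := by
    rw [velocity_comp_affine hβ1, show 0 + (1 - t)⁻¹ * 0 = 0 by ring]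
    exact congrArg (fun r : TangentBundle (𝓡 m) M =>
      (⟨r.proj, (1 - t)⁻¹ • r.snd⟩ : TangentBundle (𝓡 m) M)) (hS.velocity_zero hq)
  -- Otherwise the corner can be cut: going back along `p` and forward along `q` for time `h`, the
  -- two points are at distance at most `N * h` with `N < 2 * ‖p.snd‖`. The resulting detour joins
  -- the end points with total length less than `‖p.snd‖`, their distance.
  have key : ¬ ‖(1 - t)⁻¹ • w - (-1 : ℝ) • u‖ <
      2 * ‖p.snd‖ := by
    intro hlt
    obtain ⟨N, hN1, hN2⟩ := exists_between hlt
    have h1 := eventually_dist_le_of_velocity (hasMFDerivAt_comp_affine hα1).mdifferentiableAt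
      (hasMFDerivAt_comp_affine hβ1).mdifferentiableAt hα' hβ' hN1
    have h2 : Ioo (0 : ℝ) (min t (1 - t)) ∈ 𝓝[>] (0 : ℝ) :=
      Ioo_mem_nhdsGT (lt_min ht.1 ht1)
    obtain ⟨h, h3, h0, h4⟩ := (h1.and h2).exists
    have h5 : h < t := h4.trans_le (min_le_left _ _)
    have h6 : h < 1 - t := h4.trans_le (min_le_right _ _)
    have hs : (1 - t)⁻¹ * h ∈ Icc (0 : ℝ) 1 :=
      ⟨by positivity, by rw [inv_mul_le_iff₀ ht1]; linarith⟩
    simp only [zero_add] at h3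
    have e1 := hS.dist_proj_expCurve hp (t := t + -1 * h) ⟨by linarith, by linarith [ht.2]⟩
    have e2 := hS.dist_expCurve_le hq hs h1I
    rw [expCurve_one q, hqe] at e2
    have e3 := hS.dist_proj_expCurve hp h1I
    have e4 := dist_triangle p.proj (expCurve p (t + -1 * h)) (expCurve q ((1 - t)⁻¹ * h))
    have e5 := dist_triangle p.proj (expCurve q ((1 - t)⁻¹ * h)) (expCurve p 1)
    have e6 : ‖q.snd‖ * |(1 - t)⁻¹ * h - 1| ≤ (1 - t - h) * ‖p.snd‖ := by
      rw [abs_sub_comm, abs_of_nonneg (sub_nonneg.2 hs.2)]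
      calc ‖q.snd‖ * (1 - (1 - t)⁻¹ * h) ≤ ((1 - t) * ‖p.snd‖) * (1 - (1 - t)⁻¹ * h) :=
            mul_le_mul_of_nonneg_right hqn (sub_nonneg.2 hs.2)
        _ = (1 - t - h) * ‖p.snd‖ := by field_simp
    have e7 : N * h < 2 * ‖p.snd‖ * h := mul_lt_mul_of_pos_right hN2 h0
    linarith
  have hu : ‖u‖ = ‖p.snd‖ := by
    rw [hu']
    exact hS.constSpeed p hp t htI
  have hw : ‖(1 - t)⁻¹ • w‖ ≤ ‖p.snd‖ := by
    rw [norm_smul, Real.norm_of_nonneg (inv_nonneg.2 ht1.le), inv_mul_le_iff₀ ht1]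
    exact hqn
  -- Two vectors of norm at most `‖p.snd‖` whose sum has norm at least twice that number coincide,
  -- by the parallelogram law.
  have heq : (1 - t)⁻¹ • w = u := by
    have hpar := parallelogram_law_with_norm ℝ ((1 - t)⁻¹ • w) u
    rw [← sub_eq_zero, ← norm_eq_zero]
    have hk : 2 * ‖p.snd‖ ≤ ‖(1 - t)⁻¹ • w + u‖ := by
      rw [neg_one_smul, sub_neg_eq_add] at key
      exact not_lt.1 key
    have h0 := norm_nonneg ((1 - t)⁻¹ • w - u)
    have h1 := norm_nonneg ((1 - t)⁻¹ • w)
    have h2 := norm_nonneg p.snd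
    rw [hu] at hpar
    nlinarith
  have : w = (1 - t) • u := by rw [← heq, smul_inv_smul₀ ht1.ne']
  subst hu'
  rw [hqdef, this] at hq
  exact hq

end IsParameterManifold
end Geodesics

/-! ### Flows of bounded Lipschitz fields -/

section Flow

variable {d : ℕ}

/-- A time dependent field that is continuous in time, and bounded and Lipschitz in space with
the constant `K`. -/
structure IsLipField (v : ℝ → Eu d → Eu d) (K : ℝ≥0) : Prop where
  norm_le : ∀ t x, ‖v t x‖ ≤ K
  lipschitz : ∀ t, LipschitzWith K (v t)
  continuous_time : ∀ x, Continuous fun t => v t x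

/-- A flow on `[0,1]`, which is constant in time outside of `[0,1]`. -/
structure IsLipFlow (v φ : ℝ → Eu d → Eu d) (K : ℝ≥0) : Prop where
  zero : ∀ x, φ 0 x = x
  hasDerivWithinAt : ∀ x, ∀ t ∈ Icc (0 : ℝ) 1,
    HasDerivWithinAt (fun s => φ s x) (v t (φ t x)) (Icc 0 1) t
  lipschitz_time : ∀ x, LipschitzWith K fun t => φ t x
  continuous : Continuous (Function.uncurry φ)

lemma IsLipField.continuous {v : ℝ → Eu d → Eu d} {K : ℝ≥0} (hv : IsLipField v K) :
    Continuous (Function.uncurry v) := by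
  have h : Continuous fun z : Eu d × ℝ => v z.2 z.1 :=
    (continuous_prod_of_continuous_lipschitzWith (fun z : Eu d × ℝ => v z.2 z.1) K
      hv.continuous_time hv.lipschitz)
  exact h.comp continuous_swap

lemma IsLipField.exists_flow {v : ℝ → Eu d → Eu d} {K : ℝ≥0} (hv : IsLipField v K) :
    ∃ φ, IsLipFlow v φ K := by
  -- The global bound `K` keeps trajectories in the ball of radius `K` about `x` up to time 1, so
  -- one application covers the whole interval.
  have hPL : ∀ x, IsPicardLindelof v (tmin := 0) (tmax := 1) ⟨0, le_rfl, zero_le_one⟩ x K 0 K K :=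
    fun x => ⟨fun t _ => (hv.lipschitz t).lipschitzOnWith,
      fun x _ => (hv.continuous_time x).continuousOn, fun t _ x _ => hv.norm_le t x, by simp⟩
  choose ψ hψ0 hψ using fun x => (hPL x).exists_eq_forall_mem_Icc_hasDerivWithinAt₀
  have hcont : ∀ x, ContinuousOn (ψ x) (Icc 0 1) := fun x t ht => (hψ x t ht).continuousWithinAt
  have hright : ∀ x, ∀ t ∈ Ico (0 : ℝ) 1, HasDerivWithinAt (ψ x) (v t (ψ x t)) (Ici t) t := by
    intro x t ht
    exact (hψ x t ⟨ht.1, ht.2.le⟩).mono_of_mem_nhdsWithin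
      (mem_of_superset (Icc_mem_nhdsGE ht.2) (Icc_subset_Icc_left ht.1))
  have hLip : ∀ x, LipschitzOnWith K (ψ x) (Icc 0 1) := fun x =>
    (convex_Icc 0 1).lipschitzOnWith_of_nnnorm_hasDerivWithin_le (hψ x)
      fun t _ => hv.norm_le t _
  have hgr : ∀ x y, ∀ t ∈ Icc (0 : ℝ) 1, dist (ψ x t) (ψ y t) ≤ dist x y * Real.exp K := by
    intro x y t ht
    have h := dist_le_of_trajectories_ODE (v := v) (K := K) hv.lipschitz (hcont x) (hright x)
      (hcont y) (hright y) le_rfl t ht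
    rw [hψ0, hψ0] at h
    refine h.trans (mul_le_mul_of_nonneg_left (Real.exp_le_exp.2 ?_) dist_nonneg)
    rw [sub_zero]
    exact mul_le_of_le_one_right K.2 ht.2
  have hLip' : ∀ x, LipschitzWith K fun t : ℝ => ψ x (projIcc (0 : ℝ) 1 zero_le_one t : ℝ) := by
    intro x
    have h := (hLip x).to_restrict.comp (LipschitzWith.projIcc (zero_le_one (α := ℝ)))
    rw [mul_one] at h
    exact h
  have hmem : ∀ t : ℝ, (projIcc (0 : ℝ) 1 zero_le_one t : ℝ) ∈ Icc (0 : ℝ) 1 := fun t => Subtype.prop _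
  refine ⟨fun t x => ψ x (projIcc (0 : ℝ) 1 zero_le_one t : ℝ), fun x => ?_, fun x t ht => ?_,
    hLip', ?_⟩
  · simpa using hψ0 x
  · rw [projIcc_of_mem zero_le_one ht]
    refine (hψ x t ht).congr (fun s hs => ?_) ?_
    · rw [projIcc_of_mem zero_le_one hs]
    · rw [projIcc_of_mem zero_le_one ht]
  -- Joint continuity comes from continuity in time and the Grönwall estimate, which is a Lipschitz
  -- bound in space uniform in time.
  · have h : Continuous fun z : Eu d × ℝ => ψ z.1 (projIcc (0 : ℝ) 1 zero_le_one z.2 : ℝ) := by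
      refine continuous_prod_of_continuous_lipschitzWith _ (Real.toNNReal (Real.exp K))
        (fun x => (hLip' x).continuous) fun t => LipschitzWith.of_dist_le_mul fun x y => ?_
      rw [Real.coe_toNNReal _ (Real.exp_nonneg _), mul_comm]
      exact hgr x y _ (hmem t)
    exact h.comp continuous_swap

lemma IsLipFlow.hasDerivAt {v φ : ℝ → Eu d → Eu d} {K : ℝ≥0} (h : IsLipFlow v φ K) (x : Eu d)
    {t : ℝ} (ht : t ∈ Ioo (0 : ℝ) 1) : HasDerivAt (fun s => φ s x) (v t (φ t x)) t :=
  (h.hasDerivWithinAt x t ⟨ht.1.le, ht.2.le⟩).hasDerivAt (Icc_mem_nhds ht.1 ht.2)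

lemma IsLipFlow.isFlow {v w φ : ℝ → Eu d → Eu d} {K : ℝ≥0} (h : IsLipFlow v φ K)
    (hw : ∀ t ∈ Icc (0 : ℝ) 1, v t = w t) (Ω : Set (Eu d)) : IsFlow Ω w φ := by
  refine fun x _ => ⟨h.zero x,
    ((h.lipschitz_time x).lipschitzOnWith (s := uIcc 0 1)).absolutelyContinuousOnInterval, ?_⟩
  -- At the end points only one-sided derivatives are available; dropping these two times is
  -- harmless almost everywhere.
  rw [← restrict_Ioo_eq_restrict_Icc]
  refine (ae_restrict_iff' measurableSet_Ioo).2 (ae_of_all _ fun t ht => ?_)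
  rw [← hw t ⟨ht.1.le, ht.2.le⟩]
  exact h.hasDerivAt x ht

/-! ### Integration over compact sets and test functions -/

lemma integrable_of_continuous_of_compact {X G : Type*} [TopologicalSpace X] [MeasurableSpace X]
    [OpensMeasurableSpace X] [T2Space X] [SecondCountableTopology X] [NormedAddCommGroup G] [MeasurableSpace G] [BorelSpace G]
    [SecondCountableTopology G]
    {μ : Measure X} [IsFiniteMeasure μ] {K : Set X} (hK : IsCompact K) (hμ : μ Kᶜ = 0)
    {f : X → G} (hf : Continuous f) : Integrable f μ := by
  have h : IntegrableOn f K μ := hf.continuousOn.integrableOn_compact hK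
  rwa [IntegrableOn, Measure.restrict_eq_self_of_ae_mem] at h
  exact ae_iff.2 hμ

variable {f : ℝ → Eu d → ℝ}

lemma hasFDerivAt_uncurry (hf : ContDiff ℝ 1 (Function.uncurry f)) (z : ℝ × Eu d) :
    HasFDerivAt (Function.uncurry f) (fderiv ℝ (Function.uncurry f) z) z :=
  (hf.differentiable one_ne_zero z).hasFDerivAt

lemma deriv_fst_eq (hf : ContDiff ℝ 1 (Function.uncurry f)) (t : ℝ) (x : Eu d) :
    deriv (fun s => f s x) t = fderiv ℝ (Function.uncurry f) (t, x) (1, 0) := by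
  have h := (hasFDerivAt_uncurry hf (t, x)).comp_hasDerivAt t
    ((hasDerivAt_id t).prodMk (hasDerivAt_const t x))
  exact h.deriv

lemma fderiv_snd_eq (hf : ContDiff ℝ 1 (Function.uncurry f)) (t : ℝ) (x w : Eu d) :
    inner ℝ (gradient (f t) x) w = fderiv ℝ (Function.uncurry f) (t, x) (0, w) := by
  have h := (hasFDerivAt_uncurry hf (t, x)).comp x (hasFDerivAt_prodMk_right t x)
  have h1 : fderiv ℝ (f t) x w = fderiv ℝ (Function.uncurry f) (t, x) (0, w) := by
    have h2 : fderiv ℝ (f t) x = _ := h.fderiv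
    rw [h2]; simp
  rw [← h1, gradient, InnerProductSpace.toDual_symm_apply]

lemma continuous_deriv_fst (hf : ContDiff ℝ 1 (Function.uncurry f)) :
    Continuous fun z : ℝ × Eu d => deriv (fun s => f s z.2) z.1 := by
  simp only [deriv_fst_eq hf]
  exact (hf.continuous_fderiv one_ne_zero).clm_apply continuous_const

lemma continuous_gradient (hf : ContDiff ℝ 1 (Function.uncurry f)) :
    Continuous fun z : ℝ × Eu d => gradient (f z.1) z.2 := by
  have h : ∀ z : ℝ × Eu d, gradient (f z.1) z.2 = (InnerProductSpace.toDual ℝ (Eu d)).symm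
      ((fderiv ℝ (Function.uncurry f) z).comp (ContinuousLinearMap.inr ℝ ℝ (Eu d))) := by
    intro z
    refine ext_inner_right ℝ fun w => ?_
    rw [fderiv_snd_eq hf, InnerProductSpace.toDual_symm_apply]
    simp
  simp only [h]
  exact (InnerProductSpace.toDual ℝ (Eu d)).symm.continuous.comp
    ((hf.continuous_fderiv one_ne_zero).clm_comp continuous_const)

lemma hasDerivAt_comp_curve (hf : ContDiff ℝ 1 (Function.uncurry f)) {c : ℝ → Eu d} {w : Eu d}
    {t : ℝ} (hc : HasDerivAt c w t) :
    HasDerivAt (fun s => f s (c s))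
      (deriv (fun s => f s (c t)) t + inner ℝ (gradient (f t) (c t)) w) t := by
  have h := (hasFDerivAt_uncurry hf (t, c t)).comp_hasDerivAt t ((hasDerivAt_id t).prodMk hc)
  rw [deriv_fst_eq hf, fderiv_snd_eq hf, ← map_add, Prod.mk_add_mk, add_zero, zero_add]
  exact h


/-! ### Curves of measures transported by a flow -/

lemma map_flow_apply {v φ : ℝ → Eu d → Eu d} {K : ℝ≥0} (hφ : IsLipFlow v φ K)
    {ρ : ℝ → ProbabilityMeasure (Eu d)}
    (hρ : ∀ t ∈ Icc (0 : ℝ) 1, (ρ t : Measure (Eu d)) = Measure.map (φ t) (ρ 0 : Measure (Eu d)))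
    {t : ℝ} (ht : t ∈ Icc (0 : ℝ) 1) {g : Eu d → ℝ} (hg : Continuous g) :
    ∫ x, g x ∂(ρ t : Measure (Eu d)) = ∫ x, g (φ t x) ∂(ρ 0 : Measure (Eu d)) := by
  have hc : Continuous (φ t) := hφ.continuous.comp (Continuous.prodMk_right t)
  rw [hρ t ht, integral_map hc.aemeasurable hg.aestronglyMeasurable]

/-- Pulled back to `ρ 0` by the flow, the integrands add up to the time derivative of `f t (φ t x)`.
Fubini and the fundamental theorem of calculus on each trajectory give the equation. -/
lemma IsLipFlow.isCE {v φ : ℝ → Eu d → Eu d} {K : ℝ≥0} (hv : IsLipField v K)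
    (hφ : IsLipFlow v φ K) {Ω : Set (Eu d)} (hΩ : IsCompact Ω) {ρ : ℝ → ProbabilityMeasure (Eu d)}
    (hρ0 : (ρ 0 : Measure (Eu d)) Ωᶜ = 0)
    (hρ : ∀ t ∈ Icc (0 : ℝ) 1,
      (ρ t : Measure (Eu d)) = Measure.map (φ t) (ρ 0 : Measure (Eu d))) : IsCE ρ v := by
  have hvt : ∀ t, Continuous (v t) := fun t => (hv.lipschitz t).continuous
  refine ⟨hv.continuous.measurable, fun t _ => ?_, ?_, fun f hf => ?_⟩
  · exact MemLp.of_bound (hvt t).aestronglyMeasurable K (ae_of_all _ (hv.norm_le t))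
  · have h1 : ∀ t, ∫⁻ x, ‖v t x‖ₑ ∂(ρ t : Measure (Eu d)) ≤ K := fun t => by
      refine (lintegral_mono fun x => ?_).trans_eq ((lintegral_const (K : ℝ≥0∞)).trans (by simp))
      exact enorm_le_coe.2 (hv.norm_le t x)
    calc _ ≤ ∫⁻ t in Icc (0 : ℝ) 1, (K : ℝ≥0∞) := lintegral_mono fun t => h1 t
      _ < ⊤ := by simp
  · set μ : Measure (Eu d) := (ρ 0 : Measure (Eu d))
    set T : Measure ℝ := volume.restrict (Icc (0 : ℝ) 1)
    have hΦ : Continuous fun z : ℝ × Eu d => (z.1, φ z.1 z.2) := continuous_fst.prodMk hφ.continuous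
    set G1 : ℝ × Eu d → ℝ := fun z => deriv (fun s => f s (φ z.1 z.2)) z.1
    set G2 : ℝ × Eu d → ℝ := fun z => inner ℝ (gradient (f z.1) (φ z.1 z.2)) (v z.1 (φ z.1 z.2))
    have hG1 : Continuous G1 := (continuous_deriv_fst hf).comp hΦ
    have hG2 : Continuous G2 := ((continuous_gradient hf).comp hΦ).inner (hv.continuous.comp hΦ)
    have hsupp : (T.prod μ) (Icc (0 : ℝ) 1 ×ˢ Ω)ᶜ = 0 := by
      have h : (Icc (0 : ℝ) 1 ×ˢ Ω)ᶜ ⊆ (Icc (0 : ℝ) 1)ᶜ ×ˢ univ ∪ univ ×ˢ Ωᶜ := by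
        rintro ⟨t, x⟩ h
        by_cases ht : t ∈ Icc (0 : ℝ) 1
        · exact Or.inr ⟨trivial, fun hx => h ⟨ht, hx⟩⟩
        · exact Or.inl ⟨ht, trivial⟩
      refine measure_mono_null h (measure_union_null ?_ ?_)
      · rw [Measure.prod_prod, Measure.restrict_apply measurableSet_Icc.compl]
        simp
      · rw [Measure.prod_prod, hρ0, mul_zero]
    have hi : ∀ g : ℝ × Eu d → ℝ, Continuous g → Integrable g (T.prod μ) := fun g hg =>
      integrable_of_continuous_of_compact (isCompact_Icc.prod hΩ) hsupp hg
    have e1 : ∫ t in Icc (0 : ℝ) 1, ∫ x, deriv (fun s => f s x) t ∂(ρ t : Measure (Eu d)) =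
        ∫ t, ∫ x, G1 (t, x) ∂μ ∂T := by
      refine setIntegral_congr_fun measurableSet_Icc fun t ht => ?_
      exact map_flow_apply hφ hρ ht ((continuous_deriv_fst hf).comp (Continuous.prodMk_right t))
    have e2 : ∫ t in Icc (0 : ℝ) 1, ∫ x, inner ℝ (gradient (f t) x) (v t x) ∂(ρ t : Measure (Eu d))
        = ∫ t, ∫ x, G2 (t, x) ∂μ ∂T := by
      refine setIntegral_congr_fun measurableSet_Icc fun t ht => ?_
      exact map_flow_apply hφ hρ ht
        (((continuous_gradient hf).comp (Continuous.prodMk_right t)).inner (hvt t))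
    have hI : ∀ t ∈ Icc (0 : ℝ) 1, Integrable (fun x => f t (φ t x)) μ := fun t _ =>
      integrable_of_continuous_of_compact hΩ hρ0
        (hf.continuous.comp (hΦ.comp (Continuous.prodMk_right t)))
    have hft : ∀ t, Continuous (f t) := fun t => hf.continuous.comp (Continuous.prodMk_right t)
    rw [e1, e2, ← integral_add (hi _ hG1).integral_prod_left (hi _ hG2).integral_prod_left]
    have e3 : ∀ t, (∫ x, G1 (t, x) ∂μ) + ∫ x, G2 (t, x) ∂μ = ∫ x, (G1 (t, x) + G2 (t, x)) ∂μ :=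
      fun t => (integral_add
        (integrable_of_continuous_of_compact hΩ hρ0 (hG1.comp (Continuous.prodMk_right t)))
        (integrable_of_continuous_of_compact hΩ hρ0 (hG2.comp (Continuous.prodMk_right t)))).symm
    simp only [e3]
    rw [integral_integral_swap (f := fun t x => G1 (t, x) + G2 (t, x)) (hi _ (hG1.add hG2))]
    have h1I : (1 : ℝ) ∈ Icc (0 : ℝ) 1 := ⟨zero_le_one, le_rfl⟩
    have h0I : (0 : ℝ) ∈ Icc (0 : ℝ) 1 := ⟨le_rfl, zero_le_one⟩
    rw [map_flow_apply hφ hρ h1I (hft 1), map_flow_apply hφ hρ h0I (hft 0),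
      ← integral_sub (hI 1 h1I) (hI 0 h0I)]
    refine integral_congr_ae (ae_of_all _ fun x => ?_)
    have hc : Continuous fun t => G1 (t, x) + G2 (t, x) :=
      (hG1.add hG2).comp (Continuous.prodMk_left x)
    have := intervalIntegral.integral_eq_sub_of_hasDerivAt_of_le (zero_le_one (α := ℝ))
      (f := fun t => f t (φ t x)) (f' := fun t => G1 (t, x) + G2 (t, x))
      (hf.continuous.comp (hΦ.comp (Continuous.prodMk_left x))).continuousOn
      (fun t ht => hasDerivAt_comp_curve hf (hφ.hasDerivAt x ht)) (hc.intervalIntegrable _ _)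
    rw [intervalIntegral.integral_of_le zero_le_one, ← integral_Icc_eq_integral_Ioc] at this
    exact this

lemma IsLipFlow.energy_le {v φ : ℝ → Eu d → Eu d} {K : ℝ≥0} (hv : IsLipField v K)
    (hφ : IsLipFlow v φ K) {Ω : Set (Eu d)} (hΩ : IsCompact Ω) {ρ : ℝ → ProbabilityMeasure (Eu d)}
    (hρ0 : (ρ 0 : Measure (Eu d)) Ωᶜ = 0)
    (hρ : ∀ t ∈ Icc (0 : ℝ) 1,
      (ρ t : Measure (Eu d)) = Measure.map (φ t) (ρ 0 : Measure (Eu d))) :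
    energy ρ ≤ (K : ℝ≥0∞) ^ 2 := by
  refine (iInf₂_le v (hφ.isCE hv hΩ hρ0 hρ)).trans ?_
  have h1 : ∀ t, ∫⁻ x, ‖v t x‖ₑ ^ 2 ∂(ρ t : Measure (Eu d)) ≤ (K : ℝ≥0∞) ^ 2 := fun t => by
    refine (lintegral_mono fun x => ?_).trans_eq
      ((lintegral_const ((K : ℝ≥0∞) ^ 2)).trans (by simp))
    exact pow_le_pow_left' (enorm_le_coe.2 (hv.norm_le t x)) 2
  calc _ ≤ ∫⁻ t in Icc (0 : ℝ) 1, (K : ℝ≥0∞) ^ 2 := lintegral_mono fun t => h1 t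
    _ = (K : ℝ≥0∞) ^ 2 := by simp

/-- A potential of the initial field increases along the curve. -/
lemma IsLipFlow.integral_potential_sub_ge {v φ : ℝ → Eu d → Eu d} {K : ℝ≥0} {K' : ℝ}
    (hv : IsLipField v K)
    (hφ : IsLipFlow v φ K) {Ω : Set (Eu d)} (hΩ : IsCompact Ω) {ρ : ℝ → ProbabilityMeasure (Eu d)}
    (hρ0 : (ρ 0 : Measure (Eu d)) Ωᶜ = 0)
    (hρ : ∀ t ∈ Icc (0 : ℝ) 1,
      (ρ t : Measure (Eu d)) = Measure.map (φ t) (ρ 0 : Measure (Eu d)))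
    (hK' : ∀ t ∈ Icc (0 : ℝ) 1, ∀ x, ‖v t x - v 0 x‖ ≤ K')
    {ψ : Eu d → ℝ} (hψ : ∀ x, HasGradientAt ψ (v 0 x) x) :
    (∫ x, ‖v 0 x‖ ^ 2 ∂(ρ 0 : Measure (Eu d))) - (2 * (K : ℝ) ^ 3 + K * K') ≤
      (∫ x, ψ x ∂(ρ 1 : Measure (Eu d))) - ∫ x, ψ x ∂(ρ 0 : Measure (Eu d)) := by
  set μ : Measure (Eu d) := (ρ 0 : Measure (Eu d))
  have hψc : Continuous ψ := continuous_iff_continuousAt.2 fun x => (hψ x).differentiableAt.continuousAt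
  have h1I : (1 : ℝ) ∈ Icc (0 : ℝ) 1 := ⟨zero_le_one, le_rfl⟩
  have hφt : ∀ t, Continuous (φ t) := fun t => hφ.continuous.comp (Continuous.prodMk_right t)
  have hv0 : Continuous (v 0) := (hv.lipschitz 0).continuous
  have hi : ∀ g : Eu d → ℝ, Continuous g → Integrable g μ := fun g hg =>
    integrable_of_continuous_of_compact hΩ hρ0 hg
  have hmap : ∫ x, ψ x ∂(ρ 1 : Measure (Eu d)) = ∫ x, ψ (φ 1 x) ∂μ := map_flow_apply hφ hρ h1I hψc
  rw [hmap, ← integral_sub (f := fun x => ψ (φ 1 x)) (hi _ (hψc.comp (hφt 1))) (hi _ hψc)]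
  have hconst : (∫ x, ‖v 0 x‖ ^ 2 ∂μ) - (2 * (K : ℝ) ^ 3 + K * K') =
      ∫ x, (‖v 0 x‖ ^ 2 - (2 * (K : ℝ) ^ 3 + K * K')) ∂μ := by
    rw [integral_sub (f := fun x => ‖v 0 x‖ ^ 2) (hi _ (hv0.norm.pow 2)) (integrable_const _)]
    simp
  rw [hconst]
  refine integral_mono (hi _ ((hv0.norm.pow 2).sub continuous_const))
    (hi _ ((hψc.comp (hφt 1)).sub hψc)) fun x => ?_
  have hK0 : 0 ≤ (K : ℝ) := K.2
  -- A trajectory moves by at most `K`, which changes `v 0` by at most `K * K` and its squared norm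
  -- by at most `2 * K ^ 3`. Replacing `v 0` by `v t` in the second factor costs `K * K'`.
  have hmain : ∀ t ∈ Ioo (0 : ℝ) 1, ‖v 0 x‖ ^ 2 - (2 * (K : ℝ) ^ 3 + K * K') ≤
      inner ℝ (v 0 (φ t x)) (v t (φ t x)) := by
    intro t ht
    have h1 : ‖v 0 (φ t x) - v 0 x‖ ≤ K * K := by
      have h2 := (hv.lipschitz 0).dist_le_mul (φ t x) x
      have h3 := (hφ.lipschitz_time x).dist_le_mul t 0
      simp only [hφ.zero, Real.dist_eq, sub_zero, abs_of_pos ht.1] at h3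
      rw [← dist_eq_norm]
      refine h2.trans (mul_le_mul_of_nonneg_left (h3.trans ?_) hK0)
      exact mul_le_of_le_one_right hK0 ht.2.le
    have h4 := hK' t ⟨ht.1.le, ht.2.le⟩ (φ t x)
    set a := v 0 x with ha
    set b := v 0 (φ t x)
    set c := v t (φ t x)
    have hb : ‖b‖ ≤ K := hv.norm_le 0 _
    have ha' : ‖a‖ ≤ K := hv.norm_le 0 _
    have e1 : inner ℝ b c = ‖b‖ ^ 2 + inner ℝ b (c - b) := by
      rw [inner_sub_right, real_inner_self_eq_norm_sq]; ring
    have e2 : |inner ℝ b (c - b)| ≤ K * K' :=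
      (abs_real_inner_le_norm _ _).trans (mul_le_mul hb h4 (norm_nonneg _) hK0)
    have e3 : ‖a‖ ≤ ‖b‖ + K * K := by
      have := norm_sub_norm_le a b
      rw [norm_sub_rev] at this
      linarith
    have e4 := (abs_le.1 e2).1
    have e5 := norm_nonneg a
    have e6 := norm_nonneg b
    rw [e1]
    nlinarith [mul_le_mul_of_nonneg_right ha' (mul_nonneg hK0 hK0),
      mul_le_mul_of_nonneg_right hb (mul_nonneg hK0 hK0)]
  have hder : ∀ t ∈ Ioo (0 : ℝ) 1,
      HasDerivAt (fun s => ψ (φ s x)) (inner ℝ (v 0 (φ t x)) (v t (φ t x))) t := by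
    intro t ht
    have h := (hψ (φ t x)).hasFDerivAt.comp_hasDerivAt t (hφ.hasDerivAt x ht)
    rw [InnerProductSpace.toDual_apply_apply] at h
    exact h
  have hcψ : ContinuousOn (fun s => ψ (φ s x)) (Icc 0 1) :=
    (hψc.comp (hφ.lipschitz_time x).continuous).continuousOn
  -- The lower bound on the derivative is uniform in time, so the mean value theorem gives the
  -- increment without integrating.
  obtain ⟨t, ht, hteq⟩ := exists_hasDerivAt_eq_slope (fun s => ψ (φ s x)) _ zero_lt_one hcψ hder
  have := hmain t ht
  rw [hteq, hφ.zero] at this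
  simpa using this

end Flow

/-! ### Transport along the geodesics of the parameter manifold -/

section Transport

variable {d m : ℕ} {M : Type*} [MetricSpace M] [ChartedSpace (Eu m) M] [IsManifold (𝓡 m) ∞ M]
  [Bundle.RiemannianBundle (fun x : M => TangentSpace (𝓡 m) x)]
  [IsContMDiffRiemannianBundle (𝓡 m) ∞ (Eu m) (fun x : M => TangentSpace (𝓡 m) x)]
  [IsRiemannianManifold (𝓡 m) M]
  {Ω : Set (Eu d)} {S : Set M} {D : Set (TangentBundle (𝓡 m) M)}
  {E : M → ProbabilityMeasure (Eu d)}
  {B : ∀ θ : M, TangentSpace (𝓡 m) θ →ₗ[ℝ] (Eu d → Eu d)}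

lemma IsParameterManifold.pathField_zero (hS : IsParameterManifold S D)
    {p : TangentBundle (𝓡 m) M} (hp : p ∈ D) : pathField B (expCurve p) 0 = B p.proj p.snd := by
  unfold pathField
  rw [hS.velocity_zero hp]

/-- The field along a geodesic given by `D`, extended constantly in time. -/
def geodesicField (B : ∀ θ : M, TangentSpace (𝓡 m) θ →ₗ[ℝ] (Eu d → Eu d))
    (p : TangentBundle (𝓡 m) M) (t : ℝ) : Eu d → Eu d :=
  pathField B (expCurve p) (projIcc (0 : ℝ) 1 zero_le_one t : ℝ)

lemma geodesicField_of_mem {p : TangentBundle (𝓡 m) M} {t : ℝ} (ht : t ∈ Icc (0 : ℝ) 1) :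
    geodesicField B p t = pathField B (expCurve p) t := by
  unfold geodesicField
  rw [projIcc_of_mem zero_le_one ht]

/-- The bounds on the maps `B` that are used along geodesics. -/
def VelocityBounds (D : Set (TangentBundle (𝓡 m) M))
    (B : ∀ θ : M, TangentSpace (𝓡 m) θ →ₗ[ℝ] (Eu d → Eu d)) (C : ℝ) : Prop :=
  ∀ p ∈ D, (∀ x, ‖B p.proj p.snd x‖ ≤ C * ‖p.snd‖ ∧ ‖fderiv ℝ (B p.proj p.snd) x‖ ≤ C * ‖p.snd‖) ∧
    (∀ x, ∀ t ∈ Icc (0 : ℝ) 1, ∃ a : Eu d,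
      HasDerivWithinAt (fun s => pathField B (expCurve p) s x) a (Icc 0 1) t ∧ ‖a‖ ≤ C * ‖p.snd‖ ^ 2)

variable {C : ℝ}

lemma VelocityBounds.norm_pathField_sub_le (hC : VelocityBounds D B C)
    {p : TangentBundle (𝓡 m) M} (hp : p ∈ D) (x : Eu d) {s t : ℝ} (hs : s ∈ Icc (0 : ℝ) 1)
    (ht : t ∈ Icc (0 : ℝ) 1) :
    ‖pathField B (expCurve p) t x - pathField B (expCurve p) s x‖ ≤ C * ‖p.snd‖ ^ 2 * |t - s| := by
  choose! a ha hab using (hC p hp).2 x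
  exact (convex_Icc 0 1).norm_image_sub_le_of_norm_hasDerivWithin_le ha hab hs ht

lemma VelocityBounds.continuous_geodesicField (hC : VelocityBounds D B C)
    {p : TangentBundle (𝓡 m) M} (hp : p ∈ D) (x : Eu d) :
    Continuous fun t => geodesicField B p t x := by
  have h : ContinuousOn (fun t => pathField B (expCurve p) t x) (Icc 0 1) := fun t ht => by
    obtain ⟨a, ha, -⟩ := (hC p hp).2 x t ht
    exact ha.continuousWithinAt
  exact h.comp_continuous (continuous_subtype_val.comp continuous_projIcc) fun t => Subtype.prop _

/-- By `restart_mem` the velocity at time `t`, scaled by `1 - t`, lies in `D`, where the bounds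
hold; the factor cancels by linearity of `B`. -/
lemma VelocityBounds.norm_le_of_mem_Ioo (hS : IsParameterManifold S D) (hC : VelocityBounds D B C)
    {p : TangentBundle (𝓡 m) M} (hp : p ∈ D) {t : ℝ} (ht : t ∈ Ioo (0 : ℝ) 1) (x : Eu d) :
    ‖pathField B (expCurve p) t x‖ ≤ C * ‖p.snd‖ ∧
      ‖fderiv ℝ (pathField B (expCurve p) t) x‖ ≤ C * ‖p.snd‖ := by
  have ht1 : 0 < 1 - t := sub_pos.2 ht.2
  have h := (hC _ (hS.restart_mem hp ht)).1 x
  have hn : ‖(1 - t) • (velocity (m := m) (expCurve p) t).snd‖ = (1 - t) * ‖p.snd‖ := by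
    rw [norm_smul, Real.norm_of_nonneg ht1.le, hS.constSpeed p hp t ⟨ht.1.le, ht.2.le⟩]
  have hB : B (expCurve p t) ((1 - t) • (velocity (m := m) (expCurve p) t).snd) =
      (1 - t) • pathField B (expCurve p) t := map_smul _ _ _
  obtain ⟨h1, h2⟩ := h
  change ‖B (expCurve p t) ((1 - t) • (velocity (m := m) (expCurve p) t).snd) x‖ ≤
    C * ‖(1 - t) • (velocity (m := m) (expCurve p) t).snd‖ at h1
  change ‖fderiv ℝ (B (expCurve p t) ((1 - t) • (velocity (m := m) (expCurve p) t).snd)) x‖ ≤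
    C * ‖(1 - t) • (velocity (m := m) (expCurve p) t).snd‖ at h2
  rw [hn, hB] at h1 h2
  rw [fderiv_const_smul_field, Pi.smul_apply, norm_smul, Real.norm_of_nonneg ht1.le] at h2
  rw [Pi.smul_apply, norm_smul, Real.norm_of_nonneg ht1.le] at h1
  constructor
  · exact le_of_mul_le_mul_left (h1.trans_eq (by ring)) ht1
  · exact le_of_mul_le_mul_left (h2.trans_eq (by ring)) ht1

/-- The restarted vector degenerates to zero at time 1, so the bounds are proved on the open
interval and extended by continuity in time. -/
lemma VelocityBounds.isLipField (hS : IsParameterManifold S D) (hC : VelocityBounds D B C)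
    (hC0 : 0 < C) (hB : ∀ θ ∈ S, ∀ η : TangentSpace (𝓡 m) θ, ContDiff ℝ 1 (B θ η))
    {p : TangentBundle (𝓡 m) M} (hp : p ∈ D) :
    IsLipField (geodesicField B p) (C.toNNReal * ‖p.snd‖₊) := by
  have hK : ((C.toNNReal * ‖p.snd‖₊ : ℝ≥0) : ℝ) = C * ‖p.snd‖ := by
    rw [NNReal.coe_mul, Real.coe_toNNReal _ hC0.le, coe_nnnorm]
  have hcl : ∀ P : ℝ → Prop, IsClosed {t | P t} → (∀ t ∈ Ioo (0 : ℝ) 1, P t) →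
      ∀ t ∈ Icc (0 : ℝ) 1, P t := fun P hP h t ht => by
    rw [← closure_Ioo (zero_ne_one (α := ℝ))] at ht
    exact closure_minimal (fun s hs => h s hs) hP ht
  have hproj : ∀ t, geodesicField B p t =
      geodesicField B p (projIcc (0 : ℝ) 1 zero_le_one t : ℝ) := fun t => by
    simp [geodesicField]
  have hcont := hC.continuous_geodesicField hp
  refine ⟨fun t x => ?_, fun t => LipschitzWith.of_dist_le_mul fun x y => ?_, hcont⟩
  · rw [hproj, hK]
    refine hcl (fun t => ‖geodesicField B p t x‖ ≤ C * ‖p.snd‖)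
      (isClosed_le (hcont x).norm continuous_const) (fun t ht => ?_) _ (Subtype.prop _)
    rw [geodesicField_of_mem ⟨ht.1.le, ht.2.le⟩]
    exact (hC.norm_le_of_mem_Ioo hS hp ht x).1
  · rw [hproj, hK]
    refine hcl (fun t => dist (geodesicField B p t x) (geodesicField B p t y) ≤
        C * ‖p.snd‖ * dist x y)
      (isClosed_le ((hcont x).dist (hcont y)) continuous_const) (fun t ht => ?_) _ (Subtype.prop _)
    rw [geodesicField_of_mem ⟨ht.1.le, ht.2.le⟩]
    have hd : ContDiff ℝ 1 (pathField B (expCurve p) t) :=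
      hB _ (hS.curve_mem p hp t ⟨ht.1.le, ht.2.le⟩) _
    have := (convex_univ : Convex ℝ (univ : Set (Eu d))).norm_image_sub_le_of_norm_fderiv_le
      (f := pathField B (expCurve p) t)
      (fun z _ => hd.differentiable one_ne_zero z)
      (fun z _ => (hC.norm_le_of_mem_Ioo hS hp ht z).2) (mem_univ y) (mem_univ x)
    rwa [dist_eq_norm, dist_eq_norm]

/-- Along a geodesic given by `D` the measures are transported by a Lipschitz flow. -/
lemma exists_flow_expCurve (hS : IsParameterManifold S D) (hC : VelocityBounds D B C)
    (hC0 : 0 < C) (hB : ∀ θ ∈ S, ∀ η : TangentSpace (𝓡 m) θ, ContDiff ℝ 1 (B θ η))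
    (hc : IsConsistent Ω S E B) {p : TangentBundle (𝓡 m) M} (hp : p ∈ D) :
    ∃ φ, IsLipFlow (geodesicField B p) φ (C.toNNReal * ‖p.snd‖₊) ∧ ∀ t ∈ Icc (0 : ℝ) 1,
      (E (expCurve p t) : Measure (Eu d)) =
        Measure.map (φ t) (E (expCurve p 0) : Measure (Eu d)) := by
  obtain ⟨φ, hφ⟩ := (hC.isLipField hS hC0 hB hp).exists_flow
  exact ⟨φ, hφ, hc _ (hS.isLipPath_expCurve hp) φ
    (hφ.isFlow (fun t ht => geodesicField_of_mem ht) Ω)⟩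

lemma IsVelocityMap.exists_bounds (hB : IsVelocityMap S D E B) :
    ∃ C : ℝ, 0 < C ∧ VelocityBounds D B C ∧ ∀ p ∈ D,
      ENNReal.ofReal (C⁻¹ * ‖p.snd‖) ≤ eLpNorm (B p.proj p.snd) 2 (E p.proj : Measure (Eu d)) := by
  obtain ⟨C, hC0, h⟩ := hB.bounds
  exact ⟨C, hC0, fun p hp => ⟨(h p hp).2.1, (h p hp).2.2⟩, fun p hp => (h p hp).1.1⟩

/-- Any two points of `S` are joined by a curve whose energy is controlled by the distance. -/
lemma exists_path_energy_le (hΩ : IsCompact Ω) (hS : IsParameterManifold S D)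
    (hE : IsEmbedding Ω S E) (hB : IsVelocityMap S D E B) (hc : IsConsistent Ω S E B) :
    ∃ A : ℝ≥0, ∀ θ₀ ∈ S, ∀ θ₁ ∈ S, ∃ γ : ℝ → M, IsLipPath S γ ∧ γ 0 = θ₀ ∧ γ 1 = θ₁ ∧
      energy (fun t => E (γ t)) ≤ ((A * nndist θ₀ θ₁ : ℝ≥0) : ℝ≥0∞) ^ 2 := by
  obtain ⟨C, hC0, hC, -⟩ := hB.exists_bounds
  refine ⟨C.toNNReal, fun θ₀ h₀ θ₁ h₁ => ?_⟩
  obtain ⟨p, hp, rfl, rfl⟩ := hS.joined θ₀ h₀ θ₁ h₁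
  refine ⟨expCurve p, hS.isLipPath_expCurve hp, hS.expCurve_zero hp, expCurve_one p, ?_⟩
  obtain ⟨φ, hφ, hρ⟩ := exists_flow_expCurve hS hC hC0 hB.contDiff hc hp
  have hn : nndist p.proj (riemExp p) = ‖p.snd‖₊ := NNReal.eq (hS.minimizing p hp)
  rw [hn]
  exact hφ.energy_le (hC.isLipField hS hC0 hB.contDiff hp) hΩ
    (ρ := fun t => E (expCurve p t)) (hE.supported _ (by rw [hS.expCurve_zero hp]; exact h₀)) hρ

/-- Nearby points of `S` are separated by a test function with bounded gradient, at a rate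
proportional to their distance. -/
lemma exists_separating_function (hΩ : IsCompact Ω) (hS : IsParameterManifold S D)
    (hE : IsEmbedding Ω S E) (hB : IsVelocityMap S D E B) (hc : IsConsistent Ω S E B) :
    ∃ C₀ : ℝ≥0, ∃ δ₀ > 0, ∀ θ ∈ S, ∀ θ' ∈ S, dist θ θ' ≤ δ₀ →
      ∃ ψ : Eu d → ℝ, ContDiff ℝ 1 ψ ∧ (∀ x, ‖gradient ψ x‖ ≤ C₀) ∧
        dist θ θ' ≤ (∫ x, ψ x ∂(E θ' : Measure (Eu d))) - ∫ x, ψ x ∂(E θ : Measure (Eu d)) := by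
  obtain ⟨C, hC0, hC, hlow⟩ := hB.exists_bounds
  have hR : 0 < 2 * C ^ 3 + C ^ 2 := by positivity
  -- At distance `δ` the potential gains at least `C⁻² δ²` up to an error `(2 C³ + C²) δ³`. The
  -- threshold makes the error at most half of the gain.
  refine ⟨(2 * C ^ 3).toNNReal, (C⁻¹) ^ 2 / (2 * (2 * C ^ 3 + C ^ 2)), by positivity,
    fun θ hθ θ' hθ' hdist => ?_⟩
  obtain ⟨p, hp, rfl, rfl⟩ := hS.joined θ hθ θ' hθ'
  have hδ := hS.minimizing p hp
  rw [hδ] at hdist ⊢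
  set δ := ‖p.snd‖ with hδdef
  rcases (norm_nonneg p.snd).eq_or_lt with h0 | hpos
  · refine ⟨0, contDiff_const, fun x => ?_, ?_⟩
    · have : gradient (0 : Eu d → ℝ) x = 0 := gradient_fun_const x 0
      rw [this, norm_zero]
      exact NNReal.coe_nonneg _
    · rw [hδdef, ← h0]; simp
  rw [← hδdef] at hpos
  obtain ⟨φ, hφ, hρ⟩ := exists_flow_expCurve hS hC hC0 hB.contDiff hc hp
  have hv := hC.isLipField hS hC0 hB.contDiff hp
  have h0I : (0 : ℝ) ∈ Icc (0 : ℝ) 1 := ⟨le_rfl, zero_le_one⟩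
  have hK : ((C.toNNReal * ‖p.snd‖₊ : ℝ≥0) : ℝ) = C * δ := by
    rw [NNReal.coe_mul, Real.coe_toNNReal _ hC0.le, coe_nnnorm]
  have hv0 : geodesicField B p 0 = B p.proj p.snd := by
    rw [geodesicField_of_mem h0I, hS.pathField_zero hp]
  have hsub : ∀ t ∈ Icc (0 : ℝ) 1, ∀ x,
      ‖geodesicField B p t x - geodesicField B p 0 x‖ ≤ C * δ ^ 2 := by
    intro t ht x
    rw [geodesicField_of_mem ht, geodesicField_of_mem h0I]
    refine (hC.norm_pathField_sub_le hp x h0I ht).trans ?_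
    rw [sub_zero, abs_of_nonneg ht.1]
    exact mul_le_of_le_one_right (by positivity) ht.2
  obtain ⟨ψ, hψ⟩ := hB.isGradient _ hθ p.snd
  have hmain := hφ.integral_potential_sub_ge hv hΩ (ρ := fun t => E (expCurve p t))
    (hE.supported _ (by rw [hS.expCurve_zero hp]; exact hθ)) hρ hsub (ψ := ψ)
    (by rw [hv0]; exact hψ)
  simp only [hK, expCurve_one, hS.expCurve_zero hp, hv0] at hmain
  have hcB : ContDiff ℝ 1 (B p.proj p.snd) := hB.contDiff _ hθ _
  have hL2 : (C⁻¹ * δ) ^ 2 ≤ ∫ x, ‖B p.proj p.snd x‖ ^ 2 ∂(E p.proj : Measure (Eu d)) := by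
    have hmem : MemLp (B p.proj p.snd) 2 (E p.proj : Measure (Eu d)) :=
      MemLp.of_bound hcB.continuous.aestronglyMeasurable (C * δ)
        (ae_of_all _ fun x => ((hC p hp).1 x).1)
    have h1 := hlow p hp
    rw [hmem.eLpNorm_eq_integral_rpow_norm two_ne_zero ENNReal.ofNat_ne_top] at h1
    have hnn : 0 ≤ ∫ x, ‖B p.proj p.snd x‖ ^ 2 ∂(E p.proj : Measure (Eu d)) :=
      integral_nonneg fun x => by positivity
    simp only [ENNReal.toReal_ofNat, Real.rpow_ofNat] at h1
    rw [ENNReal.ofReal_le_ofReal_iff (by positivity), show (2 : ℝ)⁻¹ = 1 / 2 by norm_num,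
      ← Real.sqrt_eq_rpow] at h1
    calc (C⁻¹ * δ) ^ 2 ≤ _ := pow_le_pow_left₀ (by positivity) h1 2
      _ = _ := Real.sq_sqrt hnn
  have hgrad : ∀ x, gradient ψ x = B p.proj p.snd x := fun x => (hψ x).gradient
  have hψ1 : ContDiff ℝ 1 ψ := by
    rw [contDiff_one_iff_fderiv]
    refine ⟨fun x => (hψ x).differentiableAt, ?_⟩
    have : fderiv ℝ ψ = fun x => InnerProductSpace.toDual ℝ (Eu d) (B p.proj p.snd x) :=
      funext fun x => (hψ x).hasFDerivAt.fderiv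
    rw [this]
    exact (InnerProductSpace.toDual ℝ (Eu d)).continuous.comp hcB.continuous
  -- The factor turns the remaining gain `C⁻² δ² / 2` into `δ`, and the gradient bound `C δ` into `2
  -- C³`, independent of `δ`.
  refine ⟨fun x => (2 * C ^ 2 / δ) * ψ x, contDiff_const.mul hψ1, fun x => ?_, ?_⟩
  · have h1 : gradient (fun x => (2 * C ^ 2 / δ) * ψ x) x = (2 * C ^ 2 / δ) • B p.proj p.snd x := by
      refine HasGradientAt.gradient ?_
      rw [hasGradientAt_iff_hasFDerivAt, map_smul]
      exact (hψ x).hasFDerivAt.const_mul _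
    rw [h1, norm_smul, Real.norm_of_nonneg (by positivity), Real.coe_toNNReal _ (by positivity)]
    calc 2 * C ^ 2 / δ * ‖B p.proj p.snd x‖ ≤ 2 * C ^ 2 / δ * (C * δ) :=
          mul_le_mul_of_nonneg_left ((hC p hp).1 x).1 (by positivity)
      _ = 2 * C ^ 3 := by field_simp
  · rw [integral_const_mul, integral_const_mul, ← mul_sub]
    have h2 : 2 * (C * δ) ^ 3 + C * δ * (C * δ ^ 2) ≤ (C⁻¹ * δ) ^ 2 / 2 := by
      have h3 : δ * (2 * C ^ 3 + C ^ 2) ≤ (C⁻¹) ^ 2 / 2 := by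
        rw [le_div_iff₀ (by positivity)] at hdist
        linarith
      calc 2 * (C * δ) ^ 3 + C * δ * (C * δ ^ 2) = δ ^ 2 * (δ * (2 * C ^ 3 + C ^ 2)) := by ring
        _ ≤ δ ^ 2 * ((C⁻¹) ^ 2 / 2) := mul_le_mul_of_nonneg_left h3 (by positivity)
        _ = _ := by ring
    calc δ = 2 * C ^ 2 / δ * ((C⁻¹ * δ) ^ 2 / 2) := by field_simp
      _ ≤ _ := mul_le_mul_of_nonneg_left (by linarith) (by positivity)

end Transport

/-! ### Narrowly continuous curves of measures on a compact set -/

section Curves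

open ProbabilityTheory

variable {d : ℕ}

/-- Integrals depend continuously on the parameters of the integrand and of the measure. -/
lemma continuous_integral_of_continuous {Y : Type*} [TopologicalSpace Y]
    {Ω : Set (Eu d)} (hΩ : IsCompact Ω) {ρ : Y → ProbabilityMeasure (Eu d)} (hρ : Continuous ρ)
    (hs : ∀ y, (ρ y : Measure (Eu d)) Ωᶜ = 0) {f : Y → Eu d → ℝ}
    (hf : Continuous (Function.uncurry f)) :
    Continuous fun y => ∫ x, f y x ∂(ρ y : Measure (Eu d)) := by
  rw [continuous_iff_continuousAt]
  intro y₀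
  have hft : ∀ y, Continuous (f y) := fun y => hf.comp (Continuous.prodMk_right y)
  have hi : ∀ (g : Eu d → ℝ) (_ : Continuous g) y, Integrable g (ρ y : Measure (Eu d)) :=
    fun g hg y => integrable_of_continuous_of_compact hΩ (hs y) hg
  obtain ⟨R, hR⟩ := hΩ.exists_bound_of_continuousOn (hft y₀).continuousOn
  -- Narrow convergence tests only bounded functions; the truncation at `R` changes nothing on `Ω`,
  -- which carries all the measures.
  obtain ⟨g, hg⟩ : ∃ g : BoundedContinuousFunction (Eu d) ℝ, ∀ x, g x = max (-R) (min R (f y₀ x)) := by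
    refine ⟨BoundedContinuousFunction.ofNormedAddCommGroup (fun x => max (-R) (min R (f y₀ x)))
      (by have := hft y₀; fun_prop) |R| fun x => ?_, fun x => rfl⟩
    rw [Real.norm_eq_abs, abs_le]
    constructor
    · exact (neg_le_neg (le_abs_self R)).trans (le_max_left _ _)
    · exact max_le (neg_le_abs R) ((min_le_left _ _).trans (le_abs_self R))
  have hgf : ∀ y, ∫ x, f y₀ x ∂(ρ y : Measure (Eu d)) = ∫ x, g x ∂(ρ y : Measure (Eu d)) := by
    intro y
    refine integral_congr_ae ?_
    have h1 : ∀ᵐ x ∂(ρ y : Measure (Eu d)), x ∈ Ω := ae_iff.2 (hs y)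
    filter_upwards [h1] with x hx
    have h2 := abs_le.1 (hR x hx)
    rw [hg, min_eq_right h2.2, max_eq_right h2.1]
  have hweak : Tendsto (fun y => ∫ x, f y₀ x ∂(ρ y : Measure (Eu d))) (𝓝 y₀)
      (𝓝 (∫ x, f y₀ x ∂(ρ y₀ : Measure (Eu d)))) := by
    simp only [hgf]
    exact ProbabilityMeasure.tendsto_iff_forall_integral_tendsto.1 hρ.continuousAt g
  have hunif : Tendsto (fun y => (∫ x, f y x ∂(ρ y : Measure (Eu d))) -
      ∫ x, f y₀ x ∂(ρ y : Measure (Eu d))) (𝓝 y₀) (𝓝 0) := by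
    rw [Metric.tendsto_nhds]
    intro ε hε
    -- Compactness of `Ω` makes these neighbourhoods uniform in `x`, so `f y` is uniformly close to
    -- `f y₀` on `Ω`.
    have h1 : ∀ x ∈ Ω, ∀ᶠ z : Y × Eu d in 𝓝 (y₀, x), |f z.1 z.2 - f y₀ z.2| < ε / 2 := by
      intro x _
      have : Continuous fun z : Y × Eu d => |f z.1 z.2 - f y₀ z.2| :=
        (hf.sub ((hft y₀).comp continuous_snd)).abs
      exact this.continuousAt.eventually_lt continuousAt_const (by simpa using half_pos hε)
    have h2 : ∀ᶠ y in 𝓝 y₀, ∀ x ∈ Ω, |f y x - f y₀ x| < ε / 2 :=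
      hΩ.eventually_forall_of_forall_eventually h1
    filter_upwards [h2] with y hy
    rw [← integral_sub (hi _ (hft y) y) (hi _ (hft y₀) y), dist_zero_right]
    have h3 : ∀ᵐ x ∂(ρ y : Measure (Eu d)), ‖f y x - f y₀ x‖ ≤ ε / 2 := by
      have h1 : ∀ᵐ x ∂(ρ y : Measure (Eu d)), x ∈ Ω := ae_iff.2 (hs y)
      filter_upwards [h1] with x hx using (hy x hx).le
    have h4 := norm_integral_le_of_norm_le_const h3
    simp only [probReal_univ, mul_one] at h4
    linarith
  have := hunif.add hweak
  simp only [sub_add_cancel, zero_add] at this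
  exact this

/-- The kernel of a narrowly continuous curve. -/
def curveKernel (ρ : ℝ → ProbabilityMeasure (Eu d)) (hρ : Continuous ρ) : Kernel ℝ (Eu d) where
  toFun t := (ρ t : Measure (Eu d))
  measurable' := by
    -- Closed sets suffice, and their mass is a pointwise limit of integrals of thickened
    -- indicators, which are continuous in `t`.
    refine Measurable.measure_of_isPiSystem_of_isProbabilityMeasure (S := {s | IsClosed s})
      (BorelSpace.measurable_eq.trans borel_eq_generateFrom_isClosed) isPiSystem_isClosed fun s hs => ?_
    have hpos : ∀ n : ℕ, (0 : ℝ) < 1 / ((n : ℝ) + 1) := fun n => Nat.one_div_pos_of_nat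
    have hlim : ∀ t, Tendsto (fun n : ℕ => ∫⁻ x, (thickenedIndicator (hpos n) s x : ℝ≥0∞)
        ∂(ρ t : Measure (Eu d))) atTop (𝓝 ((ρ t : Measure (Eu d)) s)) := fun t =>
      tendsto_lintegral_thickenedIndicator_of_isClosed _ hs hpos
        tendsto_one_div_add_atTop_nhds_zero_nat
    refine ENNReal.measurable_of_tendsto (fun n => ?_) (tendsto_pi_nhds.2 hlim)
    have h1 : Continuous fun t => (ρ t).toFiniteMeasure.testAgainstNN
        (thickenedIndicator (hpos n) s) :=
      (ProbabilityMeasure.continuous_testAgainstNN_eval _).comp hρ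
    have h2 : (fun t => ∫⁻ x, (thickenedIndicator (hpos n) s x : ℝ≥0∞) ∂(ρ t : Measure (Eu d))) =
        fun t => (((ρ t).toFiniteMeasure.testAgainstNN (thickenedIndicator (hpos n) s) : ℝ≥0) :
          ℝ≥0∞) := by
      funext t
      rw [FiniteMeasure.testAgainstNN_coe_eq]
      rfl
    rw [h2]
    exact h1.measurable.coe_nnreal_ennreal

instance (ρ : ℝ → ProbabilityMeasure (Eu d)) (hρ : Continuous ρ) :
    IsMarkovKernel (curveKernel ρ hρ) :=
  ⟨fun t => inferInstanceAs (IsProbabilityMeasure (ρ t : Measure (Eu d)))⟩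

/-- The measure `ρ t (dx) dt` on `[0,1] × ℝ^d`. -/
def spaceTime (ρ : ℝ → ProbabilityMeasure (Eu d)) (hρ : Continuous ρ) : Measure (ℝ × Eu d) :=
  (volume.restrict (Icc (0 : ℝ) 1)) ⊗ₘ curveKernel ρ hρ

variable {ρ : ℝ → ProbabilityMeasure (Eu d)}

instance (hρ : Continuous ρ) : IsFiniteMeasure (spaceTime ρ hρ) := by
  unfold spaceTime
  infer_instance

lemma lintegral_spaceTime (hρ : Continuous ρ) {g : ℝ × Eu d → ℝ≥0∞} (hg : Measurable g) :
    ∫⁻ z, g z ∂(spaceTime ρ hρ) =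
      ∫⁻ t in Icc (0 : ℝ) 1, ∫⁻ x, g (t, x) ∂(ρ t : Measure (Eu d)) :=
  Measure.lintegral_compProd hg

lemma measurable_lintegral_curve (hρ : Continuous ρ) {g : ℝ × Eu d → ℝ≥0∞} (hg : Measurable g) :
    Measurable fun t => ∫⁻ x, g (t, x) ∂(ρ t : Measure (Eu d)) :=
  hg.lintegral_kernel_prod_right' (κ := curveKernel ρ hρ)

lemma integral_spaceTime (hρ : Continuous ρ) {g : ℝ × Eu d → ℝ} (hg : Integrable g (spaceTime ρ hρ)) :
    ∫ z, g z ∂(spaceTime ρ hρ) =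
      ∫ t in Icc (0 : ℝ) 1, ∫ x, g (t, x) ∂(ρ t : Measure (Eu d)) :=
  Measure.integral_compProd hg

lemma integrable_integral_curve (hρ : Continuous ρ) {g : ℝ × Eu d → ℝ} (hg : Integrable g (spaceTime ρ hρ)) :
    Integrable (fun t => ∫ x, g (t, x) ∂(ρ t : Measure (Eu d)))
      (volume.restrict (Icc (0 : ℝ) 1)) :=
  hg.integral_compProd

lemma spaceTime_compl_eq_zero (hρ : Continuous ρ) {Ω : Set (Eu d)} (hΩ : IsCompact Ω)
    (hs : ∀ t, (ρ t : Measure (Eu d)) Ωᶜ = 0) :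
    spaceTime ρ hρ (Icc (0 : ℝ) 1 ×ˢ Ω)ᶜ = 0 := by
  have hm : MeasurableSet ((Icc (0 : ℝ) 1 ×ˢ Ω)ᶜ) :=
    (measurableSet_Icc.prod hΩ.isClosed.measurableSet).compl
  rw [spaceTime, Measure.compProd_apply hm]
  refine (setLIntegral_congr_fun measurableSet_Icc fun t ht => ?_).trans lintegral_zero
  refine measure_mono_null (fun x hx => ?_) (hs t)
  exact fun hxΩ => hx ⟨ht, hxΩ⟩

lemma integrable_spaceTime_of_continuous (hρ : Continuous ρ) {G : Type*} [NormedAddCommGroup G] [MeasurableSpace G]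
    [BorelSpace G] [SecondCountableTopology G] {Ω : Set (Eu d)} (hΩ : IsCompact Ω)
    (hs : ∀ t, (ρ t : Measure (Eu d)) Ωᶜ = 0) {g : ℝ × Eu d → G} (hg : Continuous g) :
    Integrable g (spaceTime ρ hρ) :=
  integrable_of_continuous_of_compact (isCompact_Icc.prod hΩ) (spaceTime_compl_eq_zero hρ hΩ hs) hg

/-- Continuous functions are bounded almost everywhere. -/
lemma exists_ae_bound_spaceTime (hρ : Continuous ρ) {G : Type*} [NormedAddCommGroup G] {Ω : Set (Eu d)}
    (hΩ : IsCompact Ω) (hs : ∀ t, (ρ t : Measure (Eu d)) Ωᶜ = 0) {g : ℝ × Eu d → G}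
    (hg : Continuous g) : ∃ R, ∀ᵐ z ∂(spaceTime ρ hρ), ‖g z‖ ≤ R := by
  obtain ⟨R, hR⟩ := (isCompact_Icc.prod hΩ).exists_bound_of_continuousOn
    (hg.continuousOn (s := Icc (0 : ℝ) 1 ×ˢ Ω))
  have h : ∀ᵐ z ∂(spaceTime ρ hρ), z ∈ Icc (0 : ℝ) 1 ×ˢ Ω :=
    ae_iff.2 (spaceTime_compl_eq_zero hρ hΩ hs)
  exact ⟨R, h.mono fun z hz => hR z hz⟩

/-! ### The continuity equation -/

/-- The rate of change of `∫ f t dρ t` prescribed by the continuity equation. -/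
def rate (ρ : ℝ → ProbabilityMeasure (Eu d)) (v : ℝ → Eu d → Eu d) (f : ℝ → Eu d → ℝ) (t : ℝ) : ℝ :=
  (∫ x, deriv (fun s => f s x) t ∂(ρ t : Measure (Eu d))) +
    ∫ x, inner ℝ (gradient (f t) x) (v t x) ∂(ρ t : Measure (Eu d))

variable {v : ℝ → Eu d → Eu d} {f : ℝ → Eu d → ℝ} {Ω : Set (Eu d)}

lemma integrable_deriv_fst (hρ : Continuous ρ) (hΩ : IsCompact Ω) (hs : ∀ t, (ρ t : Measure (Eu d)) Ωᶜ = 0)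
    (hf : ContDiff ℝ 1 (Function.uncurry f)) :
    Integrable (fun t => ∫ x, deriv (fun s => f s x) t ∂(ρ t : Measure (Eu d)))
      (volume.restrict (Icc (0 : ℝ) 1)) :=
  integrable_integral_curve hρ
    (integrable_spaceTime_of_continuous hρ hΩ hs (continuous_deriv_fst hf))

lemma integrable_inner_gradient (hρ : Continuous ρ) (hΩ : IsCompact Ω) (hs : ∀ t, (ρ t : Measure (Eu d)) Ωᶜ = 0)
    (hf : ContDiff ℝ 1 (Function.uncurry f)) (hv : Measurable (Function.uncurry v))
    (hvi : ∫⁻ t in Icc (0 : ℝ) 1, ∫⁻ x, ‖v t x‖ₑ ∂(ρ t : Measure (Eu d)) < ⊤) :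
    Integrable (fun z : ℝ × Eu d => inner ℝ (gradient (f z.1) z.2) (v z.1 z.2))
      (spaceTime ρ hρ) := by
  have h1 : Integrable (Function.uncurry v) (spaceTime ρ hρ) := by
    refine ⟨hv.aestronglyMeasurable, ?_⟩
    rw [hasFiniteIntegral_def, lintegral_spaceTime hρ hv.enorm]
    exact hvi
  obtain ⟨R, hR⟩ := exists_ae_bound_spaceTime hρ hΩ hs (continuous_gradient hf)
  refine (h1.norm.const_mul R).mono'
    ((continuous_gradient hf).aestronglyMeasurable.inner h1.aestronglyMeasurable) ?_
  filter_upwards [hR] with z hz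
  exact (abs_real_inner_le_norm _ _).trans (mul_le_mul_of_nonneg_right hz (norm_nonneg _))

lemma integrable_rate (hρ : Continuous ρ) (hΩ : IsCompact Ω) (hs : ∀ t, (ρ t : Measure (Eu d)) Ωᶜ = 0)
    (hf : ContDiff ℝ 1 (Function.uncurry f)) (hv : Measurable (Function.uncurry v))
    (hvi : ∫⁻ t in Icc (0 : ℝ) 1, ∫⁻ x, ‖v t x‖ₑ ∂(ρ t : Measure (Eu d)) < ⊤) :
    IntegrableOn (rate ρ v f) (Icc 0 1) :=
  (integrable_deriv_fst hρ hΩ hs hf).add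
    (integrable_integral_curve hρ (integrable_inner_gradient hρ hΩ hs hf hv hvi))

lemma integral_rate_eq (hρ : Continuous ρ) (hΩ : IsCompact Ω) (hs : ∀ t, (ρ t : Measure (Eu d)) Ωᶜ = 0)
    (hf : ContDiff ℝ 1 (Function.uncurry f)) (hv : Measurable (Function.uncurry v))
    (hvi : ∫⁻ t in Icc (0 : ℝ) 1, ∫⁻ x, ‖v t x‖ₑ ∂(ρ t : Measure (Eu d)) < ⊤) :
    ∫ t in (0 : ℝ)..1, rate ρ v f t =
      (∫ t in Icc (0 : ℝ) 1, ∫ x, deriv (fun s => f s x) t ∂(ρ t : Measure (Eu d))) +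
      (∫ t in Icc (0 : ℝ) 1, ∫ x, inner ℝ (gradient (f t) x) (v t x) ∂(ρ t : Measure (Eu d))) := by
  rw [intervalIntegral.integral_of_le zero_le_one, ← integral_Icc_eq_integral_Ioc]
  exact integral_add (integrable_deriv_fst hρ hΩ hs hf)
    (integrable_integral_curve hρ (integrable_inner_gradient hρ hΩ hs hf hv hvi))

lemma isCE_iff (hρ : Continuous ρ) (hΩ : IsCompact Ω) (hs : ∀ t, (ρ t : Measure (Eu d)) Ωᶜ = 0) :
    IsCE ρ v ↔ Measurable (Function.uncurry v) ∧
      (∀ t ∈ Icc (0 : ℝ) 1, MemLp (v t) 2 (ρ t : Measure (Eu d))) ∧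
      (∫⁻ t in Icc (0 : ℝ) 1, ∫⁻ x, ‖v t x‖ₑ ∂(ρ t : Measure (Eu d)) < ⊤) ∧
      ∀ f : ℝ → Eu d → ℝ, ContDiff ℝ 1 (Function.uncurry f) →
        ∫ t in (0 : ℝ)..1, rate ρ v f t =
          (∫ x, f 1 x ∂(ρ 1 : Measure (Eu d))) - ∫ x, f 0 x ∂(ρ 0 : Measure (Eu d)) := by
  constructor
  · intro h
    refine ⟨h.measurable, h.memLp, h.integrable, fun f hf => ?_⟩
    rw [integral_rate_eq hρ hΩ hs hf h.measurable h.integrable, h.equation f hf]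
  · rintro ⟨h1, h2, h3, h4⟩
    refine ⟨h1, h2, h3, fun f hf => ?_⟩
    rw [← integral_rate_eq hρ hΩ hs hf h1 h3, h4 f hf]

end Curves

/-! ### Localization of the continuity equation in time -/

section Localization

variable {d : ℕ} {ρ : ℝ → ProbabilityMeasure (Eu d)} {v : ℝ → Eu d → Eu d} {f : ℝ → Eu d → ℝ}
  {Ω : Set (Eu d)}

lemma gradient_const_mul {g : Eu d → ℝ} {x : Eu d} (hg : DifferentiableAt ℝ g x) (a : ℝ) :
    gradient (fun y => a * g y) x = a • gradient g x := by
  refine HasGradientAt.gradient ?_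
  rw [hasGradientAt_iff_hasFDerivAt, map_smul]
  exact hg.hasGradientAt.hasFDerivAt.const_mul a

/-- Testing with `χ(t) f(t, x)` for arbitrary `χ` makes the continuity equation a weak ordinary
differential equation for `t ↦ ∫ f t dρ t`. -/
lemma rate_mul (hΩ : IsCompact Ω) (hs : ∀ t, (ρ t : Measure (Eu d)) Ωᶜ = 0)
    (hf : ContDiff ℝ 1 (Function.uncurry f)) {χ : ℝ → ℝ} (hχ : ContDiff ℝ 1 χ) (t : ℝ) :
    rate ρ v (fun s x => χ s * f s x) t =
      deriv χ t * (∫ x, f t x ∂(ρ t : Measure (Eu d))) + χ t * rate ρ v f t := by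
  have hi : ∀ g : Eu d → ℝ, Continuous g → Integrable g (ρ t : Measure (Eu d)) :=
    fun g hg => integrable_of_continuous_of_compact hΩ (hs t) hg
  have h1 : ∀ x, deriv (fun s => χ s * f s x) t = deriv χ t * f t x + χ t * deriv (fun s => f s x) t := by
    intro x
    have hfx : ContDiff ℝ 1 fun s => f s x := hf.comp (contDiff_id.prodMk contDiff_const)
    exact deriv_fun_mul (hχ.differentiable one_ne_zero t) (hfx.differentiable one_ne_zero t)
  have h2 : ∀ x, gradient (fun y => χ t * f t y) x = χ t • gradient (f t) x := by
    intro x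
    have hfx : ContDiff ℝ 1 (f t) := hf.comp (contDiff_const.prodMk contDiff_id)
    exact gradient_const_mul (hfx.differentiable one_ne_zero x) _
  unfold rate
  simp only [h1, h2, real_inner_smul_left]
  rw [integral_add, integral_const_mul, integral_const_mul, integral_const_mul]
  · ring
  · exact (hi _ (hf.continuous.comp (Continuous.prodMk_right t))).const_mul _
  · exact (hi _ ((continuous_deriv_fst hf).comp (Continuous.prodMk_right t))).const_mul _

lemma eqOn_const_of_integral_sq_eq_zero {k : ℝ → ℝ} (hk : Continuous k)
    (h : ∫ t in (0 : ℝ)..1, k t * k t = 0) : ∀ t ∈ Icc (0 : ℝ) 1, k t = 0 := by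
  intro t ht
  by_contra hne
  refine (intervalIntegral.integral_pos (f := fun t => k t * k t) zero_lt_one
    (hk.mul hk).continuousOn (fun x _ => mul_self_nonneg _) ⟨t, ht, ?_⟩).ne' h
  exact mul_self_pos.2 hne

/-- The fundamental lemma of the calculus of variations, for an equation `g' = h`. -/
lemma integral_eq_sub_of_weak {g h : ℝ → ℝ} (hg : Continuous g) (hh : IntegrableOn h (Icc 0 1))
    (hw : ∀ χ : ℝ → ℝ, ContDiff ℝ 1 χ →
      ∫ t in (0 : ℝ)..1, (deriv χ t * g t + χ t * h t) = χ 1 * g 1 - χ 0 * g 0)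
    {s t : ℝ} (hs : s ∈ Icc (0 : ℝ) 1) (ht : t ∈ Icc (0 : ℝ) 1) :
    ∫ r in s..t, h r = g t - g s := by
  set h' : ℝ → ℝ := (Icc (0 : ℝ) 1).indicator h
  have hh' : Integrable h' := (integrable_indicator_iff measurableSet_Icc).2 hh
  have heq : ∀ r ∈ Icc (0 : ℝ) 1, h' r = h r := fun r hr => indicator_of_mem hr h
  set H : ℝ → ℝ := fun r => ∫ u in (0 : ℝ)..r, h' u
  have hHc : Continuous H := intervalIntegral.continuous_primitive
    (fun a b => hh'.intervalIntegrable) 0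
  set G : ℝ → ℝ := fun r => g r - H r
  have hGc : Continuous G := hg.sub hHc
  -- The test function is the primitive `χ` of `k`. Integrating `χ * h` by parts turns the weak
  -- equation into `∫ k * G = χ 1 * G 1 = ∫ k * G 1`, that is `∫ k² = 0`; hence `G = g - H` is
  -- constant on `[0,1]`.
  set k : ℝ → ℝ := fun r => G r - G 1
  have hkc : Continuous k := hGc.sub continuous_const
  set χ : ℝ → ℝ := fun r => ∫ u in (0 : ℝ)..r, k u
  have hχd : ∀ r, HasDerivAt χ (k r) r := fun r =>
    intervalIntegral.integral_hasDerivAt_right (hkc.intervalIntegrable _ _)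
      hkc.stronglyMeasurable.stronglyMeasurableAtFilter hkc.continuousAt
  have hχ' : deriv χ = k := funext fun r => (hχd r).deriv
  have hχ : ContDiff ℝ 1 χ := by
    rw [contDiff_one_iff_deriv]
    exact ⟨fun r => (hχd r).differentiableAt, hχ' ▸ hkc⟩
  have hH0 : H 0 = 0 := intervalIntegral.integral_same
  have hχ0 : χ 0 = 0 := intervalIntegral.integral_same
  have hHac : AbsolutelyContinuousOnInterval H 0 1 :=
    (hh'.intervalIntegrable (a := 0) (b := 1)).absolutelyContinuousOnInterval_intervalIntegral
      (by simp)
  have hibp := AbsolutelyContinuousOnInterval.integral_mul_deriv_eq_deriv_mul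
    (hχ.contDiffOn.absolutelyContinuousOnInterval (a := 0) (b := 1)) hHac
  have hHd : ∫ r in (0 : ℝ)..1, χ r * deriv H r = ∫ r in (0 : ℝ)..1, χ r * h r := by
    refine intervalIntegral.integral_congr_ae ?_
    filter_upwards [(hh'.intervalIntegrable (a := 0) (b := 1)).ae_hasDerivAt_integral] with r hr hr1
    have hr2 : r ∈ uIcc (0 : ℝ) 1 := uIoc_subset_uIcc hr1
    rw [(hr hr2 0 (by simp)).deriv, heq r (by rwa [uIcc_of_le zero_le_one] at hr2)]
  have hi1 : IntervalIntegrable (fun r => χ r * h r) volume 0 1 :=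
    ((intervalIntegrable_iff_integrableOn_Icc_of_le zero_le_one).2 hh).continuousOn_mul
      hχ.continuous.continuousOn
  have hw' := hw χ hχ
  rw [hχ', intervalIntegral.integral_add (f := fun r => k r * g r)
    (g := fun r => χ r * h r) ((hkc.mul hg).intervalIntegrable _ _) hi1, ← hHd, hibp,
    hχ', hχ0, hH0] at hw'
  have hk2 : ∫ r in (0 : ℝ)..1, k r * k r = 0 := by
    have e1 : ∀ r, k r * k r = k r * g r - k r * H r - k r * G 1 := fun r => by
      simp only [k, G]; ring
    simp only [e1]
    rw [intervalIntegral.integral_sub, intervalIntegral.integral_sub,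
      intervalIntegral.integral_mul_const]
    · change _ - _ - χ 1 * G 1 = 0
      simp only [G]
      linarith
    · exact (hkc.mul hg).intervalIntegrable _ _
    · exact (hkc.mul hHc).intervalIntegrable _ _
    · exact ((hkc.mul hg).sub (hkc.mul hHc)).intervalIntegrable _ _
    · exact (hkc.mul continuous_const).intervalIntegrable _ _
  have hconst := eqOn_const_of_integral_sq_eq_zero hkc hk2
  have hst : H t - H s = ∫ r in s..t, h' r :=
    intervalIntegral.integral_interval_sub_left hh'.intervalIntegrable hh'.intervalIntegrable
  have hst' : ∫ r in s..t, h' r = ∫ r in s..t, h r :=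
    intervalIntegral.integral_congr fun r hr => heq r (uIcc_subset_Icc hs ht hr)
  have h1 := hconst t ht
  have h2 := hconst s hs
  simp only [k, G] at h1 h2
  rw [← hst', ← hst]
  linarith

/-- The continuity equation holds on all subintervals. -/
lemma IsCE.integral_rate (hρ : Continuous ρ) (hΩ : IsCompact Ω)
    (hsp : ∀ t, (ρ t : Measure (Eu d)) Ωᶜ = 0) (h : IsCE ρ v)
    (hf : ContDiff ℝ 1 (Function.uncurry f)) {s t : ℝ}
    (hs : s ∈ Icc (0 : ℝ) 1) (ht : t ∈ Icc (0 : ℝ) 1) :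
    ∫ r in s..t, rate ρ v f r =
      (∫ x, f t x ∂(ρ t : Measure (Eu d))) - ∫ x, f s x ∂(ρ s : Measure (Eu d)) := by
  refine integral_eq_sub_of_weak (g := fun r => ∫ x, f r x ∂(ρ r : Measure (Eu d)))
    (continuous_integral_of_continuous hΩ hρ hsp hf.continuous)
    (integrable_rate hρ hΩ hsp hf h.measurable h.integrable) (fun χ hχ => ?_) hs ht
  have hχf : ContDiff ℝ 1 (Function.uncurry fun s x => χ s * f s x) :=
    (hχ.comp contDiff_fst).mul hf
  have h1 := ((isCE_iff hρ hΩ hsp).1 h).2.2.2 _ hχf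
  simp only [rate_mul hΩ hsp hf hχ, integral_const_mul] at h1
  exact h1

end Localization

/-! ### Affine changes of time -/

section Rescale

variable {d : ℕ} {ρ ρ' : ℝ → ProbabilityMeasure (Eu d)} {v v' : ℝ → Eu d → Eu d}
  {f : ℝ → Eu d → ℝ} {Ω : Set (Eu d)}

/-- The action `∫ ‖v t‖²_{L²(ρ t)} dt` over a set of times. -/
def kinetic (ρ : ℝ → ProbabilityMeasure (Eu d)) (v : ℝ → Eu d → Eu d) (s : Set ℝ) : ℝ≥0∞ :=
  ∫⁻ t in s, ∫⁻ x, ‖v t x‖ₑ ^ 2 ∂(ρ t : Measure (Eu d))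

/-- The chain rule; the test function for the original curve undoes the change of time. -/
lemma rate_rescale {c l t : ℝ} (hl : l ≠ 0) (hf : ContDiff ℝ 1 (Function.uncurry f))
    (hρt : ρ' t = ρ (c + l * t)) (hvt : v' t = l • v (c + l * t)) :
    rate ρ' v' f t = l * rate ρ v (fun r => f ((r - c) / l)) (c + l * t) := by
  have h0 : (c + l * t - c) / l = t := by field_simp; ring
  have h1 : ∀ x, deriv (fun r => f ((r - c) / l) x) (c + l * t) = l⁻¹ * deriv (fun s => f s x) t := by
    intro x
    have hfx : ContDiff ℝ 1 fun s => f s x := hf.comp (contDiff_id.prodMk contDiff_const)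
    have h2 : HasDerivAt (fun r : ℝ => (r - c) / l) (l⁻¹) (c + l * t) := by
      simpa using ((hasDerivAt_id (c + l * t)).sub_const c).div_const l
    have h3 : HasDerivAt (fun s => f s x) (deriv (fun s => f s x) t) ((c + l * t - c) / l) := by
      rw [h0]
      exact (hfx.differentiable one_ne_zero t).hasDerivAt
    exact (h3.comp (c + l * t) h2).deriv.trans (mul_comm _ _)
  unfold rate
  simp only [h1, hρt, hvt, h0, Pi.smul_apply, real_inner_smul_right]
  rw [integral_const_mul, integral_const_mul]
  field_simp

lemma contDiff_uncurry_rescale (hf : ContDiff ℝ 1 (Function.uncurry f)) (c l : ℝ) :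
    ContDiff ℝ 1 (Function.uncurry fun r => f ((r - c) / l)) := by
  have : ContDiff ℝ 1 fun z : ℝ × Eu d => ((z.1 - c) / l, z.2) := by fun_prop
  exact hf.comp this

lemma lintegral_affine {c l : ℝ} (hl : l ≠ 0) {s : Set ℝ} (hs : MeasurableSet s) (F : ℝ → ℝ≥0∞) :
    ENNReal.ofReal |l| * ∫⁻ t in s, F (c + l * t) = ∫⁻ t in (fun t => c + l * t) '' s, F t := by
  rw [lintegral_image_eq_lintegral_abs_deriv_mul hs (f' := fun _ => l)
    (fun t _ => by
      simpa using (((hasDerivAt_id t).const_mul l).const_add c).hasDerivWithinAt)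
    (fun t _ t' _ h => mul_left_cancel₀ hl (add_left_cancel h)),
    lintegral_const_mul' _ _ ENNReal.ofReal_ne_top]

/-- The squared speed contributes `l²` and the substitution removes one factor `|l|`. The remaining
factor is what an optimal choice of time balances. -/
lemma kinetic_rescale {c l : ℝ} (hl : l ≠ 0) {s : Set ℝ} (hs : MeasurableSet s)
    (hρt : ∀ t ∈ s, ρ' t = ρ (c + l * t)) (hvt : ∀ t ∈ s, v' t = l • v (c + l * t)) :
    kinetic ρ' v' s = ENNReal.ofReal |l| * kinetic ρ v ((fun t => c + l * t) '' s) := by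
  unfold kinetic
  rw [← lintegral_affine hl hs, ← mul_assoc, ← lintegral_const_mul' _ _
    (ENNReal.mul_ne_top ENNReal.ofReal_ne_top ENNReal.ofReal_ne_top)]
  refine setLIntegral_congr_fun hs fun t ht => ?_
  simp only [hρt t ht, hvt t ht, Pi.smul_apply, enorm_smul, mul_pow]
  rw [lintegral_const_mul' _ _ (by simp), Real.enorm_eq_ofReal_abs, sq]

lemma lintegral_enorm_rescale {c l : ℝ} (hl : l ≠ 0) {s : Set ℝ} (hs : MeasurableSet s)
    (hρt : ∀ t ∈ s, ρ' t = ρ (c + l * t)) (hvt : ∀ t ∈ s, v' t = l • v (c + l * t)) :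
    ∫⁻ t in s, ∫⁻ x, ‖v' t x‖ₑ ∂(ρ' t : Measure (Eu d)) =
      ∫⁻ t in (fun t => c + l * t) '' s, ∫⁻ x, ‖v t x‖ₑ ∂(ρ t : Measure (Eu d)) := by
  rw [← lintegral_affine hl hs, ← lintegral_const_mul' _ _ ENNReal.ofReal_ne_top]
  refine setLIntegral_congr_fun hs fun t ht => ?_
  simp only [hρt t ht, hvt t ht, Pi.smul_apply, enorm_smul]
  rw [lintegral_const_mul' _ _ (by simp), Real.enorm_eq_ofReal_abs]

lemma integral_rate_rescale {c l a b : ℝ} (hl : l ≠ 0) (hf : ContDiff ℝ 1 (Function.uncurry f))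
    (hρt : ∀ᵐ t, t ∈ uIoc a b → ρ' t = ρ (c + l * t))
    (hvt : ∀ᵐ t, t ∈ uIoc a b → v' t = l • v (c + l * t)) :
    ∫ t in a..b, rate ρ' v' f t =
      ∫ t in (c + l * a)..(c + l * b), rate ρ v (fun r => f ((r - c) / l)) t := by
  rw [← intervalIntegral.mul_integral_comp_add_mul, ← intervalIntegral.integral_const_mul]
  refine intervalIntegral.integral_congr_ae ?_
  filter_upwards [hρt, hvt] with t h1 h2 ht
  exact rate_rescale hl hf (h1 ht) (h2 ht)

/-- Restriction of a solution to a subinterval, with a change of time to `[0,1]`, which may reverse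
the direction. -/
lemma IsCE.rescale (hρ : Continuous ρ) (hΩ : IsCompact Ω)
    (hsp : ∀ t, (ρ t : Measure (Eu d)) Ωᶜ = 0) (h : IsCE ρ v) {c l : ℝ} (hl : l ≠ 0)
    (hcl : ∀ t ∈ Icc (0 : ℝ) 1, c + l * t ∈ Icc (0 : ℝ) 1) :
    IsCE (fun t => ρ (c + l * t)) (fun t => l • v (c + l * t)) := by
  have hc : Continuous fun t : ℝ => ρ (c + l * t) := hρ.comp (by fun_prop)
  refine (isCE_iff hc hΩ fun t => hsp _).2 ⟨?_, fun t ht => ?_, ?_, fun f hf => ?_⟩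
  · have : Measurable fun z : ℝ × Eu d => (c + l * z.1, z.2) := by fun_prop
    exact (h.measurable.comp this).const_smul l
  · exact (h.memLp _ (hcl t ht)).const_smul l
  · have := lintegral_enorm_rescale (ρ := ρ) (v := v) (c := c)
      (ρ' := fun t => ρ (c + l * t)) (v' := fun t => l • v (c + l * t)) hl measurableSet_Icc
      (fun t (_ : t ∈ Icc (0 : ℝ) 1) => rfl) (fun t _ => rfl)
    refine this.trans_lt (lt_of_le_of_lt (lintegral_mono_set ?_) h.integrable)
    rintro _ ⟨t, ht, rfl⟩
    exact hcl t ht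
  · have h0 := hcl 0 ⟨le_rfl, zero_le_one⟩
    have h1 := hcl 1 ⟨zero_le_one, le_rfl⟩
    have h2 := integral_rate_rescale (ρ' := fun t => ρ (c + l * t)) (ρ := ρ)
      (v' := fun t => l • v (c + l * t)) (v := v) (a := 0) (b := 1) hl hf
      (ae_of_all _ fun t _ => rfl) (ae_of_all _ fun t _ => rfl)
    rw [h2, h.integral_rate hρ hΩ hsp (contDiff_uncurry_rescale hf c l) h0 h1]
    have e1 : (c + l * 1 - c) / l = 1 := by field_simp; ring
    have e0 : (c + l * 0 - c) / l = 0 := by simp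
    simp only [e1, e0]

variable {ρ₁ ρ₂ : ℝ → ProbabilityMeasure (Eu d)} {v₁ v₂ : ℝ → Eu d → Eu d}

/-- The concatenation of two functions on `[0,1]`, at the time `a`. -/
def concat {α : Type*} (a : ℝ) (p q : ℝ → α) (t : ℝ) : α :=
  -- The summand `0` gives both branches the form `c + l * t` of the rescaling lemmas.
  if t ≤ a then p (0 + a⁻¹ * t) else q (-a / (1 - a) + (1 - a)⁻¹ * t)

lemma concat_of_le {α : Type*} {a t : ℝ} (p q : ℝ → α) (h : t ≤ a) :
    concat a p q t = p (0 + a⁻¹ * t) := if_pos h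

lemma concat_of_lt {α : Type*} {a t : ℝ} (p q : ℝ → α) (h : a < t) :
    concat a p q t = q (-a / (1 - a) + (1 - a)⁻¹ * t) := if_neg (not_le.2 h)

lemma concat_zero {α : Type*} {a : ℝ} (ha : a ∈ Ioo (0 : ℝ) 1) (p q : ℝ → α) :
    concat a p q 0 = p 0 := by
  rw [concat_of_le p q ha.1.le, mul_zero, add_zero]

lemma concat_one {α : Type*} {a : ℝ} (ha : a ∈ Ioo (0 : ℝ) 1) (p q : ℝ → α) :
    concat a p q 1 = q 1 := by
  have : 1 - a ≠ 0 := (sub_pos.2 ha.2).ne'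
  rw [concat_of_lt p q ha.2]
  congr 1
  field_simp
  ring

lemma continuous_concat {α : Type*} [TopologicalSpace α] {a : ℝ} (ha : a ∈ Ioo (0 : ℝ) 1)
    {p q : ℝ → α} (hp : Continuous p) (hq : Continuous q) (hpq : p 1 = q 0) :
    Continuous (concat a p q) := by
  have h1 : 1 - a ≠ 0 := (sub_pos.2 ha.2).ne'
  refine Continuous.if_le (hp.comp (by fun_prop)) (hq.comp (by fun_prop)) continuous_id
    continuous_const fun t ht => ?_
  have ht : t = a := ht
  have e1 : 0 + a⁻¹ * t = 1 := by rw [ht, zero_add, inv_mul_cancel₀ ha.1.ne']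
  have e2 : -a / (1 - a) + (1 - a)⁻¹ * t = 0 := by rw [ht]; field_simp; ring
  rw [e1, e2, hpq]

/-- Concatenation of velocity fields, with the speed adapted to the change of time. -/
def concatField (a : ℝ) (v₁ v₂ : ℝ → Eu d → Eu d) : ℝ → Eu d → Eu d :=
  concat a (fun t => a⁻¹ • v₁ t) (fun t => (1 - a)⁻¹ • v₂ t)

lemma measurable_concatField {a : ℝ} (h₁ : Measurable (Function.uncurry v₁))
    (h₂ : Measurable (Function.uncurry v₂)) :
    Measurable (Function.uncurry (concatField a v₁ v₂)) := by
  have e : Function.uncurry (concatField a v₁ v₂) = fun z : ℝ × Eu d =>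
      if z.1 ≤ a then a⁻¹ • Function.uncurry v₁ (0 + a⁻¹ * z.1, z.2)
      else (1 - a)⁻¹ • Function.uncurry v₂ (-a / (1 - a) + (1 - a)⁻¹ * z.1, z.2) := by
    funext z
    simp only [Function.uncurry, concatField, concat]
    split_ifs <;> rfl
  rw [e]
  refine Measurable.ite (measurableSet_le measurable_fst measurable_const) ?_ ?_
  · have h : Measurable fun z : ℝ × Eu d => Function.uncurry v₁ (0 + a⁻¹ * z.1, z.2) :=
      h₁.comp (by fun_prop)
    exact Measurable.const_smul h a⁻¹
  · have h : Measurable fun z : ℝ × Eu d =>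
        Function.uncurry v₂ (-a / (1 - a) + (1 - a)⁻¹ * z.1, z.2) := h₂.comp (by fun_prop)
    exact Measurable.const_smul h (1 - a)⁻¹

lemma image_affine_fst {a : ℝ} (ha : a ∈ Ioo (0 : ℝ) 1) :
    (fun t => 0 + a⁻¹ * t) '' Icc 0 a ⊆ Icc (0 : ℝ) 1 := by
  rintro _ ⟨t, ht, rfl⟩
  have := ha.1
  simp only [zero_add]
  exact ⟨mul_nonneg (inv_nonneg.2 ha.1.le) ht.1, by rw [inv_mul_le_iff₀ ha.1]; linarith [ht.2]⟩

lemma image_affine_snd {a : ℝ} (ha : a ∈ Ioo (0 : ℝ) 1) :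
    (fun t => -a / (1 - a) + (1 - a)⁻¹ * t) '' Ioc a 1 ⊆ Icc (0 : ℝ) 1 := by
  rintro _ ⟨t, ht, rfl⟩
  have h1 : 0 < 1 - a := sub_pos.2 ha.2
  have e : -a / (1 - a) + (1 - a)⁻¹ * t = (t - a) / (1 - a) := by field_simp; ring
  simp only [e]
  exact ⟨div_nonneg (sub_nonneg.2 ht.1.le) h1.le, by rw [div_le_one h1]; linarith [ht.2]⟩

lemma lintegral_concat_le {a : ℝ} (ha : a ∈ Ioo (0 : ℝ) 1) (F : ℝ → ℝ≥0∞) :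
    ∫⁻ t in Icc (0 : ℝ) 1, F t ≤ (∫⁻ t in Icc 0 a, F t) + ∫⁻ t in Ioc a 1, F t := by
  rw [← Icc_union_Ioc_eq_Icc ha.1.le ha.2.le]
  exact lintegral_union_le _ _ _

lemma kinetic_concat_le {a : ℝ} (ha : a ∈ Ioo (0 : ℝ) 1) :
    kinetic (concat a ρ₁ ρ₂) (concatField a v₁ v₂) (Icc 0 1) ≤
      ENNReal.ofReal a⁻¹ * kinetic ρ₁ v₁ (Icc 0 1) +
        ENNReal.ofReal (1 - a)⁻¹ * kinetic ρ₂ v₂ (Icc 0 1) := by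
  have h1 : 0 < 1 - a := sub_pos.2 ha.2
  have e1 : kinetic (concat a ρ₁ ρ₂) (concatField a v₁ v₂) (Icc 0 a) = _ :=
    kinetic_rescale (ρ := ρ₁) (v := v₁) (ρ' := WSub.concat a ρ₁ ρ₂)
        (v' := concatField a v₁ v₂) (inv_ne_zero ha.1.ne') measurableSet_Icc
      (fun t ht => concat_of_le _ _ ht.2) (fun t ht => concat_of_le _ _ ht.2)
  have e2 : kinetic (concat a ρ₁ ρ₂) (concatField a v₁ v₂) (Ioc a 1) = _ :=
    kinetic_rescale (ρ := ρ₂) (v := v₂) (ρ' := WSub.concat a ρ₁ ρ₂)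
        (v' := concatField a v₁ v₂) (inv_ne_zero h1.ne') measurableSet_Ioc
      (fun t ht => concat_of_lt _ _ ht.1) (fun t ht => concat_of_lt _ _ ht.1)
  rw [abs_of_pos (inv_pos.2 ha.1)] at e1
  rw [abs_of_pos (inv_pos.2 h1)] at e2
  refine (lintegral_concat_le ha _).trans ?_
  refine (add_le_add e1.le e2.le).trans (add_le_add ?_ ?_)
  · gcongr
    exact lintegral_mono_set (image_affine_fst ha)
  · gcongr
    exact lintegral_mono_set (image_affine_snd ha)

/-- The integrated rate splits at time `a`; each piece is a rescaled solution and yields its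
boundary terms, and those at time `a` cancel because the curves match there. -/
lemma IsCE.concat (hρ₁ : Continuous ρ₁) (hρ₂ : Continuous ρ₂) (hΩ : IsCompact Ω)
    (hs₁ : ∀ t, (ρ₁ t : Measure (Eu d)) Ωᶜ = 0) (hs₂ : ∀ t, (ρ₂ t : Measure (Eu d)) Ωᶜ = 0)
    (h₁₂ : ρ₁ 1 = ρ₂ 0) (h₁ : IsCE ρ₁ v₁) (h₂ : IsCE ρ₂ v₂) {a : ℝ} (ha : a ∈ Ioo (0 : ℝ) 1) :
    IsCE (concat a ρ₁ ρ₂) (concatField a v₁ v₂) := by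
  have hc := continuous_concat ha hρ₁ hρ₂ h₁₂
  have h1 : 0 < 1 - a := sub_pos.2 ha.2
  have hs : ∀ t, ((WSub.concat a ρ₁ ρ₂ t : ProbabilityMeasure (Eu d)) : Measure (Eu d)) Ωᶜ = 0 := fun t => by
    unfold WSub.concat
    split_ifs
    exacts [hs₁ _, hs₂ _]
  have hmeas : Measurable (Function.uncurry (concatField a v₁ v₂)) :=
    measurable_concatField h₁.measurable h₂.measurable
  have hint : ∫⁻ t in Icc (0 : ℝ) 1, ∫⁻ x, ‖concatField a v₁ v₂ t x‖ₑ
      ∂((WSub.concat a ρ₁ ρ₂ t : ProbabilityMeasure (Eu d)) : Measure (Eu d)) < ⊤ := by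
    refine (lintegral_concat_le ha _).trans_lt (ENNReal.add_lt_top.2 ⟨?_, ?_⟩)
    · rw [lintegral_enorm_rescale (ρ := ρ₁) (v := v₁) (ρ' := WSub.concat a ρ₁ ρ₂)
        (v' := concatField a v₁ v₂) (inv_ne_zero ha.1.ne') measurableSet_Icc
        (fun t ht => concat_of_le _ _ ht.2) (fun t ht => concat_of_le _ _ ht.2)]
      exact (lintegral_mono_set (image_affine_fst ha)).trans_lt h₁.integrable
    · rw [lintegral_enorm_rescale (ρ := ρ₂) (v := v₂) (ρ' := WSub.concat a ρ₁ ρ₂)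
        (v' := concatField a v₁ v₂) (inv_ne_zero h1.ne') measurableSet_Ioc
        (fun t ht => concat_of_lt _ _ ht.1) (fun t ht => concat_of_lt _ _ ht.1)]
      exact (lintegral_mono_set (image_affine_snd ha)).trans_lt h₂.integrable
  refine (isCE_iff hc hΩ hs).2 ⟨hmeas, fun t ht => ?_, hint, fun f hf => ?_⟩
  · rcases le_or_gt t a with hta | hta
    · rw [concat_of_le _ _ hta, concatField, concat_of_le _ _ hta]
      exact (h₁.memLp _ (image_affine_fst ha ⟨t, ⟨ht.1, hta⟩, rfl⟩)).const_smul _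
    · rw [concat_of_lt _ _ hta, concatField, concat_of_lt _ _ hta]
      exact (h₂.memLp _ (image_affine_snd ha ⟨t, ⟨hta, ht.2⟩, rfl⟩)).const_smul _
  · have hri := integrable_rate hc hΩ hs hf hmeas hint
    have hii : ∀ {b c : ℝ}, b ∈ Icc (0 : ℝ) 1 → c ∈ Icc (0 : ℝ) 1 → IntervalIntegrable
        (rate (WSub.concat a ρ₁ ρ₂) (concatField a v₁ v₂) f) volume b c := fun hb hc =>
      (hri.mono_set (uIcc_subset_Icc hb hc)).intervalIntegrable
    have haI : a ∈ Icc (0 : ℝ) 1 := ⟨ha.1.le, ha.2.le⟩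
    have h0I : (0 : ℝ) ∈ Icc (0 : ℝ) 1 := ⟨le_rfl, zero_le_one⟩
    have h1I : (1 : ℝ) ∈ Icc (0 : ℝ) 1 := ⟨zero_le_one, le_rfl⟩
    rw [← intervalIntegral.integral_add_adjacent_intervals (hii h0I haI) (hii haI h1I)]
    rw [integral_rate_rescale (ρ := ρ₁) (v := v₁) (ρ' := WSub.concat a ρ₁ ρ₂)
        (v' := concatField a v₁ v₂) (inv_ne_zero ha.1.ne') hf
      (ae_of_all _ fun t ht => concat_of_le _ _ (by rw [uIoc_of_le ha.1.le] at ht; exact ht.2))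
      (ae_of_all _ fun t ht => concat_of_le _ _ (by rw [uIoc_of_le ha.1.le] at ht; exact ht.2)),
      integral_rate_rescale (ρ := ρ₂) (v := v₂) (ρ' := WSub.concat a ρ₁ ρ₂)
        (v' := concatField a v₁ v₂) (inv_ne_zero h1.ne') hf
      (ae_of_all _ fun t ht => concat_of_lt _ _ (by rw [uIoc_of_le ha.2.le] at ht; exact ht.1))
      (ae_of_all _ fun t ht => concat_of_lt _ _ (by rw [uIoc_of_le ha.2.le] at ht; exact ht.1))]
    have e1 : 0 + a⁻¹ * 0 = 0 := by ring
    have e2 : 0 + a⁻¹ * a = 1 := by rw [zero_add, inv_mul_cancel₀ ha.1.ne']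
    have e3 : -a / (1 - a) + (1 - a)⁻¹ * a = 0 := by field_simp; ring
    have e4 : -a / (1 - a) + (1 - a)⁻¹ * 1 = 1 := by field_simp; ring
    rw [e1, e2, e3, e4, h₁.integral_rate hρ₁ hΩ hs₁ (contDiff_uncurry_rescale hf _ _) h0I h1I,
      h₂.integral_rate hρ₂ hΩ hs₂ (contDiff_uncurry_rescale hf _ _) h0I h1I,
      concat_zero ha, concat_one ha, h₁₂]
    have e5 : (1 - 0) / a⁻¹ = a := by simp
    have e6 : (0 - -a / (1 - a)) / (1 - a)⁻¹ = a := by field_simp; ring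
    have e7 : (1 - -a / (1 - a)) / (1 - a)⁻¹ = 1 := by field_simp; ring
    have e8 : (0 - 0) / a⁻¹ = 0 := by simp
    simp only [e5, e6, e7, e8]
    ring

end Rescale

/-! ### Curves in a space of parameters -/

section Speed

variable {d : ℕ}

lemma sq_lintegral_mul_le {α : Type*} [MeasurableSpace α] {μ : Measure α} {f g : α → ℝ≥0∞}
    (hf : AEMeasurable f μ) (hg : AEMeasurable g μ) :
    (∫⁻ z, f z * g z ∂μ) ^ 2 ≤ (∫⁻ z, f z ^ 2 ∂μ) * ∫⁻ z, g z ^ 2 ∂μ := by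
  have h := ENNReal.lintegral_mul_le_Lp_mul_Lq μ Real.HolderConjugate.two_two hf hg
  have h2 : ∀ a : ℝ≥0∞, (a ^ (1 / 2 : ℝ)) ^ 2 = a := fun a => by
    rw [← ENNReal.rpow_natCast, ← ENNReal.rpow_mul]
    norm_num
  refine (pow_le_pow_left' h 2).trans ?_
  simp only [mul_pow, h2, ENNReal.rpow_ofNat]
  rfl

lemma sq_lintegral_le {α : Type*} [MeasurableSpace α] {μ : Measure α} {f : α → ℝ≥0∞}
    (hf : AEMeasurable f μ) : (∫⁻ z, f z ∂μ) ^ 2 ≤ μ univ * ∫⁻ z, f z ^ 2 ∂μ := by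
  simpa using sq_lintegral_mul_le (aemeasurable_const (b := (1 : ℝ≥0∞))) hf

variable {X : Type*} [MetricSpace X]

/-- A continuous family `F` of probability measures on a compact set `Ω` such that nearby
parameters are separated by functions with bounded gradients. -/
structure IsSeparatedFamily (Ω : Set (Eu d)) (F : X → ProbabilityMeasure (Eu d)) (C₀ : ℝ≥0)
    (δ₀ : ℝ) : Prop where
  compact : IsCompact Ω
  continuous : Continuous F
  supported : ∀ x, (F x : Measure (Eu d)) Ωᶜ = 0
  pos : 0 < δ₀
  separating : ∀ x y, dist x y ≤ δ₀ → ∃ ψ : Eu d → ℝ, ContDiff ℝ 1 ψ ∧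
    (∀ z, ‖gradient ψ z‖ ≤ C₀) ∧
    dist x y ≤ (∫ z, ψ z ∂(F y : Measure (Eu d))) - ∫ z, ψ z ∂(F x : Measure (Eu d))

variable {Ω : Set (Eu d)} {F : X → ProbabilityMeasure (Eu d)} {C₀ : ℝ≥0} {δ₀ : ℝ}
  {γ : ℝ → X} {v : ℝ → Eu d → Eu d}

/-- The separating function, constant in time, is a test function on `[s, t]`. Its increment
dominates the distance and equals the integral of `⟨∇ψ, v⟩`, with `∇ψ` bounded by `C₀`. -/
lemma IsSeparatedFamily.edist_le_of_dist_le (hF : IsSeparatedFamily Ω F C₀ δ₀) (hγ : Continuous γ)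
    (hv : IsCE (fun t => F (γ t)) v) {s t : ℝ} (hs : s ∈ Icc (0 : ℝ) 1) (ht : t ∈ Icc (0 : ℝ) 1)
    (hst : s ≤ t) (hd : dist (γ s) (γ t) ≤ δ₀) :
    edist (γ s) (γ t) ≤ C₀ * ∫⁻ r in Ioc s t, ∫⁻ x, ‖v r x‖ₑ ∂(F (γ r) : Measure (Eu d)) := by
  obtain ⟨ψ, hψ, hC, hle⟩ := hF.separating _ _ hd
  have hψ' : ContDiff ℝ 1 (Function.uncurry fun (_ : ℝ) => ψ) := hψ.comp contDiff_snd
  have hρ : Continuous fun t => F (γ t) := hF.continuous.comp hγ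
  have h1 := hv.integral_rate hρ hF.compact (fun t => hF.supported _) hψ' hs ht
  rw [← h1] at hle
  have hrate : ∀ r, ‖rate (fun t => F (γ t)) v (fun _ => ψ) r‖ₑ ≤
      C₀ * ∫⁻ x, ‖v r x‖ₑ ∂(F (γ r) : Measure (Eu d)) := by
    intro r
    simp only [rate, deriv_const, integral_zero, zero_add]
    refine (enorm_integral_le_lintegral_enorm _).trans ?_
    rw [← lintegral_const_mul' _ _ ENNReal.coe_ne_top]
    refine lintegral_mono fun x => ?_
    have hC' : ‖gradient ψ x‖₊ ≤ C₀ := hC x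
    have h2 : ‖inner ℝ (gradient ψ x) (v r x)‖₊ ≤ C₀ * ‖v r x‖₊ :=
      (nnnorm_inner_le_nnnorm (𝕜 := ℝ) _ _).trans (by gcongr)
    rw [enorm_eq_nnnorm, enorm_eq_nnnorm, ← ENNReal.coe_mul]
    exact ENNReal.coe_le_coe.2 h2
  rw [edist_dist]
  refine (ENNReal.ofReal_le_ofReal hle).trans ?_
  rw [intervalIntegral.integral_of_le hst, ← lintegral_const_mul' _ _ ENNReal.coe_ne_top]
  refine (Real.ofReal_le_enorm _).trans ((enorm_integral_le_lintegral_enorm _).trans ?_)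
  exact lintegral_mono hrate

/-- The speed of a curve is controlled by the velocity field in `L¹`. -/
lemma IsSeparatedFamily.edist_le (hF : IsSeparatedFamily Ω F C₀ δ₀) (hγ : Continuous γ)
    (hv : IsCE (fun t => F (γ t)) v) {s t : ℝ} (hs : s ∈ Icc (0 : ℝ) 1) (ht : t ∈ Icc (0 : ℝ) 1)
    (hst : s ≤ t) :
    edist (γ s) (γ t) ≤ C₀ * ∫⁻ r in Ioc s t, ∫⁻ x, ‖v r x‖ₑ ∂(F (γ r) : Measure (Eu d)) := by
  have huc := isCompact_Icc.uniformContinuousOn_of_continuous (hγ.continuousOn (s := Icc (0 : ℝ) 1))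
  obtain ⟨η, hη, hηd⟩ := Metric.uniformContinuousOn_iff.1 huc δ₀ hF.pos
  -- Induction on the number of time steps of length `η / 2`: each moves the curve by less than
  -- `δ₀`, so the local estimate applies, and the integrals add up.
  have key : ∀ n : ℕ, ∀ t ∈ Icc (0 : ℝ) 1, s ≤ t → t - s ≤ n * (η / 2) →
      edist (γ s) (γ t) ≤ C₀ * ∫⁻ r in Ioc s t, ∫⁻ x, ‖v r x‖ₑ ∂(F (γ r) : Measure (Eu d)) := by
    intro n
    induction n with
    | zero =>
      intro t _ hst h
      have : s = t := le_antisymm hst (by simpa using h)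
      simp [this]
    | succ n ih =>
      intro t ht hst h
      set u := max s (t - η / 2)
      have hsu : s ≤ u := le_max_left _ _
      have hut : u ≤ t := max_le hst (by linarith)
      have hu : u ∈ Icc (0 : ℝ) 1 := ⟨hs.1.trans hsu, hut.trans ht.2⟩
      have hdist : dist u t < η := by
        rw [dist_comm, Real.dist_eq, abs_of_nonneg (sub_nonneg.2 hut)]
        linarith [le_max_right s (t - η / 2)]
      have hun : u - s ≤ n * (η / 2) := by
        push_cast at h
        rw [sub_le_iff_le_add]
        refine max_le ?_ (by linarith)
        have : 0 ≤ (n : ℝ) * (η / 2) := by positivity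
        linarith
      refine (edist_triangle _ (γ u) _).trans ?_
      rw [← Ioc_union_Ioc_eq_Ioc hsu hut, lintegral_union measurableSet_Ioc
        (Ioc_disjoint_Ioc_of_le le_rfl), mul_add]
      exact add_le_add (ih u hu hsu hun)
        (hF.edist_le_of_dist_le hγ hv hu ht hut (hηd u hu t ht hdist).le)
  obtain ⟨n, hn⟩ := exists_nat_ge ((t - s) / (η / 2))
  exact key n t ht hst ((div_le_iff₀ (half_pos hη)).1 hn)

/-- Cauchy-Schwarz in time and then in space. This is the uniform Hölder bound behind compactness.
-/
lemma IsSeparatedFamily.sq_edist_le (hF : IsSeparatedFamily Ω F C₀ δ₀) (hγ : Continuous γ)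
    (hv : IsCE (fun t => F (γ t)) v) {s t : ℝ} (hs : s ∈ Icc (0 : ℝ) 1) (ht : t ∈ Icc (0 : ℝ) 1)
    (hst : s ≤ t) :
    edist (γ s) (γ t) ^ 2 ≤
      (C₀ : ℝ≥0∞) ^ 2 * (ENNReal.ofReal (t - s) * kinetic (fun t => F (γ t)) v (Icc s t)) := by
  have hρ : Continuous fun t => F (γ t) := hF.continuous.comp hγ
  refine (pow_le_pow_left' (hF.edist_le hγ hv hs ht hst) 2).trans ?_
  rw [mul_pow]
  gcongr
  have hm : Measurable fun r => ∫⁻ x, ‖v r x‖ₑ ∂(F (γ r) : Measure (Eu d)) :=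
    measurable_lintegral_curve hρ hv.measurable.enorm
  refine (sq_lintegral_le hm.aemeasurable).trans ?_
  rw [Measure.restrict_apply_univ, Real.volume_Ioc]
  gcongr
  refine (lintegral_mono_set Ioc_subset_Icc_self).trans (lintegral_mono fun r => ?_)
  have hmr : Measurable (v r) := hv.measurable.comp measurable_prodMk_left
  simpa using sq_lintegral_le (μ := (F (γ r) : Measure (Eu d))) hmr.enorm.aemeasurable

end Speed

/-! ### The action between two parameters and its metric properties -/

section Action

variable {d : ℕ} {X : Type*} [MetricSpace X]

/-- The infimum of the energy over the continuous curves from `x` to `y`. -/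
def action (F : X → ProbabilityMeasure (Eu d)) (x y : X) : ℝ≥0∞ :=
  ⨅ (γ : ℝ → X) (_ : Continuous γ) (_ : γ 0 = x) (_ : γ 1 = y), energy fun t => F (γ t)

variable {Ω : Set (Eu d)} {F : X → ProbabilityMeasure (Eu d)} {C₀ : ℝ≥0} {δ₀ : ℝ}
  {γ : ℝ → X} {v : ℝ → Eu d → Eu d} {x y z : X}

lemma action_le_energy (hγ : Continuous γ) (h0 : γ 0 = x) (h1 : γ 1 = y) :
    action F x y ≤ energy fun t => F (γ t) :=
  iInf_le_of_le γ <| iInf_le_of_le hγ <| iInf_le_of_le h0 <| iInf_le_of_le h1 le_rfl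

lemma energy_le_kinetic {ρ : ℝ → ProbabilityMeasure (Eu d)} (h : IsCE ρ v) :
    energy ρ ≤ kinetic ρ v (Icc 0 1) := iInf₂_le v h

lemma exists_kinetic_lt {c : ℝ≥0∞} (h : action F x y < c) :
    ∃ (γ : ℝ → X) (v : ℝ → Eu d → Eu d), Continuous γ ∧ γ 0 = x ∧ γ 1 = y ∧
      IsCE (fun t => F (γ t)) v ∧ kinetic (fun t => F (γ t)) v (Icc 0 1) < c := by
  simp only [action, energy, iInf_lt_iff] at h
  obtain ⟨γ, hγ, h0, h1, v, hv, hlt⟩ := h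
  exact ⟨γ, v, hγ, h0, h1, hv, hlt⟩

/-- The action between two points of a curve. -/
lemma IsSeparatedFamily.action_le_mul_kinetic (hF : IsSeparatedFamily Ω F C₀ δ₀)
    (hγ : Continuous γ) (hv : IsCE (fun t => F (γ t)) v) {s t : ℝ} (hs : s ∈ Icc (0 : ℝ) 1)
    (ht : t ∈ Icc (0 : ℝ) 1) (hst : s < t) :
    action F (γ s) (γ t) ≤ ENNReal.ofReal (t - s) * kinetic (fun t => F (γ t)) v (Icc s t) := by
  have hl : t - s ≠ 0 := (sub_pos.2 hst).ne'
  have himg : ∀ r ∈ Icc (0 : ℝ) 1, s + (t - s) * r ∈ Icc s t := fun r hr => by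
    constructor <;> nlinarith [hr.1, hr.2]
  have hρ : Continuous fun t => F (γ t) := hF.continuous.comp hγ
  have h := hv.rescale hρ hF.compact (fun t => hF.supported _) hl
    fun r hr => Icc_subset_Icc hs.1 ht.2 (himg r hr)
  refine (action_le_energy (γ := fun r => γ (s + (t - s) * r)) (hγ.comp (by fun_prop))
    (by simp) (by simp)).trans ((energy_le_kinetic h).trans ?_)
  rw [kinetic_rescale (c := s) (ρ := fun t => F (γ t)) (v := v) hl measurableSet_Icc (fun _ _ => rfl)
    (fun _ _ => rfl), abs_of_pos (sub_pos.2 hst)]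
  gcongr
  refine lintegral_mono_set ?_
  rintro _ ⟨r, hr, rfl⟩
  exact himg r hr

/-- Time reversal, the affine change of time with `c = 1` and `l = -1`. -/
lemma IsSeparatedFamily.action_symm_le (hF : IsSeparatedFamily Ω F C₀ δ₀) :
    action F x y ≤ action F y x := by
  refine le_of_forall_gt fun c hc => ?_
  obtain ⟨γ, v, hγ, h0, h1, hv, hlt⟩ := exists_kinetic_lt hc
  have himg : ∀ r ∈ Icc (0 : ℝ) 1, 1 + (-1) * r ∈ Icc (0 : ℝ) 1 := fun r hr =>
    ⟨by linarith [hr.2], by linarith [hr.1]⟩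
  have hρ : Continuous fun t => F (γ t) := hF.continuous.comp hγ
  have h := hv.rescale hρ hF.compact (fun t => hF.supported _)
    (neg_ne_zero.2 one_ne_zero) himg
  refine (action_le_energy (γ := fun r => γ (1 + (-1) * r)) (hγ.comp (by fun_prop))
    (by simpa using h1) (by simpa using h0)).trans_lt ((energy_le_kinetic h).trans_lt ?_)
  rw [kinetic_rescale (c := 1) (ρ := fun t => F (γ t)) (v := v) (neg_ne_zero.2 one_ne_zero)
    measurableSet_Icc (fun _ _ => rfl) (fun _ _ => rfl)]
  simp only [abs_neg, abs_one, ENNReal.ofReal_one, one_mul]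
  refine (lintegral_mono_set ?_).trans_lt hlt
  rintro _ ⟨r, hr, rfl⟩
  have := himg r hr
  simpa using this

lemma IsSeparatedFamily.action_comm (hF : IsSeparatedFamily Ω F C₀ δ₀) :
    action F x y = action F y x := le_antisymm hF.action_symm_le hF.action_symm_le

lemma IsSeparatedFamily.action_lt_add (hF : IsSeparatedFamily Ω F C₀ δ₀) {p q : ℝ} (hp : 0 < p)
    (hq : 0 < q) (h₁ : action F x y < ENNReal.ofReal (p ^ 2))
    (h₂ : action F y z < ENNReal.ofReal (q ^ 2)) :
    action F x z ≤ ENNReal.ofReal ((p + q) ^ 2) := by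
  obtain ⟨γ₁, v₁, hγ₁, h10, h11, hv₁, hlt₁⟩ := exists_kinetic_lt h₁
  obtain ⟨γ₂, v₂, hγ₂, h20, h21, hv₂, hlt₂⟩ := exists_kinetic_lt h₂
  -- The switching time that minimizes `p² / a + q² / (1 - a)`, with minimum `(p + q)²`.
  set a : ℝ := p / (p + q)
  have ha : a ∈ Ioo (0 : ℝ) 1 := ⟨by positivity, by rw [div_lt_one (by positivity)]; linarith⟩
  have hmid : γ₁ 1 = γ₂ 0 := h11.trans h20.symm
  have hce := IsCE.concat (hF.continuous.comp hγ₁) (hF.continuous.comp hγ₂) hF.compact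
    (fun _ => hF.supported _) (fun _ => hF.supported _) (congrArg F hmid) hv₁ hv₂ ha
  have hco : (fun t => F (concat a γ₁ γ₂ t)) = concat a (F ∘ γ₁) (F ∘ γ₂) := by
    funext t
    simp only [concat]
    split_ifs <;> rfl
  refine (action_le_energy (continuous_concat ha hγ₁ hγ₂ hmid) ((concat_zero ha _ _).trans h10)
    ((concat_one ha _ _).trans h21)).trans ?_
  rw [hco]
  refine (energy_le_kinetic hce).trans ((kinetic_concat_le ha).trans ?_)
  refine (add_le_add (mul_le_mul_right hlt₁.le _) (mul_le_mul_right hlt₂.le _)).trans ?_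
  have ha' : 0 < 1 - a := sub_pos.2 ha.2
  have ha0 := ha.1
  rw [← ENNReal.ofReal_mul (by positivity), ← ENNReal.ofReal_mul (by positivity),
    ← ENNReal.ofReal_add (by positivity) (by positivity)]
  refine ENNReal.ofReal_le_ofReal (le_of_eq ?_)
  have e1 : 1 - a = q / (p + q) := by simp only [a]; field_simp; ring
  rw [e1]
  simp only [a]
  field_simp

lemma IsSeparatedFamily.sqrt_action_triangle (hF : IsSeparatedFamily Ω F C₀ δ₀) (x y z : X) :
    action F x z ^ (1 / 2 : ℝ) ≤ action F x y ^ (1 / 2 : ℝ) + action F y z ^ (1 / 2 : ℝ) := by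
  have hsq : ∀ a : ℝ≥0∞, (a ^ (1 / 2 : ℝ)) ^ 2 = a := fun a => by
    rw [← ENNReal.rpow_natCast, ← ENNReal.rpow_mul]
    norm_num
  -- The slack supplies the strict bounds, and the positive `p` and `q`, that `action_lt_add`
  -- requires.
  have hlt : ∀ (A : ℝ≥0∞) (_ : A ^ (1 / 2 : ℝ) ≠ ⊤) (ε : ℝ) (_ : 0 < ε),
      A < ENNReal.ofReal (((A ^ (1 / 2 : ℝ)).toReal + ε) ^ 2) := by
    intro A hA ε hε
    rw [ENNReal.ofReal_pow (by positivity)]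
    conv_lhs => rw [← hsq A]
    refine ENNReal.pow_right_strictMono two_ne_zero ?_
    conv_lhs => rw [← ENNReal.ofReal_toReal hA]
    rw [ENNReal.ofReal_lt_ofReal_iff (by positivity)]
    linarith
  by_cases h1 : action F x y ^ (1 / 2 : ℝ) = ⊤
  · rw [h1, top_add]
    exact le_top
  by_cases h2 : action F y z ^ (1 / 2 : ℝ) = ⊤
  · rw [h2, add_top]
    exact le_top
  refine ENNReal.le_of_forall_pos_le_add fun ε hε _ => ?_
  have hε' : (0 : ℝ) < ε / 2 := by positivity
  have h := hF.action_lt_add (by positivity) (by positivity) (hlt _ h1 _ hε') (hlt _ h2 _ hε')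
  rw [ENNReal.ofReal_pow (by positivity), ← hsq (action F x z)] at h
  refine ((ENNReal.pow_le_pow_left_iff two_ne_zero).1 h).trans (le_of_eq ?_)
  rw [show ((action F x y ^ (1 / 2 : ℝ)).toReal + ε / 2 + ((action F y z ^ (1 / 2 : ℝ)).toReal + ε / 2)
    : ℝ) = (action F x y ^ (1 / 2 : ℝ)).toReal + (action F y z ^ (1 / 2 : ℝ)).toReal + ε by ring,
    ENNReal.ofReal_add (by positivity) (by positivity),
    ENNReal.ofReal_add (by positivity) (by positivity), ENNReal.ofReal_toReal h1,
    ENNReal.ofReal_toReal h2, ENNReal.ofReal_coe_nnreal]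

/-- Curves of arbitrarily small energy join the points, and the Hölder bound at times 0 and 1 makes
their distance arbitrarily small. -/
lemma IsSeparatedFamily.eq_of_action_eq_zero (hF : IsSeparatedFamily Ω F C₀ δ₀)
    (h : action F x y = 0) : x = y := by
  have key : ∀ ε : ℝ≥0, 0 < ε → edist x y ^ 2 ≤ (C₀ : ℝ≥0∞) ^ 2 * ε := by
    intro ε hε
    have hlt : action F x y < ε := by rw [h]; exact_mod_cast hε
    obtain ⟨γ, v, hγ, h0, h1, hv, hk⟩ := exists_kinetic_lt hlt
    have := hF.sq_edist_le hγ hv ⟨le_rfl, zero_le_one⟩ ⟨zero_le_one, le_rfl⟩ zero_le_one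
    rw [h0, h1, sub_zero, ENNReal.ofReal_one, one_mul] at this
    exact this.trans (mul_le_mul_right hk.le _)
  have h0 : edist x y ^ 2 ≤ 0 := by
    have hlim : Tendsto (fun ε : ℝ≥0 => (C₀ : ℝ≥0∞) ^ 2 * (ε : ℝ≥0∞)) (𝓝[>] 0) (𝓝 0) := by
      have h3 : Continuous fun ε : ℝ≥0 => (((C₀ ^ 2 * ε : ℝ≥0)) : ℝ≥0∞) := by fun_prop
      have := h3.tendsto 0
      simp only [mul_zero, ENNReal.coe_zero] at this
      refine (this.mono_left nhdsWithin_le_nhds).congr fun ε => by push_cast; rfl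
    refine ge_of_tendsto hlim ?_
    filter_upwards [self_mem_nhdsWithin] with ε hε using key ε hε
  rw [← edist_eq_zero]
  simpa using h0

end Action

/-! ### Duality for the continuity equation -/

section Duality

/-- A linear functional that is bounded by the norm of the image under `T` is represented by a
vector. -/
lemma exists_inner_eq_of_abs_le {V H : Type*} [AddCommGroup V] [Module ℝ V]
    [NormedAddCommGroup H] [InnerProductSpace ℝ H] [CompleteSpace H] (T : V →ₗ[ℝ] H)
    (L : V →ₗ[ℝ] ℝ) {a : ℝ} (ha : 0 ≤ a) (h : ∀ f, |L f| ≤ a * ‖T f‖) :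
    ∃ w : H, ‖w‖ ≤ a ∧ ∀ f, L f = inner ℝ w (T f) := by
  -- The bound forces `L` to vanish on the kernel of `T`, so `L ∘ s` does not depend on the linear
  -- section `s` and is bounded on the range. Hahn-Banach and Riesz then produce the vector.
  obtain ⟨s, hs⟩ := T.rangeRestrict.exists_rightInverse_of_surjective T.range_rangeRestrict
  have hTs : ∀ p, T (s p) = p := fun p => congrArg Subtype.val (LinearMap.congr_fun hs p)
  have hLs : ∀ f, L (s (T.rangeRestrict f)) = L f := by
    intro f
    have h1 := h (s (T.rangeRestrict f) - f)
    rw [map_sub, map_sub, hTs] at h1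
    rw [show ((T.rangeRestrict f : LinearMap.range T) : H) = T f from rfl, sub_self, norm_zero,
      mul_zero] at h1
    exact sub_eq_zero.1 (abs_nonpos_iff.1 h1)
  have hb : ∀ p, ‖(L ∘ₗ s) p‖ ≤ a * ‖p‖ := fun p => by
    have := h (s p)
    rwa [hTs] at this
  obtain ⟨g, hg, hgn⟩ := exists_extension_norm_eq _ ((L ∘ₗ s).mkContinuous a hb)
  refine ⟨(InnerProductSpace.toDual ℝ H).symm g, ?_, fun f => ?_⟩
  · rw [LinearIsometryEquiv.norm_map, hgn]
    exact LinearMap.mkContinuous_norm_le _ ha _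
  · rw [InnerProductSpace.toDual_symm_apply]
    exact ((hg (T.rangeRestrict f)).trans (hLs f)).symm

variable {d : ℕ} {ρ : ℝ → ProbabilityMeasure (Eu d)} {v : ℝ → Eu d → Eu d} {f : ℝ → Eu d → ℝ}
  {Ω : Set (Eu d)}

/-- The functional that a solution `v` of the continuity equation represents on gradients. -/
def weakRate (ρ : ℝ → ProbabilityMeasure (Eu d)) (hρ : Continuous ρ) (f : ℝ → Eu d → ℝ) : ℝ :=
  (∫ x, f 1 x ∂(ρ 1 : Measure (Eu d))) - (∫ x, f 0 x ∂(ρ 0 : Measure (Eu d))) -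
    ∫ z, deriv (fun s => f s z.2) z.1 ∂(spaceTime ρ hρ)

/-- The squared norm of the gradient of a test function. -/
def gradSq (ρ : ℝ → ProbabilityMeasure (Eu d)) (hρ : Continuous ρ) (f : ℝ → Eu d → ℝ) : ℝ :=
  ∫ z, ‖gradient (f z.1) z.2‖ ^ 2 ∂(spaceTime ρ hρ)

lemma IsCE.weakRate_eq (hρ : Continuous ρ) (hΩ : IsCompact Ω)
    (hs : ∀ t, (ρ t : Measure (Eu d)) Ωᶜ = 0) (hv : IsCE ρ v)
    (hf : ContDiff ℝ 1 (Function.uncurry f)) :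
    weakRate ρ hρ f = ∫ z, inner ℝ (gradient (f z.1) z.2) (v z.1 z.2) ∂(spaceTime ρ hρ) := by
  rw [weakRate, ← hv.equation f hf, integral_spaceTime hρ
    (integrable_spaceTime_of_continuous hρ hΩ hs (continuous_deriv_fst hf)),
    integral_spaceTime hρ (integrable_inner_gradient hρ hΩ hs hf hv.measurable hv.integrable)]
  ring

/-- Cauchy-Schwarz on space-time. The resulting inequality no longer mentions the field, only
integrals of continuous functions against the curve, so it can pass to narrow limits. -/
lemma IsCE.sq_weakRate_le (hρ : Continuous ρ) (hΩ : IsCompact Ω)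
    (hs : ∀ t, (ρ t : Measure (Eu d)) Ωᶜ = 0) (hv : IsCE ρ v)
    (hf : ContDiff ℝ 1 (Function.uncurry f)) {K : ℝ} (hK : 0 ≤ K)
    (hk : kinetic ρ v (Icc 0 1) ≤ ENNReal.ofReal K) :
    weakRate ρ hρ f ^ 2 ≤ K * gradSq ρ hρ f := by
  have hg := continuous_gradient hf
  have hvm : Measurable fun z : ℝ × Eu d => ‖v z.1 z.2‖ₑ := hv.measurable.enorm
  have hgsq : ∫⁻ z, ‖gradient (f z.1) z.2‖ₑ ^ 2 ∂(spaceTime ρ hρ) =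
      ENNReal.ofReal (gradSq ρ hρ f) := by
    rw [gradSq, ofReal_integral_eq_lintegral_ofReal
      (integrable_spaceTime_of_continuous hρ hΩ hs (by fun_prop)) (ae_of_all _ fun z => sq_nonneg _)]
    refine lintegral_congr fun z => ?_
    rw [ENNReal.ofReal_pow (norm_nonneg _), ofReal_norm]
  have h0 : 0 ≤ gradSq ρ hρ f := integral_nonneg fun z => sq_nonneg _
  rw [hv.weakRate_eq hρ hΩ hs hf]
  set I := ∫ z, inner ℝ (gradient (f z.1) z.2) (v z.1 z.2) ∂(spaceTime ρ hρ)
  have h1 : ‖I‖ₑ ≤ ∫⁻ z, ‖gradient (f z.1) z.2‖ₑ * ‖v z.1 z.2‖ₑ ∂(spaceTime ρ hρ) := by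
    refine (enorm_integral_le_lintegral_enorm _).trans (lintegral_mono fun z => ?_)
    rw [enorm_eq_nnnorm, enorm_eq_nnnorm, enorm_eq_nnnorm, ← ENNReal.coe_mul]
    exact ENNReal.coe_le_coe.2 (nnnorm_inner_le_nnnorm (𝕜 := ℝ) _ _)
  have h2 := (pow_le_pow_left' h1 2).trans
    (sq_lintegral_mul_le hg.enorm.measurable.aemeasurable hvm.aemeasurable)
  rw [hgsq, lintegral_spaceTime hρ (hvm.pow_const 2)] at h2
  have h3 := h2.trans (mul_le_mul_right hk _)
  rw [← ENNReal.ofReal_mul h0, ← ofReal_norm, ← ENNReal.ofReal_pow (norm_nonneg _),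
    ENNReal.ofReal_le_ofReal_iff (by positivity), Real.norm_eq_abs, sq_abs] at h3
  linarith

/-- The space of test functions. -/
def testFunctions (d : ℕ) : Submodule ℝ (ℝ × Eu d → ℝ) where
  carrier := {f | ContDiff ℝ 1 f}
  add_mem' {f g} (hf : ContDiff ℝ 1 f) (hg : ContDiff ℝ 1 g) := hf.add hg
  zero_mem' := (contDiff_const : ContDiff ℝ 1 fun _ : ℝ × Eu d => (0 : ℝ))
  smul_mem' c f (hf : ContDiff ℝ 1 f) := hf.const_smul c

lemma contDiff_of_mem_testFunctions (f : testFunctions d) : ContDiff ℝ 1 f.1 := f.2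

lemma testFunctions_contDiff (f : testFunctions d) :
    ContDiff ℝ 1 (Function.uncurry fun t x => f.1 (t, x)) := f.2

lemma memLp_gradient (hρ : Continuous ρ) (hΩ : IsCompact Ω)
    (hs : ∀ t, (ρ t : Measure (Eu d)) Ωᶜ = 0) (hf : ContDiff ℝ 1 (Function.uncurry f)) :
    MemLp (fun z : ℝ × Eu d => gradient (f z.1) z.2) 2 (spaceTime ρ hρ) := by
  obtain ⟨R, hR⟩ := exists_ae_bound_spaceTime hρ hΩ hs (continuous_gradient hf)
  exact MemLp.of_bound (continuous_gradient hf).aestronglyMeasurable R hR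

lemma gradient_test_add (f g : testFunctions d) (z : ℝ × Eu d) :
    gradient (fun x => (f + g).1 (z.1, x)) z.2 =
      gradient (fun x => f.1 (z.1, x)) z.2 + gradient (fun x => g.1 (z.1, x)) z.2 := by
  have hd : ∀ f : testFunctions d, DifferentiableAt ℝ (fun x => f.1 (z.1, x)) z.2 := fun f =>
    (((contDiff_of_mem_testFunctions f).comp (contDiff_const.prodMk contDiff_id)).differentiable one_ne_zero _)
  refine HasGradientAt.gradient ?_
  rw [hasGradientAt_iff_hasFDerivAt, map_add]
  exact (hd f).hasGradientAt.hasFDerivAt.add (hd g).hasGradientAt.hasFDerivAt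

lemma gradient_test_smul (c : ℝ) (f : testFunctions d) (z : ℝ × Eu d) :
    gradient (fun x => (c • f).1 (z.1, x)) z.2 = c • gradient (fun x => f.1 (z.1, x)) z.2 :=
  gradient_const_mul (((contDiff_of_mem_testFunctions f).comp (contDiff_const.prodMk contDiff_id)).differentiable one_ne_zero _) c

/-- The gradient as a map to `L²`. -/
def gradientLp (hρ : Continuous ρ) (hΩ : IsCompact Ω)
    (hs : ∀ t, (ρ t : Measure (Eu d)) Ωᶜ = 0) :
    testFunctions d →ₗ[ℝ] Lp (Eu d) 2 (spaceTime ρ hρ) where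
  toFun f := (memLp_gradient hρ hΩ hs (testFunctions_contDiff f)).toLp _
  map_add' f g := by
    rw [← MemLp.toLp_add]
    exact MemLp.toLp_congr _ _ (ae_of_all _ (gradient_test_add f g))
  map_smul' c f := by
    rw [RingHom.id_apply, ← MemLp.toLp_const_smul]
    exact MemLp.toLp_congr _ _ (ae_of_all _ (gradient_test_smul c f))

/-- `weakRate` as a linear functional. -/
def weakRateLinear (hρ : Continuous ρ) (hΩ : IsCompact Ω)
    (hs : ∀ t, (ρ t : Measure (Eu d)) Ωᶜ = 0) : testFunctions d →ₗ[ℝ] ℝ where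
  toFun f := weakRate ρ hρ fun t x => f.1 (t, x)
  map_add' f g := by
    have hi : ∀ (f : testFunctions d) t, Integrable (fun x => f.1 (t, x)) (ρ t : Measure (Eu d)) :=
      fun f t => integrable_of_continuous_of_compact hΩ (hs t)
        ((contDiff_of_mem_testFunctions f).continuous.comp (Continuous.prodMk_right t))
    have hd : ∀ (f : testFunctions d) (z : ℝ × Eu d),
        DifferentiableAt ℝ (fun s => f.1 (s, z.2)) z.1 := fun f z =>
      (((contDiff_of_mem_testFunctions f).comp (contDiff_id.prodMk contDiff_const)).differentiable one_ne_zero _)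
    have hdi : ∀ f : testFunctions d, Integrable
        (fun z : ℝ × Eu d => deriv (fun s => f.1 (s, z.2)) z.1) (spaceTime ρ hρ) := fun f =>
      integrable_spaceTime_of_continuous hρ hΩ hs (continuous_deriv_fst (testFunctions_contDiff f))
    have h1 : ∀ z : ℝ × Eu d, deriv (fun s => f.1 (s, z.2) + g.1 (s, z.2)) z.1 =
        deriv (fun s => f.1 (s, z.2)) z.1 + deriv (fun s => g.1 (s, z.2)) z.1 := fun z =>
      deriv_fun_add (hd f z) (hd g z)
    simp only [weakRate, Submodule.coe_add, Pi.add_apply, h1]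
    rw [integral_add (hi f 1) (hi g 1), integral_add (hi f 0) (hi g 0), integral_add (hdi f) (hdi g)]
    ring
  map_smul' c f := by
    simp only [weakRate, Submodule.coe_smul, Pi.smul_apply, smul_eq_mul, RingHom.id_apply,
      integral_const_mul, deriv_const_mul_field]
    ring

/-- A narrowly continuous curve whose weak rate is bounded by gradients has a velocity field. -/
lemma exists_isCE_of_sq_weakRate_le (hρ : Continuous ρ) (hΩ : IsCompact Ω)
    (hs : ∀ t, (ρ t : Measure (Eu d)) Ωᶜ = 0) {K : ℝ} (hK : 0 ≤ K)
    (h : ∀ f : ℝ → Eu d → ℝ, ContDiff ℝ 1 (Function.uncurry f) →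
      weakRate ρ hρ f ^ 2 ≤ K * gradSq ρ hρ f) :
    ∃ v, IsCE ρ v ∧ kinetic ρ v (Icc 0 1) ≤ ENNReal.ofReal K := by
  have hnorm : ∀ f : testFunctions d, ‖gradientLp hρ hΩ hs f‖ ^ 2 =
      gradSq ρ hρ fun t x => f.1 (t, x) := by
    intro f
    rw [← real_inner_self_eq_norm_sq, L2.inner_def]
    refine integral_congr_ae ?_
    filter_upwards [(memLp_gradient hρ hΩ hs (testFunctions_contDiff f)).coeFn_toLp] with z hz
    rw [← hz, ← real_inner_self_eq_norm_sq]
    rfl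
  obtain ⟨w, hw, hwL⟩ := exists_inner_eq_of_abs_le (gradientLp hρ hΩ hs)
    (weakRateLinear hρ hΩ hs) (Real.sqrt_nonneg K) fun f => by
      refine abs_le_of_sq_le_sq ?_ (by positivity)
      rw [mul_pow, Real.sq_sqrt hK, hnorm]
      exact h _ (testFunctions_contDiff f)
  set w' : ℝ × Eu d → Eu d := ⇑w
  have hwm : Measurable w' := (Lp.stronglyMeasurable w).measurable
  have hwk : ∫⁻ t in Icc (0 : ℝ) 1, ∫⁻ x, ‖w' (t, x)‖ₑ ^ 2 ∂(ρ t : Measure (Eu d)) ≤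
      ENNReal.ofReal K := by
    rw [← lintegral_spaceTime hρ (hwm.enorm.pow_const 2)]
    have h1 : eLpNorm w' 2 (spaceTime ρ hρ) ≤ ENNReal.ofReal √K := by
      rw [← Lp.enorm_def, ← ofReal_norm]
      exact ENNReal.ofReal_le_ofReal hw
    have h2 := eLpNorm_nnreal_pow_eq_lintegral (f := w') (μ := spaceTime ρ hρ) (p := 2) two_ne_zero
    simp only [NNReal.coe_ofNat, ENNReal.coe_ofNat, ENNReal.rpow_ofNat] at h2
    rw [← h2]
    refine (pow_le_pow_left' h1 2).trans ?_
    rw [← ENNReal.ofReal_pow (Real.sqrt_nonneg K), Real.sq_sqrt hK]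
  have hqm : Measurable fun t => ∫⁻ x, ‖w' (t, x)‖ₑ ^ 2 ∂(ρ t : Measure (Eu d)) :=
    measurable_lintegral_curve hρ (hwm.enorm.pow_const 2)
  -- `IsCE` asks for square integrability at every time, but the `L²` representative has it only for
  -- almost every time in `[0,1]`; the field is set to zero at the exceptional times.
  set N : Set ℝ := {t | ∫⁻ x, ‖w' (t, x)‖ₑ ^ 2 ∂(ρ t : Measure (Eu d)) = ⊤}
  have hN : MeasurableSet N := hqm (measurableSet_singleton ⊤)
  have hNae : ∀ᵐ t ∂(volume.restrict (Icc (0 : ℝ) 1)), t ∉ N :=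
    (ae_lt_top hqm (hwk.trans_lt ENNReal.ofReal_lt_top).ne).mono fun t ht => ht.ne
  classical
  set u : ℝ → Eu d → Eu d := fun t x => if t ∈ N then 0 else w' (t, x)
  have hum : Measurable (Function.uncurry u) :=
    Measurable.ite (measurable_fst hN) measurable_const hwm
  have huk : kinetic ρ u (Icc 0 1) ≤ ENNReal.ofReal K := by
    refine le_trans (lintegral_mono fun t => lintegral_mono fun x => ?_) hwk
    simp only [u]
    split_ifs <;> simp
  have humt : ∀ t, Measurable (u t) := fun t => hum.comp measurable_prodMk_left
  have hui : ∫⁻ t in Icc (0 : ℝ) 1, ∫⁻ x, ‖u t x‖ₑ ∂(ρ t : Measure (Eu d)) < ⊤ := by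
    have h1 : (∫⁻ t in Icc (0 : ℝ) 1, ∫⁻ x, ‖u t x‖ₑ ∂(ρ t : Measure (Eu d))) ^ 2 ≤
        ENNReal.ofReal K := by
      refine (sq_lintegral_le (measurable_lintegral_curve hρ hum.enorm).aemeasurable).trans ?_
      rw [Measure.restrict_apply_univ, Real.volume_Icc, sub_zero, ENNReal.ofReal_one, one_mul]
      refine le_trans (lintegral_mono fun t => ?_) huk
      simpa using sq_lintegral_le (μ := (ρ t : Measure (Eu d))) (humt t).enorm.aemeasurable
    rw [lt_top_iff_ne_top]
    intro h2
    rw [h2] at h1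
    simp at h1
  refine ⟨u, ⟨hum, fun t _ => ?_, hui, fun f hf => ?_⟩, huk⟩
  · refine ⟨(humt t).aestronglyMeasurable, ?_⟩
    by_cases ht : t ∈ N
    · have : u t = 0 := by funext x; simp [u, ht]
      simp [this]
    · have h2 := eLpNorm_nnreal_pow_eq_lintegral (f := u t) (μ := (ρ t : Measure (Eu d)))
        (p := 2) two_ne_zero
      simp only [NNReal.coe_ofNat, ENNReal.coe_ofNat, ENNReal.rpow_ofNat] at h2
      have h3 : ∫⁻ x, ‖u t x‖ₑ ^ 2 ∂(ρ t : Measure (Eu d)) < ⊤ := by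
        simp only [u, if_neg ht]
        exact lt_top_iff_ne_top.2 ht
      rw [← h2] at h3
      rw [lt_top_iff_ne_top]
      intro h4
      rw [h4] at h3
      simp at h3
  · have h1 : weakRate ρ hρ f = ∫ t in Icc (0 : ℝ) 1, ∫ x, inner ℝ (gradient (f t) x) (u t x)
        ∂(ρ t : Measure (Eu d)) := by
      have h2 : weakRate ρ hρ f = _ := hwL ⟨Function.uncurry f, hf⟩
      have hint : Integrable (fun z : ℝ × Eu d => inner ℝ (gradient (f z.1) z.2) (w' z))
          (spaceTime ρ hρ) := by
        refine (L2.integrable_inner ((memLp_gradient hρ hΩ hs hf).toLp _) w).congr ?_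
        filter_upwards [(memLp_gradient hρ hΩ hs hf).coeFn_toLp] with z hz
        rw [hz]
      rw [h2, L2.inner_def]
      have h3 : ∫ z, inner ℝ (w z) (gradientLp hρ hΩ hs ⟨Function.uncurry f, hf⟩ z)
          ∂(spaceTime ρ hρ) = ∫ z, inner ℝ (gradient (f z.1) z.2) (w' z) ∂(spaceTime ρ hρ) := by
        refine integral_congr_ae ?_
        filter_upwards [(memLp_gradient hρ hΩ hs hf).coeFn_toLp] with z hz
        rw [real_inner_comm, ← hz]
        rfl
      rw [h3, integral_spaceTime hρ hint]
      refine integral_congr_ae ?_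
      filter_upwards [hNae] with t ht
      simp only [u, if_neg ht]
    rw [← h1, weakRate, integral_spaceTime hρ
      (integrable_spaceTime_of_continuous hρ hΩ hs (continuous_deriv_fst hf))]
    ring

end Duality

/-! ### Lower semicontinuity of the energy and existence of minimizers -/

section LowerSemicontinuity

variable {d : ℕ} {Ω : Set (Eu d)}

/-- An instance of `continuous_integral_of_continuous` whose parameter space is the space of
measures carried by `Ω` itself. -/
lemma tendsto_integral_of_supported (hΩ : IsCompact Ω) {ι : Type*} {l : Filter ι}
    {μs : ι → ProbabilityMeasure (Eu d)} {μ : ProbabilityMeasure (Eu d)}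
    (hs : ∀ n, (μs n : Measure (Eu d)) Ωᶜ = 0) (hs' : (μ : Measure (Eu d)) Ωᶜ = 0)
    (h : Tendsto μs l (𝓝 μ)) {g : Eu d → ℝ} (hg : Continuous g) :
    Tendsto (fun n => ∫ x, g x ∂(μs n : Measure (Eu d))) l (𝓝 (∫ x, g x ∂(μ : Measure (Eu d)))) := by
  have hc := continuous_integral_of_continuous
    (Y := {μ : ProbabilityMeasure (Eu d) // (μ : Measure (Eu d)) Ωᶜ = 0}) hΩ
    continuous_subtype_val (fun y => y.2) (f := fun _ => g) (hg.comp continuous_snd)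
  have ht : Tendsto (fun n => (⟨μs n, hs n⟩ :
      {μ : ProbabilityMeasure (Eu d) // (μ : Measure (Eu d)) Ωᶜ = 0})) l (𝓝 ⟨μ, hs'⟩) :=
    tendsto_subtype_rng.2 h
  exact (hc.tendsto ⟨μ, hs'⟩).comp ht

variable {ρs : ℕ → ℝ → ProbabilityMeasure (Eu d)} {ρ : ℝ → ProbabilityMeasure (Eu d)}

lemma tendsto_integral_spaceTime (hΩ : IsCompact Ω) (hρs : ∀ n, Continuous (ρs n))
    (hρ : Continuous ρ) (hss : ∀ n t, (ρs n t : Measure (Eu d)) Ωᶜ = 0)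
    (hs : ∀ t, (ρ t : Measure (Eu d)) Ωᶜ = 0)
    (hlim : ∀ t ∈ Icc (0 : ℝ) 1, Tendsto (fun n => ρs n t) atTop (𝓝 (ρ t)))
    {g : ℝ × Eu d → ℝ} (hg : Continuous g) :
    Tendsto (fun n => ∫ z, g z ∂(spaceTime (ρs n) (hρs n))) atTop
      (𝓝 (∫ z, g z ∂(spaceTime ρ hρ))) := by
  obtain ⟨R, hR⟩ := (isCompact_Icc.prod hΩ).exists_bound_of_continuousOn
    (hg.continuousOn (s := Icc (0 : ℝ) 1 ×ˢ Ω))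
  have hi := fun n => integrable_spaceTime_of_continuous (hρs n) hΩ (hss n) hg
  simp only [integral_spaceTime (hρs _) (hi _), integral_spaceTime hρ
    (integrable_spaceTime_of_continuous hρ hΩ hs hg)]
  refine tendsto_integral_of_dominated_convergence (fun _ => R)
    (fun n => (integrable_integral_curve (hρs n) (hi n)).aestronglyMeasurable)
    (integrable_const R) (fun n => ?_) ?_
  · filter_upwards [ae_restrict_mem measurableSet_Icc] with t ht
    have h3 : ∀ᵐ x ∂(ρs n t : Measure (Eu d)), ‖g (t, x)‖ ≤ R := by
      have h1 : ∀ᵐ x ∂(ρs n t : Measure (Eu d)), x ∈ Ω := ae_iff.2 (hss n t)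
      filter_upwards [h1] with x hx using hR (t, x) ⟨ht, hx⟩
    simpa using norm_integral_le_of_norm_le_const h3
  · filter_upwards [ae_restrict_mem measurableSet_Icc] with t ht
    exact tendsto_integral_of_supported hΩ (fun n => hss n t) (hs t) (hlim t ht)
      (hg.comp (Continuous.prodMk_right t))

/-- Lower semicontinuity of the energy under pointwise narrow convergence. -/
lemma exists_isCE_of_tendsto (hΩ : IsCompact Ω) (hρs : ∀ n, Continuous (ρs n))
    (hρ : Continuous ρ) (hss : ∀ n t, (ρs n t : Measure (Eu d)) Ωᶜ = 0)
    (hs : ∀ t, (ρ t : Measure (Eu d)) Ωᶜ = 0)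
    (hlim : ∀ t ∈ Icc (0 : ℝ) 1, Tendsto (fun n => ρs n t) atTop (𝓝 (ρ t)))
    {vs : ℕ → ℝ → Eu d → Eu d} (hv : ∀ n, IsCE (ρs n) (vs n)) {K : ℕ → ℝ} {A : ℝ}
    (hK0 : ∀ n, 0 ≤ K n) (hK : Tendsto K atTop (𝓝 A))
    (hk : ∀ n, kinetic (ρs n) (vs n) (Icc 0 1) ≤ ENNReal.ofReal (K n)) :
    ∃ v, IsCE ρ v ∧ kinetic ρ v (Icc 0 1) ≤ ENNReal.ofReal A := by
  -- No limit of the fields `vs n` is taken: by duality only the inequality for each fixed test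
  -- function has to pass to the limit.
  refine exists_isCE_of_sq_weakRate_le hρ hΩ hs (ge_of_tendsto' hK hK0) fun f hf => ?_
  have h0 : (0 : ℝ) ∈ Icc (0 : ℝ) 1 := ⟨le_rfl, zero_le_one⟩
  have h1 : (1 : ℝ) ∈ Icc (0 : ℝ) 1 := ⟨zero_le_one, le_rfl⟩
  have hft : ∀ t, Continuous (f t) := fun t => hf.continuous.comp (Continuous.prodMk_right t)
  have hg := continuous_gradient hf
  have hL : Tendsto (fun n => weakRate (ρs n) (hρs n) f) atTop (𝓝 (weakRate ρ hρ f)) :=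
    ((tendsto_integral_of_supported hΩ (fun n => hss n 1) (hs 1) (hlim 1 h1) (hft 1)).sub
      (tendsto_integral_of_supported hΩ (fun n => hss n 0) (hs 0) (hlim 0 h0) (hft 0))).sub
      (tendsto_integral_spaceTime hΩ hρs hρ hss hs hlim (continuous_deriv_fst hf))
  have hQ : Tendsto (fun n => gradSq (ρs n) (hρs n) f) atTop (𝓝 (gradSq ρ hρ f)) :=
    tendsto_integral_spaceTime hΩ hρs hρ hss hs hlim (by fun_prop)
  exact le_of_tendsto_of_tendsto' (hL.pow 2) (hK.mul hQ) fun n =>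
    (hv n).sq_weakRate_le (hρs n) hΩ (hss n) hf (hK0 n) (hk n)

end LowerSemicontinuity

/-! ### Existence, constant speed and Lipschitz regularity of minimizers -/

section Minimizer

variable {d : ℕ} {X : Type*} [MetricSpace X] {Ω : Set (Eu d)}
  {F : X → ProbabilityMeasure (Eu d)} {C₀ : ℝ≥0} {δ₀ : ℝ} {γ : ℝ → X} {v : ℝ → Eu d → Eu d}
  {x y : X}

/-- Arzelà-Ascoli. The bound itself forces continuity, so as a set of plain functions the family is
cut out by closed pointwise conditions in a compact product. -/
lemma isCompact_setOf_sq_dist_le [CompactSpace X] (c : ℝ) :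
    IsCompact {g : C(unitInterval, X) | ∀ s t, dist (g s) (g t) ^ 2 ≤ c * dist s t} := by
  have hb : Continuous fun r : ℝ => √(c * r) := by fun_prop
  have hmod : ∀ g : unitInterval → X, (∀ s t, dist (g s) (g t) ^ 2 ≤ c * dist s t) →
      ∀ s t, dist (g s) (g t) ≤ √(c * dist s t) := fun g hg s t =>
    Real.le_sqrt_of_sq_le (hg s t)
  refine ArzelaAscoli.isCompact_of_equicontinuous _ ?_ ?_
  · have himg : (fun g : C(unitInterval, X) => g.toFun) ''
        {g | ∀ s t, dist (g s) (g t) ^ 2 ≤ c * dist s t} =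
        {g : unitInterval → X | ∀ s t, dist (g s) (g t) ^ 2 ≤ c * dist s t} := by
      ext g
      constructor
      · rintro ⟨g, hg, rfl⟩
        exact hg
      · intro hg
        have hgc : Continuous g := by
          rw [continuous_iff_continuousAt]
          intro s
          rw [ContinuousAt, tendsto_iff_dist_tendsto_zero]
          have h0 : Tendsto (fun t => √(c * dist t s)) (𝓝 s) (𝓝 0) := by
            have h1 : Continuous fun t => √(c * dist t s) := by fun_prop
            simpa using h1.tendsto s
          exact squeeze_zero (fun _ => dist_nonneg) (fun t => hmod g hg t s) h0
        exact ⟨⟨g, hgc⟩, hg, rfl⟩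
    rw [himg]
    refine IsClosed.isCompact ?_
    simp only [ofPred_forall]
    exact isClosed_iInter fun s => isClosed_iInter fun t =>
      isClosed_le (by fun_prop) continuous_const
  · refine Metric.equicontinuous_of_continuity_modulus (fun r => √(c * r)) ?_ _
      fun s t g => hmod _ g.2 s t
    simpa using hb.tendsto 0

lemma IsSeparatedFamily.sq_dist_le (hF : IsSeparatedFamily Ω F C₀ δ₀) (hγ : Continuous γ)
    (hv : IsCE (fun t => F (γ t)) v) {s t : ℝ} (hs : s ∈ Icc (0 : ℝ) 1) (ht : t ∈ Icc (0 : ℝ) 1)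
    (hst : s ≤ t) {K : ℝ} (hK : 0 ≤ K)
    (hk : kinetic (fun t => F (γ t)) v (Icc s t) ≤ ENNReal.ofReal K) :
    dist (γ s) (γ t) ^ 2 ≤ C₀ ^ 2 * ((t - s) * K) := by
  have h0 : 0 ≤ t - s := sub_nonneg.2 hst
  have h := (hF.sq_edist_le hγ hv hs ht hst).trans
    (mul_le_mul_right (mul_le_mul_right hk _) _)
  rw [edist_dist, ← ENNReal.ofReal_pow dist_nonneg, ← ENNReal.ofReal_mul h0,
    ← ENNReal.ofReal_coe_nnreal, ← ENNReal.ofReal_pow C₀.coe_nonneg,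
    ← ENNReal.ofReal_mul (by positivity), ENNReal.ofReal_le_ofReal_iff (by positivity)] at h
  exact h

/-- The action is attained among continuous curves. -/
lemma IsSeparatedFamily.exists_minimizer [CompactSpace X] (hF : IsSeparatedFamily Ω F C₀ δ₀)
    (h : action F x y ≠ ⊤) :
    ∃ (γ : ℝ → X) (v : ℝ → Eu d → Eu d), Continuous γ ∧ γ 0 = x ∧ γ 1 = y ∧
      IsCE (fun t => F (γ t)) v ∧ kinetic (fun t => F (γ t)) v (Icc 0 1) ≤ action F x y := by
  set A := (action F x y).toReal
  have hA : 0 ≤ A := ENNReal.toReal_nonneg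
  set K : ℕ → ℝ := fun n => A + 1 / ((n : ℝ) + 1)
  have hpos : ∀ n : ℕ, (0 : ℝ) < 1 / ((n : ℝ) + 1) := fun n => Nat.one_div_pos_of_nat
  have hK0 : ∀ n, 0 ≤ K n := fun n => add_nonneg hA (hpos n).le
  have hK1 : ∀ n, K n ≤ A + 1 := fun n => by
    have : 1 / ((n : ℝ) + 1) ≤ 1 := by
      rw [div_le_one (by positivity)]
      linarith [(Nat.cast_nonneg n : (0 : ℝ) ≤ n)]
    simp only [K]
    linarith
  have hKlim : Tendsto K atTop (𝓝 A) := by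
    have := (tendsto_const_nhds (x := A)).add (tendsto_one_div_add_atTop_nhds_zero_nat (𝕜 := ℝ))
    rwa [add_zero] at this
  have hex : ∀ n, action F x y < ENNReal.ofReal (K n) := fun n => by
    rw [← ENNReal.ofReal_toReal h, ENNReal.ofReal_lt_ofReal_iff (by have := hpos n; positivity)]
    exact lt_add_of_pos_right _ (hpos n)
  choose γs vs hγs h0 h1 hvs hks using fun n => exists_kinetic_lt (hex n)
  -- A common Hölder constant for the minimizing sequence, whose energies are all at most `A + 1`.
  set c : ℝ := C₀ ^ 2 * (A + 1)
  set g : ℕ → C(unitInterval, X) := fun n => ⟨fun t => γs n t, (hγs n).comp continuous_subtype_val⟩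
  have hle : ∀ n (s t : unitInterval), s ≤ t → dist (g n s) (g n t) ^ 2 ≤ c * dist s t := by
    intro n s t hst
    have hst' : (s : ℝ) ≤ t := hst
    have hk : kinetic (fun t => F (γs n t)) (vs n) (Icc s t) ≤ ENNReal.ofReal (A + 1) :=
      (lintegral_mono_set (Icc_subset_Icc s.2.1 t.2.2)).trans
        ((hks n).le.trans (ENNReal.ofReal_le_ofReal (hK1 n)))
    have := hF.sq_dist_le (hγs n) (hvs n) s.2 t.2 hst (by positivity) hk
    rw [Subtype.dist_eq, dist_comm (s : ℝ), Real.dist_eq, abs_of_nonneg (sub_nonneg.2 hst')]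
    refine this.trans (le_of_eq ?_)
    simp only [c]
    ring
  have hgmem : ∀ n, g n ∈ {g : C(unitInterval, X) | ∀ s t, dist (g s) (g t) ^ 2 ≤ c * dist s t} := by
    intro n s t
    rcases le_total s t with hst | hst
    · exact hle n s t hst
    · rw [dist_comm, dist_comm s]
      exact hle n t s hst
  obtain ⟨g₀, -, φ, hφ, hlim⟩ := (isCompact_setOf_sq_dist_le c).isSeqCompact hgmem
  have hpt : ∀ t : unitInterval, Tendsto (fun n => γs (φ n) t) atTop (𝓝 (g₀ t)) := fun t =>
    ((continuous_eval_const t).tendsto g₀).comp hlim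
  set γ : ℝ → X := fun t => g₀ (projIcc 0 1 zero_le_one t)
  have hγ : Continuous γ := g₀.continuous.comp continuous_projIcc
  have hγt : ∀ t ∈ Icc (0 : ℝ) 1, Tendsto (fun n => γs (φ n) t) atTop (𝓝 (γ t)) := by
    intro t ht
    simp only [γ, projIcc_of_mem zero_le_one ht]
    exact hpt ⟨t, ht⟩
  obtain ⟨v, hv, hk⟩ := exists_isCE_of_tendsto hF.compact
    (ρs := fun n t => F (γs (φ n) t)) (ρ := fun t => F (γ t))
    (fun n => hF.continuous.comp (hγs _)) (hF.continuous.comp hγ) (fun _ _ => hF.supported _)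
    (fun _ => hF.supported _) (fun t ht => (hF.continuous.tendsto _).comp (hγt t ht))
    (fun n => hvs (φ n)) (fun n => hK0 (φ n)) (hKlim.comp hφ.tendsto_atTop) (fun n => (hks _).le)
  refine ⟨γ, v, hγ, ?_, ?_, hv, by rwa [ENNReal.ofReal_toReal h] at hk⟩
  · refine tendsto_nhds_unique (hγt 0 ⟨le_rfl, zero_le_one⟩) ?_
    simp only [h0]
    exact tendsto_const_nhds
  · refine tendsto_nhds_unique (hγt 1 ⟨zero_le_one, le_rfl⟩) ?_
    simp only [h1]
    exact tendsto_const_nhds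

lemma kinetic_Icc_add (ρ : ℝ → ProbabilityMeasure (Eu d)) (v : ℝ → Eu d → Eu d) {r s t : ℝ}
    (hrs : r ≤ s) (hst : s ≤ t) :
    kinetic ρ v (Icc r t) = kinetic ρ v (Icc r s) + kinetic ρ v (Icc s t) := by
  have h : ∀ a b, kinetic ρ v (Icc a b) = kinetic ρ v (Ioc a b) := fun a b =>
    setLIntegral_congr Ioc_ae_eq_Icc.symm
  rw [h, h, h, ← Ioc_union_Ioc_eq_Ioc hrs hst]
  exact lintegral_union measurableSet_Ioc (Ioc_disjoint_Ioc_of_le le_rfl)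

/-- The equality case of Cauchy-Schwarz: the right side of `h` never exceeds `√W`, and it equals
`√W` only if `k` and `W - k` are in the proportion `t : 1 - t`. -/
lemma eq_mul_of_sqrt_le_add_sqrt {t k W : ℝ} (ht : t ∈ Icc (0 : ℝ) 1) (hk : 0 ≤ k) (hkW : k ≤ W)
    (h : √W ≤ √(t * k) + √((1 - t) * (W - k))) : k = t * W := by
  have h1 : 0 ≤ 1 - t := sub_nonneg.2 ht.2
  have h2 : 0 ≤ W - k := sub_nonneg.2 hkW
  have ht0 := ht.1
  have hW : 0 ≤ W := hk.trans hkW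
  have hsq := pow_le_pow_left₀ (Real.sqrt_nonneg W) h 2
  have hpq : √(t * k) * √((1 - t) * (W - k)) = √(t * (W - k)) * √((1 - t) * k) := by
    rw [← Real.sqrt_mul (by positivity), ← Real.sqrt_mul (by positivity)]
    congr 1
    ring
  have e1 := Real.sq_sqrt (show 0 ≤ t * k by positivity)
  have e2 := Real.sq_sqrt (show 0 ≤ (1 - t) * (W - k) by positivity)
  have e3 := Real.sq_sqrt (show 0 ≤ t * (W - k) by positivity)
  have e4 := Real.sq_sqrt (show 0 ≤ (1 - t) * k by positivity)
  rw [Real.sq_sqrt hW, add_sq, e1, e2, mul_assoc, hpq] at hsq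
  have h5 : (√(t * (W - k)) - √((1 - t) * k)) ^ 2 ≤ 0 := by
    rw [sub_sq, e3, e4]
    linarith
  have h6 : √(t * (W - k)) = √((1 - t) * k) := by
    have := pow_eq_zero_iff two_ne_zero |>.1 (le_antisymm h5 (sq_nonneg _))
    linarith
  rw [← h6, e3] at e4
  linarith

/-- Minimizers have constant speed. -/
lemma IsSeparatedFamily.kinetic_eq_of_minimizer (hF : IsSeparatedFamily Ω F C₀ δ₀)
    (hγ : Continuous γ) (hv : IsCE (fun t => F (γ t)) v)
    (h : action F (γ 0) (γ 1) ≠ ⊤)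
    (hk : kinetic (fun t => F (γ t)) v (Icc 0 1) ≤ action F (γ 0) (γ 1)) {t : ℝ}
    (ht : t ∈ Icc (0 : ℝ) 1) :
    kinetic (fun t => F (γ t)) v (Icc 0 t) =
      ENNReal.ofReal (t * (action F (γ 0) (γ 1)).toReal) := by
  set k := kinetic (fun t => F (γ t)) v (Icc 0 t)
  set W := action F (γ 0) (γ 1)
  have hkW : kinetic (fun t => F (γ t)) v (Icc 0 1) = W :=
    le_antisymm hk ((action_le_energy hγ rfl rfl).trans (energy_le_kinetic hv))
  have hadd : W = k + kinetic (fun t => F (γ t)) v (Icc t 1) := by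
    rw [← hkW, kinetic_Icc_add _ _ ht.1 ht.2]
  have hkle : k ≤ W := hadd ▸ le_self_add
  have hktop : k ≠ ⊤ := ne_top_of_le_ne_top h hkle
  have hk' : kinetic (fun t => F (γ t)) v (Icc t 1) = ENNReal.ofReal (W.toReal - k.toReal) := by
    rw [← ENNReal.toReal_sub_of_le hkle h, ENNReal.ofReal_toReal (ENNReal.sub_ne_top h), hadd,
      ENNReal.add_sub_cancel_left hktop]
  rcases eq_or_lt_of_le ht.1 with rfl | ht0
  · simp [k, kinetic]
  rcases eq_or_lt_of_le ht.2 with rfl | ht1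
  · rw [one_mul, ENNReal.ofReal_toReal h]
    exact hkW
  have h1 := hF.action_le_mul_kinetic hγ hv ⟨le_rfl, zero_le_one⟩ ht ht0
  have h2 := hF.action_le_mul_kinetic hγ hv ht ⟨zero_le_one, le_rfl⟩ ht1
  rw [sub_zero] at h1
  rw [hk', ← ENNReal.ofReal_mul (by linarith)] at h2
  change _ ≤ ENNReal.ofReal t * k at h1
  rw [← ENNReal.ofReal_toReal hktop, ← ENNReal.ofReal_mul ht.1] at h1
  -- The action of each piece is at most its duration times its kinetic energy, so the triangle
  -- inequality becomes `√W ≤ √(t k) + √((1 - t)(W - k))`.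
  have h3 := (hF.sqrt_action_triangle (γ 0) (γ t) (γ 1)).trans
    (add_le_add (ENNReal.rpow_le_rpow h1 (by norm_num)) (ENNReal.rpow_le_rpow h2 (by norm_num)))
  have hkr : k.toReal ≤ W.toReal := ENNReal.toReal_mono h hkle
  have hp : 0 ≤ t * k.toReal := mul_nonneg ht.1 ENNReal.toReal_nonneg
  have hq : 0 ≤ (1 - t) * (W.toReal - k.toReal) :=
    mul_nonneg (by linarith) (sub_nonneg.2 hkr)
  change W ^ (1 / 2 : ℝ) ≤ _ at h3
  conv_lhs at h3 => rw [← ENNReal.ofReal_toReal h]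
  rw [ENNReal.ofReal_rpow_of_nonneg ENNReal.toReal_nonneg (by norm_num),
    ENNReal.ofReal_rpow_of_nonneg hp (by norm_num), ENNReal.ofReal_rpow_of_nonneg hq (by norm_num),
    ← Real.sqrt_eq_rpow, ← Real.sqrt_eq_rpow, ← Real.sqrt_eq_rpow,
    ← ENNReal.ofReal_add (by positivity) (by positivity),
    ENNReal.ofReal_le_ofReal_iff (by positivity)] at h3
  rw [← eq_mul_of_sqrt_le_add_sqrt ht ENNReal.toReal_nonneg hkr h3, ENNReal.ofReal_toReal hktop]

/-- The action is attained by a Lipschitz curve. -/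
lemma IsSeparatedFamily.exists_lipschitz_minimizer [CompactSpace X]
    (hF : IsSeparatedFamily Ω F C₀ δ₀) (h : action F x y ≠ ⊤) :
    ∃ γ : ℝ → X, Continuous γ ∧ γ 0 = x ∧ γ 1 = y ∧ energy (fun t => F (γ t)) = action F x y ∧
      ∃ K : ℝ≥0, LipschitzOnWith K γ (Icc 0 1) := by
  obtain ⟨γ, v, hγ, rfl, rfl, hv, hk⟩ := hF.exists_minimizer h
  set W := (action F (γ 0) (γ 1)).toReal
  have hW : 0 ≤ W := ENNReal.toReal_nonneg
  refine ⟨γ, hγ, rfl, rfl, le_antisymm ((energy_le_kinetic hv).trans hk)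
    (action_le_energy hγ rfl rfl), C₀ * ⟨√W, Real.sqrt_nonneg W⟩, ?_⟩
  have key : ∀ s ∈ Icc (0 : ℝ) 1, ∀ t ∈ Icc (0 : ℝ) 1, s ≤ t →
      dist (γ s) (γ t) ≤ C₀ * √W * dist s t := by
    intro s hs t ht hst
    have hst' : 0 ≤ t - s := sub_nonneg.2 hst
    -- With energy proportional to elapsed time, the Hölder bound becomes `dist² ≤ C₀² W (t - s)²`,
    -- a Lipschitz bound.
    have hkin : kinetic (fun t => F (γ t)) v (Icc s t) = ENNReal.ofReal ((t - s) * W) := by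
      have h1 := kinetic_Icc_add (fun t => F (γ t)) v hs.1 hst
      rw [hF.kinetic_eq_of_minimizer hγ hv h hk hs, hF.kinetic_eq_of_minimizer hγ hv h hk ht] at h1
      have h2 : t * W = s * W + (t - s) * W := by ring
      have hs0 := hs.1
      change ENNReal.ofReal (t * W) = ENNReal.ofReal (s * W) + _ at h1
      rw [h2, ENNReal.ofReal_add (by positivity) (by positivity)] at h1
      exact ((ENNReal.add_right_inj ENNReal.ofReal_ne_top).1 h1).symm
    have h3 := hF.sq_dist_le hγ hv hs ht hst (by positivity) hkin.le
    rw [dist_comm s t, Real.dist_eq, abs_of_nonneg hst']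
    refine (sq_le_sq₀ dist_nonneg (by positivity)).1 ?_
    refine h3.trans (le_of_eq ?_)
    rw [mul_pow, mul_pow, Real.sq_sqrt hW]
    ring
  refine LipschitzOnWith.of_dist_le_mul fun s hs t ht => ?_
  rcases le_total s t with hst | hst
  · exact key s hs t ht hst
  · rw [dist_comm, dist_comm s]
    exact key t ht s hs hst

end Minimizer

/-! ### Narrow continuity from the Wasserstein distance -/

section Wasserstein

variable {d : ℕ} {μ ν : ProbabilityMeasure (Eu d)}

lemma W2_self (μ : ProbabilityMeasure (Eu d)) : W2 μ μ = 0 := by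
  have hm : Measurable fun x : Eu d => (x, x) := by fun_prop
  have hq : Measure.map (fun x : Eu d => (x, x)) (μ : Measure (Eu d)) ∈ couplings μ μ := by
    constructor
    · rw [Measure.fst, Measure.map_map measurable_fst hm]
      exact Measure.map_id
    · rw [Measure.snd, Measure.map_map measurable_snd hm]
      exact Measure.map_id
  have h0 : (⨅ q ∈ couplings μ μ, ∫⁻ z, ‖z.1 - z.2‖ₑ ^ 2 ∂q) = 0 := by
    refine le_antisymm (iInf₂_le_of_le _ hq ?_) zero_le
    rw [lintegral_map (by fun_prop) hm]
    simp
  rw [W2, h0, ENNReal.zero_rpow_of_pos (by norm_num)]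

/-- For each coupling the difference is the integral of `f z.1 - f z.2`, at most `K` times the mean
displacement, which Cauchy-Schwarz bounds by the root mean square. -/
lemma enorm_integral_sub_le_W2 {f : Eu d → ℝ} {K : ℝ≥0} (hf : LipschitzWith K f)
    (hμ : Integrable f (μ : Measure (Eu d))) (hν : Integrable f (ν : Measure (Eu d))) :
    ‖(∫ x, f x ∂(μ : Measure (Eu d))) - ∫ x, f x ∂(ν : Measure (Eu d))‖ₑ ≤ K * W2 μ ν := by
  have key : ∀ q ∈ couplings μ ν,
      ‖(∫ x, f x ∂(μ : Measure (Eu d))) - ∫ x, f x ∂(ν : Measure (Eu d))‖ₑ ≤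
        K * (∫⁻ z, ‖z.1 - z.2‖ₑ ^ 2 ∂q) ^ (1 / 2 : ℝ) := by
    rintro q ⟨h1, h2⟩
    have hq : q univ = 1 := by
      rw [← Measure.fst_univ, h1]
      exact measure_univ
    have hi1 : Integrable (fun z : Eu d × Eu d => f z.1) q := by
      rw [← h1] at hμ
      exact hμ.comp_measurable measurable_fst
    have hi2 : Integrable (fun z : Eu d × Eu d => f z.2) q := by
      rw [← h2] at hν
      exact hν.comp_measurable measurable_snd
    have e1 : ∫ x, f x ∂(μ : Measure (Eu d)) = ∫ z, f z.1 ∂q := by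
      rw [← h1, Measure.fst, integral_map measurable_fst.aemeasurable
        hf.continuous.aestronglyMeasurable]
    have e2 : ∫ x, f x ∂(ν : Measure (Eu d)) = ∫ z, f z.2 ∂q := by
      rw [← h2, Measure.snd, integral_map measurable_snd.aemeasurable
        hf.continuous.aestronglyMeasurable]
    rw [e1, e2, ← integral_sub hi1 hi2]
    have hle : ∫⁻ z, ‖f z.1 - f z.2‖ₑ ∂q ≤ K * ∫⁻ z, ‖z.1 - z.2‖ₑ ∂q := by
      rw [← lintegral_const_mul' _ _ ENNReal.coe_ne_top]
      refine lintegral_mono fun z => ?_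
      simpa only [edist_eq_enorm_sub] using hf z.1 z.2
    refine (enorm_integral_le_lintegral_enorm _).trans (hle.trans ?_)
    gcongr
    have hsq := sq_lintegral_le (μ := q) (f := fun z : Eu d × Eu d => ‖z.1 - z.2‖ₑ)
      (by fun_prop)
    rw [hq, one_mul] at hsq
    have := ENNReal.rpow_le_rpow hsq (show (0 : ℝ) ≤ 1 / 2 by norm_num)
    rwa [← ENNReal.rpow_natCast, ← ENNReal.rpow_mul, show ((2 : ℕ) : ℝ) * (1 / 2) = 1 by norm_num,
      ENNReal.rpow_one] at this
  have hW : W2 μ ν = ⨅ q ∈ couplings μ ν, (∫⁻ z, ‖z.1 - z.2‖ₑ ^ 2 ∂q) ^ (1 / 2 : ℝ) := by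
    change ENNReal.orderIsoRpow (1 / 2 : ℝ) (by norm_num) _ = _
    simp only [OrderIso.map_iInf, ENNReal.orderIsoRpow_apply]
  rw [hW]
  -- A nonzero factor `K` moves inside the infimum; for `K = 0` a single coupling, the product
  -- measure, is enough.
  rcases eq_or_ne K 0 with rfl | hK
  · have hne : (couplings μ ν).Nonempty := by
      refine ⟨(μ : Measure (Eu d)).prod (ν : Measure (Eu d)), ?_, ?_⟩
      · rw [Measure.fst_prod]
      · rw [Measure.snd_prod]
    obtain ⟨q, hq⟩ := hne
    have := key q hq
    rw [ENNReal.coe_zero, zero_mul] at this ⊢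
    exact this
  · simp only [ENNReal.mul_iInf_of_ne (ENNReal.coe_ne_zero.2 hK) ENNReal.coe_ne_top]
    exact le_iInf₂ key

/-- A map into the probability measures that is Lipschitz for the Wasserstein distance is
continuous for narrow convergence. -/
lemma continuous_of_W2_le {X : Type*} [MetricSpace X] {F : X → ProbabilityMeasure (Eu d)} {L : ℝ}
    (h : ∀ x y, W2 (F x) (F y) ≤ ENNReal.ofReal (L * dist x y)) : Continuous F := by
  rw [continuous_iff_continuousAt]
  intro x₀
  refine tendsto_iff_forall_lipschitz_integral_tendsto.2 fun f hb hf => ?_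
  obtain ⟨K, hK⟩ := hf
  obtain ⟨C, hC⟩ := hb
  have hi : ∀ x, Integrable f (F x : Measure (Eu d)) := fun x =>
    Integrable.of_bound hK.continuous.aestronglyMeasurable (‖f 0‖ + C) (ae_of_all _ fun z => by
      have h1 := hC z 0
      rw [dist_eq_norm] at h1
      have h2 := norm_le_norm_add_norm_sub' (f z) (f 0)
      linarith)
  rw [tendsto_iff_edist_tendsto_0]
  have hlim : Tendsto (fun x => (K : ℝ≥0∞) * ENNReal.ofReal (L * dist x x₀)) (𝓝 x₀) (𝓝 0) := by
    have h1 : Continuous fun x => ENNReal.ofReal (K * (L * dist x x₀)) :=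
      ENNReal.continuous_ofReal.comp (by fun_prop)
    have h2 := h1.tendsto x₀
    simp only [dist_self, mul_zero, ENNReal.ofReal_zero] at h2
    refine h2.congr fun x => ?_
    rw [ENNReal.ofReal_mul K.coe_nonneg, ENNReal.ofReal_coe_nnreal]
  refine tendsto_of_tendsto_of_tendsto_of_le_of_le tendsto_const_nhds hlim (fun _ => zero_le)
    fun x => ?_
  rw [edist_eq_enorm_sub]
  refine (enorm_integral_sub_le_W2 hK (hi x) (hi x₀)).trans ?_
  gcongr
  exact h x x₀

end Wasserstein

/-! ### Comparison of the two infima -/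

section Congr

variable {d : ℕ} {ρ ρ' : ℝ → ProbabilityMeasure (Eu d)} {v : ℝ → Eu d → Eu d}

lemma IsCE.congr (h : IsCE ρ v) (hρ : EqOn ρ ρ' (Icc 0 1)) : IsCE ρ' v where
  measurable := h.measurable
  memLp t ht := hρ ht ▸ h.memLp t ht
  integrable := by
    refine lt_of_eq_of_lt (setLIntegral_congr_fun measurableSet_Icc fun t ht => ?_) h.integrable
    simp only [hρ ht]
  equation φ hφ := by
    rw [← hρ ⟨le_rfl, zero_le_one⟩, ← hρ ⟨zero_le_one, le_rfl⟩, ← h.equation φ hφ]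
    congr 1
    · refine setIntegral_congr_fun measurableSet_Icc fun t ht => ?_
      simp only [hρ ht]
    · refine setIntegral_congr_fun measurableSet_Icc fun t ht => ?_
      simp only [hρ ht]

/-- Curves are functions on all of `ℝ`; this allows them to be modified freely outside `[0,1]`. -/
lemma energy_le_of_eqOn (hρ : EqOn ρ ρ' (Icc 0 1)) : energy ρ' ≤ energy ρ := by
  refine le_iInf₂ fun v hv => iInf₂_le_of_le v (hv.congr hρ) (le_of_eq ?_)
  refine setLIntegral_congr_fun measurableSet_Icc fun t ht => ?_
  simp only [hρ ht]

end Congr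

/-! ### Passage between curves in `S` and admissible curves in its image under `E` -/

section Restriction

variable {d m : ℕ} {M : Type*} [MetricSpace M] [ChartedSpace (Eu m) M] [IsManifold (𝓡 m) ∞ M]
  {Ω : Set (Eu d)} {S : Set M} {E : M → ProbabilityMeasure (Eu d)} {μ ν : ProbabilityMeasure (Eu d)}

/-- A Lipschitz path in `S` as a continuous curve in the subtype. -/
lemma IsLipPath.exists_continuous {γ : ℝ → M} (h : IsLipPath S γ) :
    ∃ γ' : ℝ → S, Continuous γ' ∧ ∀ t ∈ Icc (0 : ℝ) 1, (γ' t : M) = γ t := by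
  obtain ⟨hm, K, hK⟩ := h
  refine ⟨fun t => ⟨γ (projIcc 0 1 zero_le_one t), hm (projIcc 0 1 zero_le_one t).2⟩, ?_,
    fun t ht => by simp only [projIcc_of_mem zero_le_one ht]⟩
  exact (hK.continuousOn.domRestrict.comp continuous_projIcc).subtype_mk _

lemma IsEmbedding.injOn (hE : IsEmbedding Ω S E) : InjOn E S := by
  obtain ⟨L, hL, h⟩ := hE.biLipschitz
  intro θ hθ θ' hθ' heq
  have h1 := (h θ hθ θ' hθ').1
  rw [heq, W2_self, nonpos_iff_eq_zero, ENNReal.ofReal_eq_zero] at h1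
  have h2 : dist θ θ' ≤ 0 := by
    by_contra hne
    exact (mul_pos (inv_pos.2 hL) (not_le.1 hne)).not_ge h1
  exact dist_le_zero.1 h2

/-- The curves admissible for the restricted distance lift to Lipschitz paths. -/
lemma IsEmbedding.exists_isLipPath (hE : IsEmbedding Ω S E) {ρ : ℝ → ProbabilityMeasure (Eu d)}
    (hρ : IsLipCurveIn (E '' S) ρ) :
    ∃ γ : ℝ → M, IsLipPath S γ ∧ ∀ t ∈ Icc (0 : ℝ) 1, E (γ t) = ρ t := by
  obtain ⟨L, hL, hLip⟩ := hE.biLipschitz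
  obtain ⟨hmem, K, hK⟩ := hρ
  -- `θ₀` only serves as a default value of the lifted path outside `[0,1]`.
  obtain ⟨θ₀, -, -⟩ := hmem 0 ⟨le_rfl, zero_le_one⟩
  have : ∀ t, ∃ θ : M, t ∈ Icc (0 : ℝ) 1 → θ ∈ S ∧ E θ = ρ t := by
    intro t
    by_cases ht : t ∈ Icc (0 : ℝ) 1
    · obtain ⟨θ, h1, h2⟩ := hmem t ht
      exact ⟨θ, fun _ => ⟨h1, h2⟩⟩
    · exact ⟨θ₀, fun h => absurd h ht⟩
  choose γ hγ using this
  refine ⟨γ, ⟨fun t ht => (hγ t ht).1, L.toNNReal * K, ?_⟩, fun t ht => (hγ t ht).2⟩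
  refine LipschitzOnWith.of_dist_le_mul fun s hs t ht => ?_
  have h1 := (hLip _ (hγ s hs).1 _ (hγ t ht).1).1
  rw [(hγ s hs).2, (hγ t ht).2] at h1
  have h2 := h1.trans (hK s hs t ht)
  rw [← ENNReal.ofReal_coe_nnreal, ← ENNReal.ofReal_mul K.coe_nonneg,
    ENNReal.ofReal_le_ofReal_iff (by positivity), inv_mul_le_iff₀ hL] at h2
  rw [NNReal.coe_mul, Real.coe_toNNReal L hL.le, mul_assoc, Real.dist_eq]
  exact h2

/-- Every admissible curve lifts to a Lipschitz path in `S`, so the infimum defining the action runs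
over a larger class. -/
lemma IsEmbedding.sqrt_action_le_WRestr (hE : IsEmbedding Ω S E) (x y : S) :
    action (fun x : S => E x) x y ^ (1 / 2 : ℝ) ≤ WRestr (E '' S) (E x) (E y) := by
  refine le_iInf₂ fun ρ hρ => ?_
  obtain ⟨hLip, h0, h1⟩ := hρ
  obtain ⟨γ, hγ, hγρ⟩ := hE.exists_isLipPath hLip
  obtain ⟨γ', hγ', heq⟩ := hγ.exists_continuous
  have hc : ∀ t ∈ Icc (0 : ℝ) 1, E (γ' t) = ρ t := fun t ht => by rw [heq t ht, hγρ t ht]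
  have e0 : γ' 0 = x := Subtype.ext (hE.injOn (γ' 0).2 x.2
    ((hc 0 ⟨le_rfl, zero_le_one⟩).trans h0))
  have e1 : γ' 1 = y := Subtype.ext (hE.injOn (γ' 1).2 y.2
    ((hc 1 ⟨zero_le_one, le_rfl⟩).trans h1))
  exact ENNReal.rpow_le_rpow ((action_le_energy hγ' e0 e1).trans
    (energy_le_of_eqOn fun t ht => (hc t ht).symm)) (by norm_num)

lemma IsEmbedding.mem_admissible (hE : IsEmbedding Ω S E) {γ : ℝ → S} {K : ℝ≥0}
    (hγ : LipschitzOnWith K γ (Icc 0 1)) :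
    (fun t => E (γ t)) ∈ admissible (E '' S) (E (γ 0)) (E (γ 1)) := by
  obtain ⟨L, hL, hLip⟩ := hE.biLipschitz
  refine ⟨⟨fun t _ => mem_image_of_mem E (γ t).2, L.toNNReal * K, fun s hs t ht => ?_⟩, rfl, rfl⟩
  refine (hLip _ (γ s).2 _ (γ t).2).2.trans ?_
  rw [← ENNReal.ofReal_coe_nnreal, ← ENNReal.ofReal_mul (NNReal.coe_nonneg _), NNReal.coe_mul,
    Real.coe_toNNReal L hL.le, mul_assoc]
  refine ENNReal.ofReal_le_ofReal (mul_le_mul_of_nonneg_left ?_ hL.le)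
  have := hγ.dist_le_mul s hs t ht
  rwa [Real.dist_eq] at this

variable [Bundle.RiemannianBundle (fun x : M => TangentSpace (𝓡 m) x)]
  [IsContMDiffRiemannianBundle (𝓡 m) ∞ (Eu m) (fun x : M => TangentSpace (𝓡 m) x)]
  [IsRiemannianManifold (𝓡 m) M]
  {D : Set (TangentBundle (𝓡 m) M)} {B : ∀ θ : M, TangentSpace (𝓡 m) θ →ₗ[ℝ] (Eu d → Eu d)}

/-- The geometry of `M` and the fields `B` enter the variational argument only through this lemma
and `exists_action_le`. -/
lemma exists_isSeparatedFamily (hΩ : IsCompact Ω) (hS : IsParameterManifold S D)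
    (hE : IsEmbedding Ω S E) (hB : IsVelocityMap S D E B) (hc : IsConsistent Ω S E B) :
    ∃ C₀ δ₀, IsSeparatedFamily Ω (fun x : S => E x) C₀ δ₀ := by
  obtain ⟨C₀, δ₀, hδ₀, h⟩ := exists_separating_function hΩ hS hE hB hc
  obtain ⟨L, -, hLip⟩ := hE.biLipschitz
  exact ⟨C₀, δ₀, hΩ, continuous_of_W2_le fun x y => (hLip x x.2 y y.2).2,
    fun x => hE.supported x x.2, hδ₀, fun x y hxy => h x x.2 y y.2 hxy⟩

lemma exists_action_le (hΩ : IsCompact Ω) (hS : IsParameterManifold S D)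
    (hE : IsEmbedding Ω S E) (hB : IsVelocityMap S D E B) (hc : IsConsistent Ω S E B) :
    ∃ A : ℝ≥0, ∀ x y : S,
      action (fun x : S => E x) x y ≤ ((A * nndist x y : ℝ≥0) : ℝ≥0∞) ^ 2 := by
  obtain ⟨A, hA⟩ := exists_path_energy_le hΩ hS hE hB hc
  refine ⟨A, fun x y => ?_⟩
  obtain ⟨γ, hγ, h0, h1, hle⟩ := hA x x.2 y y.2
  obtain ⟨γ', hγ', heq⟩ := hγ.exists_continuous
  have e0 : γ' 0 = x := Subtype.ext ((heq 0 ⟨le_rfl, zero_le_one⟩).trans h0)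
  have e1 : γ' 1 = y := Subtype.ext ((heq 1 ⟨zero_le_one, le_rfl⟩).trans h1)
  refine (action_le_energy hγ' e0 e1).trans (le_trans ?_ hle)
  exact energy_le_of_eqOn fun t ht => by simp only [heq t ht]

end Restriction
end
end WSub

/-! ### The metric axioms, the finite diameter and the existence of minimizers -/

theorem mainTheorem10 {d m : ℕ} {M : Type*} [MetricSpace M] [ChartedSpace (WSub.Eu m) M]
    [IsManifold (𝓡 m) ∞ M]
    [Bundle.RiemannianBundle (fun x : M => TangentSpace (𝓡 m) x)]
    [IsContMDiffRiemannianBundle (𝓡 m) ∞ (WSub.Eu m) (fun x : M => TangentSpace (𝓡 m) x)]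
    [IsRiemannianManifold (𝓡 m) M]
    (Ω : Set (WSub.Eu d)) (hΩ : IsCompact Ω) (hΩ' : Convex ℝ Ω)
    (S : Set M) (D : Set (TangentBundle (𝓡 m) M))
    (hS : WSub.IsParameterManifold S D)
    (E : M → ProbabilityMeasure (WSub.Eu d))
    (hE : WSub.IsEmbedding Ω S E)
    (B : ∀ θ : M, TangentSpace (𝓡 m) θ →ₗ[ℝ] (WSub.Eu d → WSub.Eu d))
    (hB : WSub.IsVelocityMap S D E B)
    (hc : WSub.IsConsistent Ω S E B)
    (Λ : Set (ProbabilityMeasure (WSub.Eu d))) (hΛ : Λ = E '' S) :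
    (∃ K : ℝ≥0, ∀ μ ∈ Λ, ∀ ν ∈ Λ, WSub.WRestr Λ μ ν ≤ (K : ℝ≥0∞)) ∧
    (∀ μ ∈ Λ, ∀ ν ∈ Λ, (WSub.WRestr Λ μ ν = 0 ↔ μ = ν)) ∧
    (∀ μ ∈ Λ, ∀ ν ∈ Λ, WSub.WRestr Λ μ ν = WSub.WRestr Λ ν μ) ∧
    (∀ μ ∈ Λ, ∀ ν ∈ Λ, ∀ κ ∈ Λ,
      WSub.WRestr Λ μ κ ≤ WSub.WRestr Λ μ ν + WSub.WRestr Λ ν κ) ∧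
    (∀ μ ∈ Λ, ∀ ν ∈ Λ, ∃ ρ ∈ WSub.admissible Λ μ ν,
      WSub.energy ρ ^ (1 / 2 : ℝ) = WSub.WRestr Λ μ ν) := by
  subst hΛ
  obtain ⟨C₀, δ₀, hF⟩ := WSub.exists_isSeparatedFamily hΩ hS hE hB hc
  obtain ⟨A, hA⟩ := WSub.exists_action_le hΩ hS hE hB hc
  have : CompactSpace S := isCompact_iff_compactSpace.1 hS.compact
  have hfin : ∀ x y : S, WSub.action (fun x : S => E x) x y ≠ ⊤ := fun x y =>
    ne_top_of_le_ne_top (ENNReal.pow_ne_top ENNReal.coe_ne_top) (hA x y)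
  have hmin : ∀ x y : S, ∃ ρ ∈ WSub.admissible (E '' S) (E x) (E y),
      WSub.energy ρ = WSub.action (fun x : S => E x) x y := by
    intro x y
    obtain ⟨γ, -, rfl, rfl, hγ, K, hK⟩ := hF.exists_lipschitz_minimizer (hfin x y)
    exact ⟨_, hE.mem_admissible hK, hγ⟩
  -- The minimizer over continuous curves is Lipschitz, hence admissible, so restricting to
  -- Lipschitz curves does not raise the infimum.
  have hW : ∀ x y : S, WSub.WRestr (E '' S) (E x) (E y) =
      WSub.action (fun x : S => E x) x y ^ (1 / 2 : ℝ) := by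
    intro x y
    obtain ⟨ρ, hρ, h⟩ := hmin x y
    exact le_antisymm (iInf₂_le_of_le ρ hρ (by rw [h])) (hE.sqrt_action_le_WRestr x y)
  -- This bound gives both the finite diameter, as `S` is bounded, and the vanishing on the
  -- diagonal.
  have hWle : ∀ x y : S, WSub.WRestr (E '' S) (E x) (E y) ≤ ((A * nndist x y : ℝ≥0) : ℝ≥0∞) := by
    intro x y
    rw [hW]
    refine (ENNReal.rpow_le_rpow (hA x y) (by norm_num)).trans (le_of_eq ?_)
    rw [← ENNReal.rpow_natCast, ← ENNReal.rpow_mul, show ((2 : ℕ) : ℝ) * (1 / 2) = 1 by norm_num,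
      ENNReal.rpow_one]
  refine ⟨⟨A * ⟨Metric.diam S, Metric.diam_nonneg⟩, ?_⟩, ?_, ?_, ?_, ?_⟩
  · rintro _ ⟨θ, hθ, rfl⟩ _ ⟨θ', hθ', rfl⟩
    refine (hWle ⟨θ, hθ⟩ ⟨θ', hθ'⟩).trans ?_
    rw [ENNReal.coe_le_coe]
    have hd : nndist θ θ' ≤ (⟨Metric.diam S, Metric.diam_nonneg⟩ : ℝ≥0) :=
      Metric.dist_le_diam_of_mem hS.compact.isBounded hθ hθ'
    exact mul_le_mul_right hd A
  · rintro _ ⟨θ, hθ, rfl⟩ _ ⟨θ', hθ', rfl⟩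
    constructor
    · intro h
      rw [hW ⟨θ, hθ⟩ ⟨θ', hθ'⟩, ENNReal.rpow_eq_zero_iff_of_pos (by norm_num)] at h
      have := hF.eq_of_action_eq_zero h
      rw [Subtype.mk.injEq] at this
      rw [this]
    · intro h
      rw [h]
      simpa using hWle ⟨θ', hθ'⟩ ⟨θ', hθ'⟩
  · rintro _ ⟨θ, hθ, rfl⟩ _ ⟨θ', hθ', rfl⟩
    rw [hW ⟨θ, hθ⟩ ⟨θ', hθ'⟩, hW ⟨θ', hθ'⟩ ⟨θ, hθ⟩, hF.action_comm]
  · rintro _ ⟨θ, hθ, rfl⟩ _ ⟨θ', hθ', rfl⟩ _ ⟨θ'', hθ'', rfl⟩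
    rw [hW ⟨θ, hθ⟩ ⟨θ', hθ'⟩, hW ⟨θ', hθ'⟩ ⟨θ'', hθ''⟩, hW ⟨θ, hθ⟩ ⟨θ'', hθ''⟩]
    exact hF.sqrt_action_triangle _ _ _
  · rintro _ ⟨θ, hθ, rfl⟩ _ ⟨θ', hθ', rfl⟩
    obtain ⟨ρ, hρ, h⟩ := hmin ⟨θ, hθ⟩ ⟨θ', hθ'⟩
    exact ⟨ρ, hρ, by rw [h, ← hW ⟨θ, hθ⟩ ⟨θ', hθ'⟩]⟩
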